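/- Let $\mathbb F_q\subseteq k$ be finite fields, $\mathfrak o_0=\mathbb F_q[[\pi_0]]$, $\mathfrak o_K=k[[u]]$, $K=k((u))$, $G_K=\mathrm{Gal}(K^{\mathrm{sep}}/K)$, and let $\iota:\mathfrak o_0\to\mathfrak o_K$ be a finite $\mathbb F_q$-algebra homomorphism; put $u_0=\iota(\pi_0)$ and fix an integer $h\ge 0$. Let $\mathfrak S=\mathfrak o_K[[\pi_0]]$, $\mathfrak o_{\mathcal E}=K[[\pi_0]]$, $\mathcal P=\pi_0-u_0\in\mathfrak S$, and let $\sigma$ be the endomorphism of $\mathfrak S$, of $\mathfrak o_{\mathcal E}$ and of $K^{\mathrm{sep}}[[\pi_0]]$ that is the $q$-th power map on coefficients and fixes $\pi_0$. For a finitely generated $\mathfrak o_{\mathcal E}$-module $M$ with a linear isomorphism $\varphi:\sigma^*M\to M$ put $T_{\mathcal E}(M)=(M\otimes_{\mathfrak o_{\mathcal E}}K^{\mathrm{sep}}[[\pi_0]])^{\varphi=1}$, an $\mathfrak o_0$-module on which $G_K$ acts through the coefficients $K^{\mathrm{sep}}$. Let $\chi_{\mathcal{LT}}:G_K\to\mathfrak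 o_0^\times$ be the character by which $G_K$ acts on $T_{\mathcal E}(\mathfrak o_{\mathcal E}\mathbf e)$, where $\varphi(\sigma^*\mathbf e)=\mathcal P^{-1}\mathbf e$. An effective local shtuka of height $\le h$ is a finite free $\mathfrak S$-module $\mathfrak M$ with an $\mathfrak S$-linear map $\varphi:\sigma^*\mathfrak M\to\mathfrak M$ whose cokernel is killed by $\mathcal P^h$. A finite free $\mathfrak o_0$-module with continuous $G_K$-action is of height $\le h$ if it is isomorphic to $T_{\mathcal E}(\mathfrak M\otimes_{\mathfrak S}\mathfrak o_{\mathcal E})\otimes\chi_{\mathcal{LT}}^h$ for such an $\mathfrak M$. A finitely generated $\pi_0^\infty$-torsion $\mathfrak o_0$-module with continuous $G_K$-action is of height $\le h$ if it is isomorphic to $T/T'$ for finite free $\mathfrak o_0$-modules $T'\subseteq T$ with continuous $G_K$-action, both of height $\le h$. Let $\mathfrak o$ be a complete discrete valuation ring with finite residue field $\mathbb F$, equipped with a local homomorphism $\mathfrak o_0\to\mathfrak o$. Let $\widehat{\mathfrak{AR}}_{\mathfrak o}$ be the category of complete local noetherian $\mathfrak o$-algebras with residue field $\mathbb F$ (via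 the natural map) and local $\mathfrak o$-algebra homomorphisms. Let $\bar\rho:G_K\to GL_d(\mathbb F)$ be a continuous representation which is of height $\le h$. Let $D^\Box$ be the framed deformation functor of $\bar\rho$ on $\widehat{\mathfrak{AR}}_{\mathfrak o}$ (so $D^\Box(A)$ is the set of continuous lifts $G_K\to GL_d(A)$ of $\bar\rho$), and let $D$ be the deformation functor ($D(A)$ is the quotient of $D^\Box(A)$ by conjugation under $\ker(GL_d(A)\to GL_d(\mathbb F))$). Let $D^{\le h}(A)\subseteq D(A)$ and $D^{\Box,\le h}(A)\subseteq D^\Box(A)$ be the subsets of those $\rho_A$ for which $\rho_A\otimes_A A/\mathfrak m_A^n$ is of height $\le h$, as a $\pi_0^\infty$-torsion $\mathfrak o_0$-representation, for every $n$. Then $D^{\le h}\subseteq D$ and $D^{\Box,\le h}\subseteq D^\Box$ are subfunctors, and: (1) $D^{\le h}$ has a hull; (2) if $\mathrm{End}_{G_K}(\bar\rho)\cong\mathbb F$, then $D^{\le h}$ is representable by an object of $\widehat{\mathfrak{AR}}_{\mathfrak o}$; (3) $D^{\Box,\le h}$ is representable by an object of $\widehat{\mathfrak{AR}}_{\mathfrak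 o}$; (4) the inclusions $D^{\le h}\hookrightarrow D$ and $D^{\Box,\le h}\hookrightarrow D^\Box$ are relatively representable by surjective maps: for each $A$ in $\widehat{\mathfrak{AR}}_{\mathfrak o}$ and each $\rho_A$ in $D(A)$ (respectively $D^\Box(A)$), there is a surjection $A\to A^{\le h}$ in $\widehat{\mathfrak{AR}}_{\mathfrak o}$ such that a morphism $f:A\to B$ in $\widehat{\mathfrak{AR}}_{\mathfrak o}$ carries $\rho_A$ into $D^{\le h}(B)$ (respectively $D^{\Box,\le h}(B)$) if and only if $f$ factors through $A^{\le h}$. -/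

import Mathlib

open CategoryTheory IsLocalRing TensorProduct

universe u v w t

namespace EqCharDeformation

/-! ### Semilinear algebra -/

section Semilinear

variable {R : Type u} {S : Type v} [CommRing R] [CommRing S] [Algebra R S]

/-- A ring endomorphism `τ` of `S` lifting the endomorphism `σ` of `R`, as a `σ`-semilinear map. -/
def endoSemilinear (σ : R →+* R) (τ : S →+* S)
    (hτ : ∀ r, τ (algebraMap R S r) = algebraMap R S (σ r)) : S →ₛₗ[σ] S where
  toFun := τ
  map_add' := map_add τ
  map_smul' r s := by rw [Algebra.smul_def, Algebra.smul_def, map_mul, hτ]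

/-- The scalar extension `s ⊗ m ↦ τ s ⊗ φ m` to `S` of a `σ`-semilinear endomorphism `φ`.
A `σ`-semilinear `φ : M → M` is the same thing as a linear map `σ^* M → M`. -/
def baseChangePhi (σ : R →+* R) (τ : S →+* S)
    (hτ : ∀ r, τ (algebraMap R S r) = algebraMap R S (σ r))
    {M : Type w} [AddCommGroup M] [Module R M] (φ : M →ₛₗ[σ] M) :
    S ⊗[R] M →ₛₗ[τ] S ⊗[R] M where
  toFun := TensorProduct.map (endoSemilinear σ τ hτ) φ
  map_add' := map_add _
  map_smul' s x := by
    induction x with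
    | zero => simp
    | add x y hx hy => rw [smul_add, map_add, hx, hy, map_add, smul_add]
    | tmul a m =>
      rw [smul_tmul', TensorProduct.map_tmul, TensorProduct.map_tmul, smul_tmul', smul_eq_mul,
        smul_eq_mul]
      exact congrArg (· ⊗ₜ[R] φ m) (map_mul τ s a)

end Semilinear

/-- The twist `g ↦ χ(g)^n τ(g)` of a representation `τ` by the `n`-th power of a character `χ`. -/
def twist {R : Type u} [CommSemiring R] {G : Type w} [Group G]
    {V : Type t} [AddCommMonoid V] [Module R V]
    (χ : G →* R) (n : ℕ) (τ : Representation R G V) : Representation R G V where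
  toFun g := χ g ^ n • τ g
  map_one' := by simp
  map_mul' g g' := by
    ext x
    simp only [map_mul, mul_pow, LinearMap.smul_apply, Module.End.mul_apply, map_smul, mul_smul]
    exact smul_comm _ _ _


/-! ### The period rings -/

section Rings

/-- `K = k((u))`. -/
abbrev LocalField (k : Type v) [Field k] : Type v := LaurentSeries k

/-- `K^sep`. -/
abbrev Ksep (k : Type v) [Field k] : Type v := SeparableClosure (LocalField k)

/-- The absolute Galois group `Gal(K^sep / K)` of `K = k((u))`, with its Krull topology. -/
abbrev GK (k : Type v) [Field k] : Type v := Ksep k ≃ₐ[LocalField k] Ksep k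

/-- `𝔖 = k[[u]][[π₀]]`. The outer power series variable is `π₀`, the inner one is `u`. -/
def SRing (k : Type v) [Field k] : Type v := PowerSeries (PowerSeries k)

/-- `𝔬_ℰ = K[[π₀]]`. -/
def OE (k : Type v) [Field k] : Type v := PowerSeries (LocalField k)

/-- The completed maximal unramified extension `K^sep[[π₀]]` of `𝔬_ℰ`. -/
def OEur (k : Type v) [Field k] : Type v := PowerSeries (Ksep k)

variable (Fq : Type u) [Field Fq] [Fintype Fq] (k : Type v) [Field k] [Algebra Fq k]

noncomputable instance : CommRing (SRing k) := inferInstanceAs (CommRing (PowerSeries (PowerSeries k)))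
noncomputable instance : CommRing (OE k) := inferInstanceAs (CommRing (PowerSeries (LocalField k)))
noncomputable instance : CommRing (OEur k) := inferInstanceAs (CommRing (PowerSeries (Ksep k)))

noncomputable instance : Algebra Fq (Ksep k) :=
  ((algebraMap (LocalField k) (Ksep k)).comp (algebraMap Fq (LocalField k))).toAlgebra

/-- `𝔖 → 𝔬_ℰ`, coefficientwise the inclusion `k[[u]] → k((u))`. -/
noncomputable instance : Algebra (SRing k) (OE k) :=
  (PowerSeries.map (algebraMap (PowerSeries k) (LocalField k))).toAlgebra

/-- `K[[π₀]] → K^sep[[π₀]]`, coefficientwise the inclusion. -/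
noncomputable instance : Algebra (OE k) (OEur k) :=
  (PowerSeries.map (algebraMap (LocalField k) (Ksep k))).toAlgebra

/-- `𝔽_q[[π₀]] → K[[π₀]]`, coefficientwise the inclusion. -/
noncomputable instance : Algebra (PowerSeries Fq) (OE k) :=
  (PowerSeries.map (algebraMap Fq (LocalField k))).toAlgebra

/-- `𝔽_q[[π₀]] → K^sep[[π₀]]`, coefficientwise the inclusion. -/
noncomputable instance : Algebra (PowerSeries Fq) (OEur k) :=
  (PowerSeries.map (algebraMap Fq (Ksep k))).toAlgebra

instance : IsScalarTower (PowerSeries Fq) (OE k) (OEur k) :=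
  IsScalarTower.of_algebraMap_eq fun x => by
    refine PowerSeries.ext fun n => ?_
    rfl

/-- The partial `q`-Frobenius of `A[[π₀]]`: the `q`-th power map on `A`, and `π₀ ↦ π₀`. -/
noncomputable def partialFrob (A : Type w) [CommRing A] [Algebra Fq A] :
    PowerSeries A →+* PowerSeries A :=
  PowerSeries.map (FiniteField.frobeniusAlgHom Fq A).toRingHom

/-- `σ` on `𝔖`. -/
noncomputable def sigmaS : SRing k →+* SRing k := partialFrob Fq (PowerSeries k)

/-- `σ` on `𝔬_ℰ`. -/
noncomputable def sigmaE : OE k →+* OE k := partialFrob Fq (LocalField k)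

/-- `σ` on `K^sep[[π₀]]`. -/
noncomputable def sigmaUr : OEur k →+* OEur k := partialFrob Fq (Ksep k)

theorem partialFrob_map {A : Type v} {B : Type w} [CommRing A] [CommRing B] [Algebra Fq A]
    [Algebra Fq B] (f : A →+* B) (x : PowerSeries A) :
    partialFrob Fq B (PowerSeries.map f x) = PowerSeries.map f (partialFrob Fq A x) := by
  ext n
  simp [partialFrob]

theorem sigmaE_algebraMap (x : SRing k) :
    sigmaE Fq k (algebraMap (SRing k) (OE k) x) = algebraMap (SRing k) (OE k) (sigmaS Fq k x) :=
  partialFrob_map Fq _ x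

theorem sigmaUr_algebraMap (x : OE k) :
    sigmaUr Fq k (algebraMap (OE k) (OEur k) x) = algebraMap (OE k) (OEur k) (sigmaE Fq k x) :=
  partialFrob_map Fq _ x

theorem sigmaUr_algebraMap_o0 (x : PowerSeries Fq) :
    sigmaUr Fq k (algebraMap (PowerSeries Fq) (OEur k) x) =
      algebraMap (PowerSeries Fq) (OEur k) x := by
  refine (partialFrob_map Fq (algebraMap Fq (Ksep k)) x).trans (congrArg _ ?_)
  ext n
  simp [partialFrob, FiniteField.pow_card]

variable {k}

/-- The coefficientwise action of `g ∈ Gal(K^sep / K)` on `K^sep[[π₀]]`. -/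
noncomputable def galAct (g : GK k) : OEur k →ₐ[OE k] OEur k where
  __ := (PowerSeries.map (g : Ksep k →+* Ksep k) : PowerSeries (Ksep k) →+* PowerSeries (Ksep k))
  commutes' x := by
    refine PowerSeries.ext fun n => ?_
    exact g.commutes (PowerSeries.coeff n x)

theorem coeff_galAct (g : GK k) (x : OEur k) (n : ℕ) :
    PowerSeries.coeff n (galAct g x : PowerSeries (Ksep k)) =
      g (PowerSeries.coeff n (x : PowerSeries (Ksep k))) := rfl

theorem galAct_one : galAct (1 : GK k) = AlgHom.id (OE k) (OEur k) :=
  AlgHom.ext fun _ => PowerSeries.ext fun _ => rfl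

theorem galAct_mul (g g' : GK k) : galAct (g * g') = (galAct g).comp (galAct g') :=
  AlgHom.ext fun _ => PowerSeries.ext fun _ => rfl

theorem sigmaUr_galAct (g : GK k) (x : OEur k) :
    sigmaUr Fq k (galAct g x) = galAct g (sigmaUr Fq k x) :=
  partialFrob_map Fq (g : Ksep k →+* Ksep k) x

end Rings

/-! ### From `φ`-modules over `𝔬_ℰ` to Galois representations -/

section GaloisRep

variable {Fq : Type u} [Field Fq] [Fintype Fq] {k : Type v} [Field k] [Algebra Fq k]
variable {M : Type w} [AddCommGroup M] [Module (OE k) M]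

/-- `φ` on `K^sep[[π₀]] ⊗ M`. -/
noncomputable def phiUr (φ : M →ₛₗ[sigmaE Fq k] M) :
    OEur k ⊗[OE k] M →ₛₗ[sigmaUr Fq k] OEur k ⊗[OE k] M :=
  baseChangePhi (sigmaE Fq k) (sigmaUr Fq k) (sigmaUr_algebraMap Fq k) φ

/-- `T_ℰ(M) = (M ⊗ K^sep[[π₀]])^{φ = 1}`, as an `𝔽_q[[π₀]]`-module. -/
noncomputable def TE (φ : M →ₛₗ[sigmaE Fq k] M) :
    Submodule (PowerSeries Fq) (OEur k ⊗[OE k] M) where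
  carrier := {x | phiUr φ x = x}
  add_mem' {x y} hx hy := by
    rw [Set.mem_ofPred_eq] at *
    rw [map_add, hx, hy]
  zero_mem' := map_zero _
  smul_mem' c x hx := by
    rw [Set.mem_ofPred_eq] at *
    rw [← algebraMap_smul (OEur k) c x, map_smulₛₗ, sigmaUr_algebraMap_o0, hx]

theorem phiUr_rTensor (φ : M →ₛₗ[sigmaE Fq k] M) (g : GK k) (x : OEur k ⊗[OE k] M) :
    phiUr φ ((galAct g).toLinearMap.rTensor M x) =
      (galAct g).toLinearMap.rTensor M (phiUr φ x) := by
  induction x with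
  | zero => simp
  | add x y hx hy => simp only [map_add, hx, hy]
  | tmul a m => exact congrArg (· ⊗ₜ[OE k] φ m) (sigmaUr_galAct Fq g a)

/-- The Galois action on `T_ℰ(M)`, induced by the action on the coefficients `K^sep[[π₀]]`. -/
noncomputable def galRep (φ : M →ₛₗ[sigmaE Fq k] M) :
    Representation (PowerSeries Fq) (GK k) (TE φ) where
  toFun g := (((galAct g).toLinearMap.rTensor M).restrictScalars (PowerSeries Fq)).restrict
    (p := TE φ) (q := TE φ) fun x hx => by
      change phiUr φ _ = _
      rw [LinearMap.restrictScalars_apply, phiUr_rTensor]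
      exact congrArg _ hx
  map_one' := by
    ext x
    simp [LinearMap.restrict_apply, galAct_one]
  map_mul' g g' := by
    ext x
    simp [LinearMap.restrict_apply, galAct_mul, LinearMap.rTensor_comp]

end GaloisRep

/-! ### Effective local shtukas -/

section Shtuka

variable {Fq : Type u} [Field Fq] [Fintype Fq] {k : Type v} [Field k] [Algebra Fq k]

/-- `𝒫(u) = π₀ - u₀ ∈ 𝔖`, where `u₀ = ι(π₀)`. -/
noncomputable def curlyP (ι : PowerSeries Fq →ₐ[Fq] PowerSeries k) : SRing k :=
  (PowerSeries.X - PowerSeries.C (ι PowerSeries.X) : PowerSeries (PowerSeries k))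

/-- An effective local shtuka of height `≤ h`: a finite free `𝔖`-module with a linear map
`σ^* 𝔐 → 𝔐` (given here as a `σ`-semilinear endomorphism `φ`, whose linearization has as image the
span of the range of `φ`) with cokernel killed by `𝒫(u)^h`. -/
structure EffectiveLocalShtuka (ι : PowerSeries Fq →ₐ[Fq] PowerSeries k) (h : ℕ) where
  carrier : Type v
  [addCommGroup : AddCommGroup carrier]
  [module : Module (SRing k) carrier]
  [free : Module.Free (SRing k) carrier]
  [finite : Module.Finite (SRing k) carrier]
  phi : carrier →ₛₗ[sigmaS Fq k] carrier
  height_le : ∀ m : carrier, curlyP ι ^ h • m ∈ Submodule.span (SRing k) (Set.range phi)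

attribute [instance] EffectiveLocalShtuka.addCommGroup EffectiveLocalShtuka.module
  EffectiveLocalShtuka.free EffectiveLocalShtuka.finite

/-- `𝒫(u)⁻¹` in `𝔬_ℰ = K[[π₀]]`. -/
noncomputable def curlyPInv (ι : PowerSeries Fq →ₐ[Fq] PowerSeries k) : OE k :=
  Ring.inverse (algebraMap (SRing k) (OE k) (curlyP ι))

/-- The rank one étale `φ`-module `M_LT = 𝔬_ℰ e`, with `φ(e) = 𝒫(u)⁻¹ e`. -/
noncomputable def phiLT (ι : PowerSeries Fq →ₐ[Fq] PowerSeries k) :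
    OE k →ₛₗ[sigmaE Fq k] OE k where
  toFun x := sigmaE Fq k x * curlyPInv ι
  map_add' x y := by rw [map_add, add_mul]
  map_smul' c x := by rw [smul_eq_mul, smul_eq_mul, map_mul, mul_assoc]

/-- The Lubin-Tate character `χ_LT : Gal(K^sep / K) → 𝔽_q[[π₀]]^×`: the character through which the
Galois group acts on `T_ℰ(M_LT)`, which is free of rank one over `𝔽_q[[π₀]]` (so that the
determinant of the action of `g` is the scalar by which `g` acts). -/
noncomputable def chiLT (ι : PowerSeries Fq →ₐ[Fq] PowerSeries k) : GK k →* PowerSeries Fq :=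
  (LinearMap.det (M := TE (phiLT ι))).comp (galRep (phiLT ι))

variable {ι : PowerSeries Fq →ₐ[Fq] PowerSeries k} {h : ℕ}

/-- `φ` on the étale `φ`-module `𝔐 ⊗ 𝔬_ℰ`. -/
noncomputable def EffectiveLocalShtuka.phiE (𝔐 : EffectiveLocalShtuka ι h) :
    OE k ⊗[SRing k] 𝔐.carrier →ₛₗ[sigmaE Fq k] OE k ⊗[SRing k] 𝔐.carrier :=
  baseChangePhi (sigmaS Fq k) (sigmaE Fq k) (sigmaE_algebraMap Fq k) 𝔐.phi

/-- `T_𝔖^{≤ h}(𝔐) = T_ℰ(𝔐 ⊗ 𝔬_ℰ)(h)`. -/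
noncomputable def EffectiveLocalShtuka.galRep (𝔐 : EffectiveLocalShtuka ι h) :
    Representation (PowerSeries Fq) (GK k) (TE 𝔐.phiE) :=
  twist (chiLT ι) h (EqCharDeformation.galRep 𝔐.phiE)

/-- A lattice Galois representation: a finite free `𝔽_q[[π₀]]`-module `T` with an action of
`Gal(K^sep / K)` that is continuous for the `π₀`-adic topology, i.e. the stabilizer of each element
of each (discrete) quotient `T / π₀^n T` is open. -/
structure IsLatticeRep {T : Type w} [AddCommGroup T] [Module (PowerSeries Fq) T]
    (τ : Representation (PowerSeries Fq) (GK k) T) : Prop where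
  free : Module.Free (PowerSeries Fq) T
  finite : Module.Finite (PowerSeries Fq) T
  continuous : ∀ (n : ℕ) (x : T), IsOpen {g : GK k |
    τ g x - x ∈ Ideal.span {(PowerSeries.X : PowerSeries Fq) ^ n} •
      (⊤ : Submodule (PowerSeries Fq) T)}

/-- A lattice Galois representation of height `≤ h`: one isomorphic to `T_𝔖^{≤ h}(𝔐)` for an
effective local shtuka `𝔐` of height `≤ h`. -/
def LatticeHeightLE (ι : PowerSeries Fq →ₐ[Fq] PowerSeries k) (h : ℕ)
    {T : Type w} [AddCommGroup T] [Module (PowerSeries Fq) T]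
    (τ : Representation (PowerSeries Fq) (GK k) T) : Prop :=
  IsLatticeRep τ ∧ ∃ 𝔐 : EffectiveLocalShtuka ι h, Nonempty (τ.Equiv 𝔐.galRep)

/-- A `π₀^∞`-torsion Galois representation is of height `≤ h` if it is isomorphic to `T / T'` for
lattice Galois representations `T' ⊆ T` of height `≤ h`. -/
def TorsionHeightLE (ι : PowerSeries Fq →ₐ[Fq] PowerSeries k) (h : ℕ)
    {V : Type w} [AddCommGroup V] [Module (PowerSeries Fq) V]
    (τV : Representation (PowerSeries Fq) (GK k) V) : Prop :=
  ∃ (T : Type u) (_ : AddCommGroup T) (_ : Module (PowerSeries Fq) T)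
    (τ : Representation (PowerSeries Fq) (GK k) T)
    (T' : Submodule (PowerSeries Fq) T) (hT' : ∀ g, T' ≤ T'.comap (τ g)),
    LatticeHeightLE ι h τ ∧ LatticeHeightLE ι h (τ.subrepresentation T' hT') ∧
      Nonempty (τV.Equiv (τ.quotient T' hT'))

end Shtuka

/-! ### Complete local noetherian algebras -/

/-- A complete local noetherian `𝔬`-algebra with the same residue field as `𝔬` (through the
structure map). -/
structure CompleteLocalAlg (𝔬 : Type w) [CommRing 𝔬] [IsLocalRing 𝔬] where
  carrier : Type w
  [commRing : CommRing carrier]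
  [isLocalRing : IsLocalRing carrier]
  [isNoetherianRing : IsNoetherianRing carrier]
  [isAdicComplete : IsAdicComplete (maximalIdeal carrier) carrier]
  [algebra : Algebra 𝔬 carrier]
  [isLocalHom : IsLocalHom (algebraMap 𝔬 carrier)]
  residue_surjective : Function.Surjective (algebraMap 𝔬 (ResidueField carrier))

namespace CompleteLocalAlg

attribute [instance] commRing isLocalRing isNoetherianRing isAdicComplete algebra isLocalHom

variable {𝔬 : Type w} [CommRing 𝔬] [IsLocalRing 𝔬]

instance : CoeSort (CompleteLocalAlg 𝔬) (Type w) := ⟨carrier⟩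

/-- Morphisms are local `𝔬`-algebra homomorphisms. -/
@[ext]
structure Hom (A B : CompleteLocalAlg 𝔬) where
  toAlgHom : A →ₐ[𝔬] B
  isLocal : IsLocalHom (toAlgHom : A →+* B)

instance : Category (CompleteLocalAlg 𝔬) where
  Hom A B := Hom A B
  id A := ⟨AlgHom.id 𝔬 A, ⟨fun _ ha => ha⟩⟩
  comp f g := ⟨g.toAlgHom.comp f.toAlgHom,
    ⟨fun a ha => f.isLocal.map_nonunit a (g.isLocal.map_nonunit _ ha)⟩⟩

/-- The underlying ring homomorphism of a morphism. -/
def ringHom {A B : CompleteLocalAlg 𝔬} (f : A ⟶ B) : A →+* B := f.toAlgHom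

instance {A B : CompleteLocalAlg 𝔬} (f : A ⟶ B) : IsLocalHom (ringHom f) := f.isLocal

@[simp] theorem ringHom_id (A : CompleteLocalAlg 𝔬) : ringHom (𝟙 A) = RingHom.id A := rfl

@[simp] theorem ringHom_comp {A B C : CompleteLocalAlg 𝔬} (f : A ⟶ B) (g : B ⟶ C) :
    ringHom (f ≫ g) = (ringHom g).comp (ringHom f) := rfl

theorem ringHom_comp_algebraMap {A B : CompleteLocalAlg 𝔬} (f : A ⟶ B) :
    (ringHom f).comp (algebraMap 𝔬 A) = algebraMap 𝔬 B :=
  f.toAlgHom.comp_algebraMap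

/-- The residue field of `𝔬` maps to that of `A` (isomorphically). -/
noncomputable def residueMap (A : CompleteLocalAlg 𝔬) : ResidueField 𝔬 →+* ResidueField A :=
  ResidueField.map (algebraMap 𝔬 A)

/-- The dual numbers `𝔽[ε]` over the residue field `𝔽` of `𝔬`. -/
noncomputable def dualNumbers (𝔬 : Type w) [CommRing 𝔬] [IsLocalRing 𝔬] : CompleteLocalAlg 𝔬 :=
  have hloc : IsLocalHom (algebraMap 𝔬 (DualNumber (ResidueField 𝔬))) := ⟨fun a ha => by
    have := ha.map (TrivSqZeroExt.fstHom (ResidueField 𝔬) (ResidueField 𝔬) (ResidueField 𝔬))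
    exact (isUnit_map_iff (residue 𝔬) a).1 this⟩
  have hcompl : IsAdicComplete (maximalIdeal (DualNumber (ResidueField 𝔬)))
      (DualNumber (ResidueField 𝔬)) := by
    have hsq : maximalIdeal (DualNumber (ResidueField 𝔬)) ^ 2 = ⊥ := by
      rw [DualNumber.maximalIdeal_eq_span_singleton_eps, Ideal.span_singleton_pow, pow_two,
        DualNumber.eps_mul_eps, Ideal.span_singleton_zero]
    have hzero : ∀ n, 2 ≤ n → maximalIdeal (DualNumber (ResidueField 𝔬)) ^ n = ⊥ := fun n hn =>
      le_bot_iff.1 (hsq ▸ Ideal.pow_le_pow_right hn)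
    exact
      { haus' := fun x hx => by simpa [SModEq.zero, hsq] using hx 2
        prec' := fun f hf => ⟨f 2, fun n => by
          rcases le_total n 2 with hn | hn
          · exact hf hn
          · have := hf hn
            rw [hsq] at this
            rw [hzero n hn]
            exact this.symm⟩ }
  { carrier := DualNumber (ResidueField 𝔬)
    residue_surjective := fun y => by
      obtain ⟨x, rfl⟩ := IsLocalRing.residue_surjective y
      obtain ⟨c, hc⟩ := IsLocalRing.residue_surjective (R := 𝔬) x.fst
      refine ⟨c, ?_⟩
      change residue _ (algebraMap 𝔬 (DualNumber (ResidueField 𝔬)) c) = _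
      rw [← sub_eq_zero, ← map_sub, residue_eq_zero_iff,
        DualNumber.maximalIdeal_eq_span_singleton_eps, Ideal.mem_span_singleton,
        ← DualNumber.fst_eq_zero_iff_eps_dvd, TrivSqZeroExt.fst_sub, ← hc, sub_eq_zero]
      rfl }

end CompleteLocalAlg

/-! ### Deformation functors -/

section Deformation

variable {𝔬 : Type w} [CommRing 𝔬] [IsLocalRing 𝔬] {G : Type v} [Group G] [TopologicalSpace G]
  {d : ℕ}

/-- Continuity of `ρ : G → GL_d(A)` for the `𝔪_A`-adic topology of the local ring `A`. -/
def AdicContinuous {A : Type w} [CommRing A] [IsLocalRing A] (ρ : G →* GL (Fin d) A) : Prop :=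
  letI : TopologicalSpace A := (maximalIdeal A).adicTopology
  Continuous ρ

theorem AdicContinuous.map {A B : Type w} [CommRing A] [CommRing B] [IsLocalRing A] [IsLocalRing B]
    (f : A →+* B) [IsLocalHom f] {ρ : G →* GL (Fin d) A} (hρ : AdicContinuous ρ) :
    AdicContinuous ((Matrix.GeneralLinearGroup.map f).comp ρ) := by
  let : TopologicalSpace A := (maximalIdeal A).adicTopology
  let : TopologicalSpace B := (maximalIdeal B).adicTopology
  have : IsTopologicalRing A :=
    (maximalIdeal A).adic_basis.toRing_subgroups_basis.toRingFilterBasis.isTopologicalRing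
  have : IsTopologicalRing B :=
    (maximalIdeal B).adic_basis.toRing_subgroups_basis.toRingFilterBasis.isTopologicalRing
  have hf : Continuous f := by
    refine continuous_of_continuousAt_zero f ?_
    rw [ContinuousAt, map_zero]
    refine ((maximalIdeal A).hasBasis_nhds_zero_adic.tendsto_iff
      (maximalIdeal B).hasBasis_nhds_zero_adic).2 fun n _ => ⟨n, trivial, fun x hx => ?_⟩
    have h1 : (maximalIdeal A).map f ≤ maximalIdeal B :=
      ((local_hom_TFAE f).out 0 2).1 ‹IsLocalHom f›
    exact Ideal.pow_right_mono h1 n (Ideal.map_pow f _ n ▸ Ideal.mem_map_of_mem f hx)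
  have hM : Continuous
      ((RingHom.mapMatrix f : Matrix (Fin d) (Fin d) A →+* Matrix (Fin d) (Fin d) B) :
        Matrix (Fin d) (Fin d) A →* Matrix (Fin d) (Fin d) B) :=
    Continuous.matrix_map continuous_id hf
  exact (Continuous.units_map _ hM).comp hρ

/-- A framed deformation of `ρbar` to `A`: a continuous lift of `ρbar` to `GL_d(A)`. -/
def FramedDeformation (ρbar : G →* GL (Fin d) (ResidueField 𝔬)) (A : CompleteLocalAlg 𝔬) :
    Type (max v w) :=
  {ρ : G →* GL (Fin d) A // AdicContinuous ρ ∧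
    (Matrix.GeneralLinearGroup.map (residue A)).comp ρ =
      (Matrix.GeneralLinearGroup.map A.residueMap).comp ρbar}

/-- Base change of framed deformations. -/
def FramedDeformation.map {ρbar : G →* GL (Fin d) (ResidueField 𝔬)} {A B : CompleteLocalAlg 𝔬}
    (f : A ⟶ B) (ρ : FramedDeformation ρbar A) : FramedDeformation ρbar B :=
  ⟨(Matrix.GeneralLinearGroup.map (CompleteLocalAlg.ringHom f)).comp ρ.1, ρ.2.1.map _, by
    have hres : (residue B).comp (CompleteLocalAlg.ringHom f) =
        (ResidueField.map (CompleteLocalAlg.ringHom f)).comp (residue A) := rfl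
    have hmap : (ResidueField.map (CompleteLocalAlg.ringHom f)).comp A.residueMap =
        B.residueMap := by
      refine Ideal.Quotient.ringHom_ext ?_
      change (residue B).comp ((CompleteLocalAlg.ringHom f).comp (algebraMap 𝔬 A)) =
        (residue B).comp (algebraMap 𝔬 B)
      rw [CompleteLocalAlg.ringHom_comp_algebraMap]
    rw [← MonoidHom.comp_assoc, ← Matrix.GeneralLinearGroup.map_comp, hres,
      Matrix.GeneralLinearGroup.map_comp, MonoidHom.comp_assoc, ρ.2.2, ← MonoidHom.comp_assoc,
      ← Matrix.GeneralLinearGroup.map_comp, hmap]⟩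

theorem FramedDeformation.map_id {ρbar : G →* GL (Fin d) (ResidueField 𝔬)}
    {A : CompleteLocalAlg 𝔬} (ρ : FramedDeformation ρbar A) :
    FramedDeformation.map (𝟙 A) ρ = ρ := by
  refine Subtype.ext (MonoidHom.ext fun g => ?_)
  change Matrix.GeneralLinearGroup.map (RingHom.id A) (ρ.1 g) = ρ.1 g
  rw [Matrix.GeneralLinearGroup.map_id, MonoidHom.id_apply]

theorem FramedDeformation.map_comp {ρbar : G →* GL (Fin d) (ResidueField 𝔬)}
    {A B C : CompleteLocalAlg 𝔬} (f : A ⟶ B) (f' : B ⟶ C) (ρ : FramedDeformation ρbar A) :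
    FramedDeformation.map (f ≫ f') ρ = FramedDeformation.map f' (FramedDeformation.map f ρ) :=
  Subtype.ext (MonoidHom.ext fun _ => rfl)

/-- Two lifts define the same deformation if they are conjugate under the kernel of
`GL_d(A) → GL_d(𝔽)`. -/
def deformationSetoid (ρbar : G →* GL (Fin d) (ResidueField 𝔬)) (A : CompleteLocalAlg 𝔬) :
    Setoid (FramedDeformation ρbar A) where
  r ρ ρ' := ∃ X : GL (Fin d) A, Matrix.GeneralLinearGroup.map (residue A) X = 1 ∧
    ∀ g, ρ'.1 g = X * ρ.1 g * X⁻¹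
  iseqv :=
    { refl := fun ρ => ⟨1, by simp, by simp⟩
      symm := by
        rintro ρ ρ' ⟨X, hX, h⟩
        exact ⟨X⁻¹, by simp [hX], fun g => by simp [h, mul_assoc]⟩
      trans := by
        rintro ρ ρ' ρ'' ⟨X, hX, h⟩ ⟨Y, hY, h'⟩
        exact ⟨Y * X, by simp [hX, hY], fun g => by simp [h, h', mul_assoc]⟩ }

/-- The framed deformation functor `D^□` of `ρbar`. -/
def framedFunctor (ρbar : G →* GL (Fin d) (ResidueField 𝔬)) :
    CompleteLocalAlg 𝔬 ⥤ Type (max v w) where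
  obj A := FramedDeformation ρbar A
  map f := ↾ (FramedDeformation.map f)
  map_id A := by
    ext ρ
    exact FramedDeformation.map_id ρ
  map_comp f f' := by
    ext ρ
    exact FramedDeformation.map_comp f f' ρ

/-- The deformation functor `D` of `ρbar`. -/
def deformationFunctor (ρbar : G →* GL (Fin d) (ResidueField 𝔬)) :
    CompleteLocalAlg 𝔬 ⥤ Type (max v w) where
  obj A := Quotient (deformationSetoid ρbar A)
  map {A B} f := ↾ (Quotient.map (FramedDeformation.map f) (by
    rintro ρ ρ' ⟨X, hX, h⟩
    refine ⟨Matrix.GeneralLinearGroup.map (CompleteLocalAlg.ringHom f) X, ?_, fun g => ?_⟩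
    · change Matrix.GeneralLinearGroup.map (ResidueField.map (CompleteLocalAlg.ringHom f))
        (Matrix.GeneralLinearGroup.map (residue A) X) = 1
      rw [hX, map_one]
    · change Matrix.GeneralLinearGroup.map (CompleteLocalAlg.ringHom f) (ρ'.1 g) =
        _ * Matrix.GeneralLinearGroup.map (CompleteLocalAlg.ringHom f) (ρ.1 g) * _
      rw [h, map_mul, map_mul, map_inv]))
  map_id A := by
    ext x
    induction x using Quotient.inductionOn with
    | h ρ => exact congrArg _ (FramedDeformation.map_id ρ)
  map_comp f f' := by
    ext x
    induction x using Quotient.inductionOn with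
    | h ρ => exact congrArg _ (FramedDeformation.map_comp f f' ρ)

/-- `ρ : G → GL_d(B)` as a representation on the `R`-module `B^d`, for an `R`-algebra `B`. -/
noncomputable def modRep (R : Type u) [CommRing R] {B : Type w} [CommRing B] [Algebra R B]
    (ρ : G →* GL (Fin d) B) : Representation R G (Fin d → B) where
  toFun g := (Matrix.toLin' (ρ g : Matrix (Fin d) (Fin d) B)).restrictScalars R
  map_one' := by ext; simp
  map_mul' g g' := by ext; simp

/-- The endomorphism algebra of a matrix representation over a field: the matrices commuting with
the image of `ρ`. -/
abbrev endAlgebra {E : Type w} [Field E] (ρ : G →* GL (Fin d) E) :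
    Subalgebra E (Matrix (Fin d) (Fin d) E) :=
  Subalgebra.centralizer E (Set.range fun g => (ρ g : Matrix (Fin d) (Fin d) E))

/-- A pair `(R, ξ)` with `ξ ∈ D(R)` is a hull of `D` if `Hom(R, -) → D` is smooth on artinian
objects and bijective on the tangent spaces. -/
structure IsHull (D : CompleteLocalAlg 𝔬 ⥤ Type t) (R : CompleteLocalAlg 𝔬) (ξ : D.obj R) :
    Prop where
  smooth : ∀ (B A : CompleteLocalAlg 𝔬) [IsArtinianRing B] [IsArtinianRing A] (p : B ⟶ A),
    Function.Surjective (CompleteLocalAlg.ringHom p) →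
      ∀ (f : R ⟶ A) (y : D.obj B), D.map p y = D.map f ξ →
        ∃ f' : R ⟶ B, f' ≫ p = f ∧ D.map f' ξ = y
  tangent : Function.Bijective
    fun f : R ⟶ CompleteLocalAlg.dualNumbers 𝔬 => D.map f ξ

/-- `D` has a hull. -/
def HasHull (D : CompleteLocalAlg 𝔬 ⥤ Type t) : Prop :=
  ∃ (R : CompleteLocalAlg 𝔬) (ξ : D.obj R), IsHull D R ξ

/-- A subfunctor `S` of `D` is relatively representable by surjective maps: for every `A` and every
`x ∈ D(A)`, the fibre product of `Hom(A, -)` and `S` over `D` is represented by a quotient of `A`. -/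
def RelRepresentableBySurjections {D : CompleteLocalAlg 𝔬 ⥤ Type t} (S : Subfunctor D) : Prop :=
  ∀ (A : CompleteLocalAlg 𝔬) (x : D.obj A), ∃ (A' : CompleteLocalAlg 𝔬) (π : A ⟶ A'),
    Function.Surjective (CompleteLocalAlg.ringHom π) ∧
      ∀ (B : CompleteLocalAlg 𝔬) (f : A ⟶ B),
        D.map f x ∈ S.obj B ↔ ∃ f' : A' ⟶ B, π ≫ f' = f

end Deformation

/-! ### Deformations of height `≤ h` -/

section Height

variable {Fq : Type u} [Field Fq] [Fintype Fq] {k : Type v} [Field k] [Algebra Fq k]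
  {𝔬 : Type w} [CommRing 𝔬] [IsLocalRing 𝔬] [Algebra (PowerSeries Fq) 𝔬] {d : ℕ}

/-- A representation over an `𝔬`-algebra `B` that is `π₀^∞`-torsion and finitely generated over
`𝔽_q[[π₀]]` is of height `≤ h` if it is so as a representation on an `𝔽_q[[π₀]]`-module. -/
def RepHeightLE (ι : PowerSeries Fq →ₐ[Fq] PowerSeries k) (h : ℕ) (𝔬 : Type w) [CommRing 𝔬]
    [Algebra (PowerSeries Fq) 𝔬] {B : Type w} [CommRing B] [Algebra 𝔬 B]
    (ρ : GK k →* GL (Fin d) B) : Prop :=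
  letI : Algebra (PowerSeries Fq) B := Algebra.compHom B (algebraMap (PowerSeries Fq) 𝔬)
  TorsionHeightLE ι h (modRep (PowerSeries Fq) ρ)

/-- A lift `ρ` to `A` is of height `≤ h` if all its reductions modulo `𝔪_A^n` are. -/
def FramedDeformation.HeightLE (ι : PowerSeries Fq →ₐ[Fq] PowerSeries k) (h : ℕ)
    {ρbar : GK k →* GL (Fin d) (ResidueField 𝔬)} {A : CompleteLocalAlg 𝔬}
    (ρ : FramedDeformation ρbar A) : Prop :=
  ∀ n : ℕ, RepHeightLE ι h 𝔬
    ((Matrix.GeneralLinearGroup.map (Ideal.Quotient.mk (maximalIdeal A.carrier ^ n))).comp ρ.1)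

/-- The framed deformations to `A` of height `≤ h`. -/
def framedHeightLE (ι : PowerSeries Fq →ₐ[Fq] PowerSeries k) (h : ℕ)
    (ρbar : GK k →* GL (Fin d) (ResidueField 𝔬)) (A : CompleteLocalAlg 𝔬) :
    Set ((framedFunctor ρbar).obj A) :=
  {ρ : FramedDeformation ρbar A | ρ.HeightLE ι h}

/-- The deformations to `A` of height `≤ h`. -/
def deformationHeightLE (ι : PowerSeries Fq →ₐ[Fq] PowerSeries k) (h : ℕ)
    (ρbar : GK k →* GL (Fin d) (ResidueField 𝔬)) (A : CompleteLocalAlg 𝔬) :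
    Set ((deformationFunctor ρbar).obj A) :=
  Quotient.mk (deformationSetoid ρbar A) '' {ρ : FramedDeformation ρbar A | ρ.HeightLE ι h}

end Height

end EqCharDeformation

open EqCharDeformation

/-!
# Deformations of height `≤ h` in equal characteristic

The lifts of height `≤ h` are well behaved because the torsion representations of height `≤ h` are
stable under subrepresentations, quotients and finite products, and because only finitely many of
them live on a given finite module killed by `π₀`. Everything else is formal deformation theory,
which needs no finiteness condition on the Galois group: the finiteness of the set of lifts of
height `≤ h` to the dual numbers takes its place.

**Lattices.** Lang's theorem over a separably closed field, applied coefficient by coefficient,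
shows that the equation `A σ(Y) = Y` is solvable by an invertible matrix `Y` over `Kˢᵉᵖ⟦π₀⟧`. Hence a
lattice of height `≤ h` is, up to the twist by `χ_LT ^ h`, the module of solutions `x` of
`A σ(x) = x`, for matrices `A`, `B` over `𝔖` with `A B = 𝒫 ^ h`. Let `T'` be a Galois stable
sublattice of such a lattice `T` that contains `π₀ ^ N T`. It spans a Galois stable submodule over
`Kˢᵉᵖ⟦π₀⟧`, and the vectors with entries in `𝔖` of this submodule form a module that is
`u`-saturated, hence free over `𝔖`. Galois descent shows that it generates the submodule, and the
Frobenius in a basis of it is again given by a pair of matrices with product `𝒫 ^ h`. So `T'` is of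
height `≤ h` as well (`LatticeHeightLE.subrepresentation`), and the closure properties of torsion
representations follow.

**Finiteness.** A torsion representation of height `≤ h` killed by `π₀` embeds into the solutions
of `A σ(z) = z` for a square matrix `A` over `k⟦u⟧` that divides `u₀ ^ h` and has bounded size. Two
such matrices that agree modulo a high power of `u` are Frobenius conjugate, by a contraction
argument, so that there are only finitely many possibilities.

**Deformation conditions.** A `DeformationCondition` abstracts these facts: stability under base
change, under conjugation and under passing to a ring into which the coefficients embed jointly,
and finiteness over `𝔽[ε]`. Finitely many group elements then separate the lifts to `𝔽[ε]` that
satisfy the condition, and the matrix entries of these elements generate the coefficient ring of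
every such lift that is generated by all its entries, since otherwise there would be a nonzero
derivation killing them. So the universal framed lift exists over a quotient of a power series ring
over `𝔬` in finitely many variables. The ideals modulo which a given lift satisfies the condition
are stable under finite intersections; Chevalley's theorem turns this into relative
representability by surjections.

**The unframed functor.** Finitely many matrix entries of finitely many group elements give
coordinates on the tangent space of the orbit of `ρ̄` under conjugation. Prescribing the values of
these coordinates cuts out a slice: every lift is conjugate to one on the slice, by successive
approximation, and over `𝔽[ε]` to only one. The restriction of the universal framed lift to the
slice is therefore a hull. If only scalars commute with `ρ̄`, two conjugate lifts on the slice are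
equal over every coefficient ring, and the hull represents the functor.
-/

namespace EqCharDeformation

/-! ### Frobenius-semilinear algebra over a separably closed field -/

section Lang

variable {Fq : Type u} [Field Fq] [Fintype Fq] {L : Type v} [Field L] [Algebra Fq L]

local notation "q" => Fintype.card Fq

/-- The `q`-th power endomorphism of an `Fq`-algebra. -/
noncomputable abbrev frob (Fq : Type u) [Field Fq] [Fintype Fq] (A : Type v) [CommRing A]
    [Algebra Fq A] : A →+* A := (FiniteField.frobeniusAlgHom Fq A).toRingHom

variable (Fq) in
theorem card_cast_eq_zero (L : Type v) [Field L] [Algebra Fq L] : ((q : ℕ) : L) = 0 := by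
  have h := congrArg (algebraMap Fq L) (FiniteField.cast_card_eq_zero Fq)
  rwa [map_natCast, map_zero] at h

variable (Fq) in
theorem frob_apply {A : Type v} [CommRing A] [Algebra Fq A] (x : A) : frob Fq A x = x ^ q := rfl

variable (Fq) in
/-- Artin--Schreier: `x ↦ x^q - x` is onto on a separably closed field. -/
theorem exists_pow_card_sub_self [IsSepClosed L] (c : L) : ∃ x : L, x ^ q - x = c := by
  classical
  have hq : 1 < q := Fintype.one_lt_card
  let p : Polynomial L := Polynomial.X ^ q - Polynomial.X - Polynomial.C c
  have hdeg : p.natDegree = q := by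
    have h1 := FiniteField.X_pow_card_sub_X_natDegree_eq L hq
    rw [Polynomial.natDegree_sub_C, h1]
  have hsep : p.Separable := by
    rw [Polynomial.separable_def]
    have : Polynomial.derivative p = -1 := by
      simp [p, Polynomial.derivative_pow, card_cast_eq_zero Fq L]
    rw [this]
    exact isCoprime_one_right.neg_right
  have hd : p.degree ≠ 0 := by
    intro h0
    have := Polynomial.natDegree_eq_zero_iff_degree_le_zero.2 h0.le
    omega
  obtain ⟨x, hx⟩ := IsSepClosed.exists_root p hd hsep
  refine ⟨x, ?_⟩
  simp only [p, Polynomial.IsRoot, Polynomial.eval_sub, Polynomial.eval_pow, Polynomial.eval_X,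
    Polynomial.eval_C] at hx
  linear_combination hx

/-- An element fixed by the `q`-Frobenius lies in `Fq`. -/
theorem exists_algebraMap_of_pow_card {c : L} (hc : c ^ q = c) :
    ∃ a : Fq, algebraMap Fq L a = c := by
  classical
  have hq : 1 < q := Fintype.one_lt_card
  have hne := FiniteField.X_pow_card_sub_X_ne_zero L hq
  have hsub : (Finset.univ.image (algebraMap Fq L)) ⊆
      (Polynomial.X ^ q - Polynomial.X : Polynomial L).roots.toFinset := by
    intro x hx
    obtain ⟨a, -, rfl⟩ := Finset.mem_image.1 hx
    rw [Multiset.mem_toFinset, Polynomial.mem_roots hne]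
    simp [← map_pow, FiniteField.pow_card]
  have hcard : (Polynomial.X ^ q - Polynomial.X : Polynomial L).roots.toFinset.card ≤
      (Finset.univ.image (algebraMap Fq L)).card := by
    rw [Finset.card_image_of_injective _ (algebraMap Fq L).injective, Finset.card_univ]
    refine (Multiset.toFinset_card_le _).trans ((Polynomial.card_roots' _).trans ?_)
    rw [FiniteField.X_pow_card_sub_X_natDegree_eq L hq]
  have hmem : c ∈ (Polynomial.X ^ q - Polynomial.X : Polynomial L).roots.toFinset := by
    rw [Multiset.mem_toFinset, Polynomial.mem_roots hne]
    simp [hc]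
  rw [← Finset.eq_of_subset_of_card_le hsub hcard] at hmem
  obtain ⟨a, -, ha⟩ := Finset.mem_image.1 hmem
  exact ⟨a, ha⟩

variable {V : Type w} [AddCommGroup V] [Module L V]

/-- A semilinear map whose range spans the space carries bases to bases, by counting dimensions. -/
theorem linearIndependent_semilinear [Module.Finite L V] (φ : V →ₛₗ[frob Fq L] V)
    (hφ : Submodule.span L (Set.range φ) = ⊤) {ι : Type*} {b : ι → V}
    (hb : LinearIndependent L b) : LinearIndependent L (φ ∘ b) := by
  classical
  let B := Module.Basis.sumExtend hb
  have := FiniteDimensional.fintypeBasisIndex B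
  have hB : LinearIndependent L (φ ∘ B) := by
    refine linearIndependent_of_top_le_span_of_card_eq_finrank ?_
      (Module.finrank_eq_card_basis B).symm
    rw [← hφ, Submodule.span_le]
    rintro _ ⟨x, rfl⟩
    rw [← B.sum_repr x, map_sum]
    refine Submodule.sum_mem _ fun i _ => ?_
    rw [map_smulₛₗ]
    exact Submodule.smul_mem _ _ (Submodule.subset_span ⟨i, rfl⟩)
  have h2 := hB.comp Sum.inl Sum.inl_injective
  have h3 : ∀ i, B (Sum.inl i) = b i := fun i => by
    simp only [B, Module.Basis.sumExtend, Module.Basis.reindex_apply, Module.Basis.extend_apply_self]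
    rfl
  convert h2 using 1
  ext i
  exact congrArg φ (h3 i).symm

theorem linearIndependent_of_forall_notMem_span (f : ℕ → V) (m : ℕ)
    (h : ∀ s < m, f s ∉ Submodule.span L (f '' Set.Iio s)) :
    LinearIndependent L (fun i : Fin m => f i) := by
  induction m with
  | zero => exact linearIndependent_empty_type
  | succ m ih =>
    rw [linearIndependent_finSucc']
    refine ⟨ih fun s hs => h s (by omega), ?_⟩
    have h1 : Set.range (Fin.init fun i : Fin (m + 1) => f i) = f '' Set.Iio m := by
      ext x
      constructor
      · rintro ⟨i, rfl⟩
        exact ⟨i, i.2, rfl⟩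
      · rintro ⟨i, hi, rfl⟩
        exact ⟨⟨i, hi⟩, rfl⟩
    rw [h1]
    exact h m (by omega)

/-- A polynomial of the form `p - X`, with `p' = 0`, `p(0) = 0` and `p` of degree at least `2`, has a
nonzero root in a separably closed field. -/
theorem exists_root_ne_zero [IsSepClosed L] (p : Polynomial L) (hd : Polynomial.derivative p = 0)
    (h0 : p.eval 0 = 0) (hp : 1 < p.natDegree) : ∃ x : L, x ≠ 0 ∧ p.eval x = x := by
  have hXp : (Polynomial.X : Polynomial L).natDegree < p.natDegree := by
    rwa [Polynomial.natDegree_X]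
  have hdeg : (p - Polynomial.X).natDegree = p.natDegree :=
    Polynomial.natDegree_sub_eq_left_of_natDegree_lt hXp
  have hsep : (p - Polynomial.X).Separable := by
    rw [Polynomial.separable_def]
    have : Polynomial.derivative (p - Polynomial.X) = -1 := by simp [hd]
    rw [this]
    exact isCoprime_one_right.neg_right
  obtain ⟨g, hg⟩ : Polynomial.X ∣ p - Polynomial.X := by
    rw [Polynomial.X_dvd_iff, Polynomial.coeff_zero_eq_eval_zero]
    simp [h0]
  have hg0 : g.eval 0 = -1 := by
    have := congrArg (fun r => Polynomial.eval 0 (Polynomial.derivative r)) hg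
    simp [hd] at this
    exact this.symm
  have hgne : g ≠ 0 := by rintro rfl; simp at hg0
  have hgdeg : g.degree ≠ 0 := by
    intro h
    have h1 := Polynomial.natDegree_eq_zero_iff_degree_le_zero.2 h.le
    rw [hg, Polynomial.natDegree_X_mul hgne, h1] at hdeg
    omega
  obtain ⟨x, hx⟩ := IsSepClosed.exists_root g hgdeg (by
    rw [hg] at hsep; exact hsep.of_mul_right)
  refine ⟨x, ?_, ?_⟩
  · rintro rfl
    rw [Polynomial.IsRoot, hg0] at hx
    simp at hx
  · have := congrArg (Polynomial.eval x) hg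
    rw [Polynomial.eval_mul, hx.eq_zero, mul_zero] at this
    simpa [sub_eq_zero] using this

/-- If the linearization of a Frobenius-semilinear endomorphism of a nonzero finite-dimensional space
is onto, then there is a nonzero fixed vector: on the span of `v, φ v, φ² v, …` the equation for a
fixed vector becomes a single separable additive polynomial equation. -/
theorem exists_fixed_ne_zero [IsSepClosed L] [Module.Finite L V] [Nontrivial V]
    (φ : V →ₛₗ[frob Fq L] V) (hφ : Submodule.span L (Set.range φ) = ⊤) :
    ∃ x : V, x ≠ 0 ∧ φ x = x := by
  classical
  have hq : 1 < q := Fintype.one_lt_card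
  obtain ⟨v, hv⟩ := exists_ne (0 : V)
  let f : ℕ → V := fun i => φ^[i] v
  have hf : ∀ i, φ (f i) = f (i + 1) := fun i => (Function.iterate_succ_apply' φ i v).symm
  have hex : ∃ s, f s ∈ Submodule.span L (f '' Set.Iio s) := by
    by_contra! hcon
    have h1 := linearIndependent_of_forall_notMem_span f (Module.finrank L V + 1)
      fun s _ => hcon s
    have h2 := h1.fintype_card_le_finrank
    rw [Fintype.card_fin] at h2
    omega
  obtain ⟨m, hm⟩ : ∃ m, Nat.find hex = m + 1 := by
    refine Nat.exists_eq_succ_of_ne_zero fun h0 => hv ?_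
    have := Nat.find_spec hex
    rw [h0] at this
    simpa [f] using this
  have hspec := Nat.find_spec hex
  rw [hm] at hspec
  have hind : LinearIndependent L (fun i : Fin (m + 1) => f i) :=
    linearIndependent_of_forall_notMem_span f (m + 1) fun s hs =>
      Nat.find_min hex (by omega)
  obtain ⟨a, ha⟩ : ∃ a : ℕ → L, f (m + 1) = ∑ i ∈ Finset.range (m + 1), a i • f i := by
    have h1 : f '' Set.Iio (m + 1) = Set.range (fun i : Fin (m + 1) => f i) := by
      ext x
      constructor
      · rintro ⟨i, hi, rfl⟩
        exact ⟨⟨i, hi⟩, rfl⟩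
      · rintro ⟨i, rfl⟩
        exact ⟨i, i.2, rfl⟩
    rw [h1, Submodule.mem_span_range_iff_exists_fun] at hspec
    obtain ⟨c, hc⟩ := hspec
    refine ⟨fun i => if h : i < m + 1 then c ⟨i, h⟩ else 0, ?_⟩
    rw [← hc, Finset.sum_range]
    exact Finset.sum_congr rfl fun i _ => by
      dsimp only
      rw [dif_pos i.2]
  have ha0 : a 0 ≠ 0 := by
    intro h0
    have h1 := linearIndependent_semilinear φ hφ hind
    have h2 := (linearIndependent_finSucc'.1 h1).2
    refine h2 ?_
    change φ (f m) ∈ _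
    rw [hf, ha, Finset.sum_range_succ', h0, zero_smul, add_zero]
    refine Submodule.sum_mem _ fun i hi => Submodule.smul_mem _ _ (Submodule.subset_span ?_)
    exact ⟨⟨i, Finset.mem_range.1 hi⟩, hf i⟩
  let C : ℕ → Polynomial L := fun n => Nat.rec (Polynomial.C (a 0) * Polynomial.X ^ q)
    (fun i p => p ^ q + Polynomial.C (a (i + 1)) * Polynomial.X ^ q) n
  have hC0 : C 0 = Polynomial.C (a 0) * Polynomial.X ^ q := rfl
  have hCs : ∀ i, C (i + 1) = C i ^ q + Polynomial.C (a (i + 1)) * Polynomial.X ^ q := fun i => rfl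
  have hCd : ∀ i, Polynomial.derivative (C i) = 0 := by
    intro i
    cases i with
    | zero => simp [hC0, Polynomial.derivative_pow, card_cast_eq_zero Fq L]
    | succ i => simp [hCs, Polynomial.derivative_pow, card_cast_eq_zero Fq L]
  have hCe : ∀ i, (C i).eval 0 = 0 := by
    intro i
    induction i with
    | zero => simp [hC0]
    | succ i ih => simp [hCs, ih]
  have hCn : ∀ i, (C i).natDegree = q ^ (i + 1) := by
    intro i
    induction i with
    | zero => rw [hC0, Polynomial.natDegree_C_mul_X_pow _ _ ha0, zero_add, pow_one]
    | succ i ih =>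
      have h1 : (C i ^ q).natDegree = q ^ (i + 1 + 1) := by
        rw [Polynomial.natDegree_pow, ih, pow_succ _ (i + 1), mul_comm]
      rw [hCs, Polynomial.natDegree_add_eq_left_of_natDegree_lt, h1]
      rw [h1]
      refine (Polynomial.natDegree_C_mul_X_pow_le _ _).trans_lt ?_
      exact lt_self_pow₀ hq (by omega)
  obtain ⟨t, ht0, ht⟩ := exists_root_ne_zero (C m) (hCd m) (hCe m) (by
    rw [hCn]; exact Nat.one_lt_pow (by omega) hq)
  let c : ℕ → L := fun i => (C i).eval t
  have hc0 : c 0 = t ^ q * a 0 := by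
    simp only [c, hC0, Polynomial.eval_mul, Polynomial.eval_C, Polynomial.eval_pow,
      Polynomial.eval_X]
    exact mul_comm _ _
  have hcs : ∀ i, c (i + 1) = c i ^ q + t ^ q * a (i + 1) := fun i => by
    simp only [c, hCs, Polynomial.eval_add, Polynomial.eval_mul, Polynomial.eval_C,
      Polynomial.eval_pow, Polynomial.eval_X]
    exact congrArg _ (mul_comm _ _)
  have hcm : c m = t := ht
  refine ⟨∑ i ∈ Finset.range (m + 1), c i • f i, fun h0 => ?_, ?_⟩
  · rw [Finset.sum_range] at h0
    have := Fintype.linearIndependent_iff.1 hind (fun i => c i) h0 (Fin.last m)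
    exact ht0 (hcm ▸ this)
  · simp only [map_sum, map_smulₛₗ, hf, frob_apply]
    rw [Finset.sum_range_succ, hcm, ha, Finset.smul_sum, Finset.sum_range_succ' _ m,
      Finset.sum_range_succ' _ m, hc0, ← add_assoc, smul_smul, ← Finset.sum_add_distrib]
    refine congrArg₂ _ (Finset.sum_congr rfl fun i _ => ?_) rfl
    rw [hcs, smul_smul, add_smul]

/-- `φ - 1` is onto on the span of the fixed vectors of `φ`. -/
theorem exists_semilinear_sub_self_of_mem_span [IsSepClosed L] (φ : V →ₛₗ[frob Fq L] V) {v : V}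
    (hv : v ∈ Submodule.span L {x : V | φ x = x}) :
    ∃ x ∈ Submodule.span L {x : V | φ x = x}, φ x - x = v := by
  rw [Submodule.mem_span_set'] at hv
  obtain ⟨n, c, g, rfl⟩ := hv
  choose b hb using fun i => exists_pow_card_sub_self Fq (c i)
  refine ⟨∑ i, b i • (g i : V), Submodule.sum_mem _ fun i _ =>
    Submodule.smul_mem _ _ (Submodule.subset_span (g i).2), ?_⟩
  rw [map_sum, ← Finset.sum_sub_distrib]
  refine Finset.sum_congr rfl fun i _ => ?_
  rw [map_smulₛₗ, frob_apply, show φ (g i) = g i from (g i).2, ← sub_smul, hb]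

/-- **Lang's theorem** for `GL_n`, in the language of semilinear maps. -/
theorem span_fixed_eq_top [IsSepClosed L] [Module.Finite L V]
    (φ : V →ₛₗ[frob Fq L] V) (hφ : Submodule.span L (Set.range φ) = ⊤) :
    Submodule.span L {x : V | φ x = x} = ⊤ := by
  classical
  set S := Submodule.span L {x : V | φ x = x} with hS
  by_contra hne
  have hSφ : S ≤ S.comap φ := by
    refine Submodule.span_le.2 fun x hx => ?_
    change φ x ∈ S
    rw [show φ x = x from hx]
    exact Submodule.subset_span hx
  have : Nontrivial (V ⧸ S) := Submodule.Quotient.nontrivial_iff.2 hne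
  let φ' : V ⧸ S →ₛₗ[frob Fq L] V ⧸ S := S.mapQ S φ hSφ
  have hφ' : Submodule.span L (Set.range φ') = ⊤ := by
    have h1 : Set.range φ' = S.mkQ '' Set.range φ := by
      ext x
      constructor
      · rintro ⟨y, rfl⟩
        obtain ⟨y, rfl⟩ := S.mkQ_surjective y
        exact ⟨_, ⟨y, rfl⟩, rfl⟩
      · rintro ⟨_, ⟨y, rfl⟩, rfl⟩
        exact ⟨S.mkQ y, rfl⟩
    rw [h1, Submodule.span_image, hφ, Submodule.map_top, Submodule.range_mkQ]
  obtain ⟨x, hx0, hx⟩ := exists_fixed_ne_zero φ' hφ'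
  obtain ⟨w, rfl⟩ := S.mkQ_surjective x
  have hw : φ w - w ∈ S := by
    rw [← Submodule.Quotient.eq]
    exact hx
  obtain ⟨y, hy, hyw⟩ := exists_semilinear_sub_self_of_mem_span φ hw
  refine hx0 ?_
  rw [Submodule.mkQ_apply, Submodule.Quotient.mk_eq_zero]
  have : w - y ∈ S := Submodule.subset_span (by
    change φ (w - y) = w - y
    rw [map_sub]
    have h2 : φ w = φ y - y + w := by rw [hyw]; abel
    rw [h2]
    abel)
  simpa using add_mem this hy

end Lang

/-! ### Frobenius equations over a power series ring -/

section FrobeniusEquations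

variable {n : Type*} [Fintype n]

/-- Strong recursion on `ℕ`, giving the coefficients of a power series one after the other. -/
theorem exists_strongRec {α : Type*} (F : ∀ m : ℕ, (∀ j < m, α) → α) :
    ∃ z : ℕ → α, ∀ m, z m = F m fun j _ => z j :=
  ⟨(wellFounded_lt (α := ℕ)).fix F, fun m => WellFounded.fix_eq _ F m⟩

variable {Fq : Type u} [Field Fq] [Fintype Fq] {L : Type v} [Field L] [Algebra Fq L]

/-- The Frobenius-semilinear map `x ↦ A x^{(q)}`. -/
noncomputable def matrixPhi (Fq : Type u) [Field Fq] [Fintype Fq] [Algebra Fq L]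
    (A : Matrix n n L) : (n → L) →ₛₗ[frob Fq L] (n → L) where
  toFun x := A.mulVec (frob Fq L ∘ x)
  map_add' x y := by
    have h1 : frob Fq L ∘ (x + y) = frob Fq L ∘ x + frob Fq L ∘ y := by
      ext i; exact map_add (frob Fq L) _ _
    rw [h1, Matrix.mulVec_add]
  map_smul' c x := by
    have h1 : frob Fq L ∘ (c • x) = frob Fq L c • (frob Fq L ∘ x) := by
      ext i; exact map_mul (frob Fq L) _ _
    rw [h1, Matrix.mulVec_smul]

theorem matrixPhi_apply (A : Matrix n n L) (x : n → L) :
    matrixPhi Fq A x = A.mulVec (frob Fq L ∘ x) := rfl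

theorem span_range_matrixPhi [DecidableEq n] {A : Matrix n n L} (hA : IsUnit A.det) :
    Submodule.span L (Set.range (matrixPhi Fq A)) = ⊤ := by
  rw [eq_top_iff]
  rintro y -
  have h1 : y = A.mulVec (A⁻¹.mulVec y) := by
    rw [Matrix.mulVec_mulVec, Matrix.mul_nonsing_inv _ hA, Matrix.one_mulVec]
  rw [h1, Matrix.mulVec_eq_sum]
  refine Submodule.sum_mem _ fun i _ => ?_
  rw [op_smul_eq_smul]
  refine Submodule.smul_mem _ _ (Submodule.subset_span ⟨Pi.single i 1, ?_⟩)
  rw [matrixPhi_apply]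
  have : frob Fq L ∘ (Pi.single i 1 : n → L) = Pi.single i 1 := by
    ext j
    rcases eq_or_ne j i with rfl | h
    · simp
    · simp [h]
  rw [this, Matrix.mulVec_single_one]
  rfl

theorem exists_matrixPhi_sub_self [DecidableEq n] [IsSepClosed L] {A : Matrix n n L}
    (hA : IsUnit A.det) (v : n → L) : ∃ x, matrixPhi Fq A x - x = v := by
  have h := span_fixed_eq_top (matrixPhi Fq A) (span_range_matrixPhi hA)
  obtain ⟨x, -, hx⟩ := exists_semilinear_sub_self_of_mem_span (matrixPhi Fq A) (v := v) (by
    rw [h]; trivial)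
  exact ⟨x, hx⟩

/-- A fixed vector of `A` modulo the variable lifts to a fixed vector of `A`. -/
theorem exists_fixed_lift [DecidableEq n] [IsSepClosed L] {A : Matrix n n (PowerSeries L)}
    (hA : IsUnit A.det) {y₀ : n → L}
    (hy₀ : matrixPhi Fq (A.map (PowerSeries.constantCoeff (R := L))) y₀ = y₀) :
    ∃ y : n → PowerSeries L, A.mulVec (partialFrob Fq L ∘ y) = y ∧
      ∀ i, PowerSeries.constantCoeff (y i) = y₀ i := by
  classical
  set A₀ := A.map (PowerSeries.constantCoeff (R := L)) with hA₀
  have hdet : IsUnit A₀.det := by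
    have := hA.map (PowerSeries.constantCoeff (R := L))
    rwa [RingHom.map_det] at this
  choose S hS using exists_matrixPhi_sub_self (Fq := Fq) hdet
  obtain ⟨z, hz⟩ := exists_strongRec (α := n → L) fun m ih =>
    if m = 0 then y₀ else S (-∑ p ∈ Finset.HasAntidiagonal.antidiagonal m, if h : p.2 < m then
      (A.map (PowerSeries.coeff p.1)).mulVec (frob Fq L ∘ ih p.2 h) else 0)
  have hz0 : z 0 = y₀ := by rw [hz]; simp
  refine ⟨fun i => PowerSeries.mk fun m => z m i, ?_, fun i => by simp [hz0]⟩
  ext i m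
  have hexp : PowerSeries.coeff m (A.mulVec (partialFrob Fq L ∘
      fun i => PowerSeries.mk fun m => z m i) i) = ∑ p ∈ Finset.HasAntidiagonal.antidiagonal m,
        (A.map (PowerSeries.coeff p.1)).mulVec (frob Fq L ∘ z p.2) i := by
    simp only [Matrix.mulVec, dotProduct, map_sum, PowerSeries.coeff_mul, Matrix.map_apply]
    rw [Finset.sum_comm]
    refine Finset.sum_congr rfl fun p _ => Finset.sum_congr rfl fun j _ => ?_
    simp [partialFrob]
  rw [hexp, PowerSeries.coeff_mk]
  rcases Nat.eq_zero_or_pos m with rfl | hm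
  · simp only [Finset.Nat.antidiagonal_zero, Finset.sum_singleton, hz0]
    have := congrFun hy₀ i
    rw [matrixPhi_apply] at this
    simpa [hA₀] using this
  · have h1 := hS (-∑ p ∈ Finset.HasAntidiagonal.antidiagonal m, if h : p.2 < m then
      (A.map (PowerSeries.coeff p.1)).mulVec (frob Fq L ∘ z p.2) else 0)
    have h2 := hz m
    rw [if_neg hm.ne'] at h2
    rw [← h2] at h1
    have h3 : matrixPhi Fq A₀ (z m) = (A.map (PowerSeries.coeff 0)).mulVec (frob Fq L ∘ z m) := by
      rw [matrixPhi_apply, hA₀]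
      congr 2
      ext
      simp
    have h4 := congrFun h1 i
    have h5 : ∀ p ∈ Finset.HasAntidiagonal.antidiagonal m, (A.map (PowerSeries.coeff p.1)).mulVec
        (frob Fq L ∘ z p.2) i = (if h : p.2 < m then
        (A.map (PowerSeries.coeff p.1)).mulVec (frob Fq L ∘ z p.2) else 0) i +
        if p = (0, m) then (A.map (PowerSeries.coeff 0)).mulVec (frob Fq L ∘ z m) i else 0 := by
      rintro ⟨a, b⟩ hp
      rw [Finset.HasAntidiagonal.mem_antidiagonal] at hp
      dsimp only at *
      by_cases hb : b < m
      · rw [dif_pos hb, if_neg (by rintro ⟨⟩; omega), add_zero]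
      · obtain rfl : b = m := by omega
        obtain rfl : a = 0 := by omega
        simp
    rw [Finset.sum_congr rfl h5, Finset.sum_add_distrib, Finset.sum_ite_eq',
      if_pos (by simp [Finset.HasAntidiagonal.mem_antidiagonal]), ← Finset.sum_apply, ← h3]
    simp only [Pi.sub_apply, Pi.neg_apply] at h4
    linear_combination h4

/-- Over `L⟦X⟧`, with `L` separably closed, an invertible Frobenius structure on a free module is
trivial. -/
theorem exists_trivialization [DecidableEq n] [IsSepClosed L] {A : Matrix n n (PowerSeries L)}
    (hA : IsUnit A.det) :
    ∃ Y : Matrix n n (PowerSeries L), IsUnit Y.det ∧ A * Y.map (partialFrob Fq L) = Y := by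
  classical
  have hdet : IsUnit (A.map (PowerSeries.constantCoeff (R := L))).det := by
    have := hA.map (PowerSeries.constantCoeff (R := L))
    rwa [RingHom.map_det] at this
  set φ := matrixPhi Fq (A.map (PowerSeries.constantCoeff (R := L)))
  have htop := span_fixed_eq_top φ (span_range_matrixPhi hdet)
  obtain ⟨f, hf, -, hind⟩ := Submodule.exists_fun_fin_finrank_span_eq L {x | φ x = x}
  have hcard : Module.finrank L (Submodule.span L {x | φ x = x}) = Fintype.card n := by
    rw [htop, finrank_top, Module.finrank_fintype_fun_eq_card]
  let e : n ≃ Fin (Module.finrank L (Submodule.span L {x | φ x = x})) :=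
    (Fintype.equivFin n).trans (finCongr hcard.symm)
  choose y hy hy0 using fun j => exists_fixed_lift (Fq := Fq) hA (hf (e j))
  refine ⟨Matrix.of fun i j => y j i, ?_, ?_⟩
  · rw [PowerSeries.isUnit_iff_constantCoeff, RingHom.map_det]
    have : (PowerSeries.constantCoeff (R := L)).mapMatrix (Matrix.of fun i j => y j i) =
        (Matrix.of fun j => f (e j)).transpose := by
      ext i j
      simp [hy0]
    rw [this, Matrix.det_transpose, ← Matrix.isUnit_iff_isUnit_det,
      ← Matrix.linearIndependent_rows_iff_isUnit]
    exact hind.comp e e.injective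
  · ext1 i j
    exact congrFun (hy j) i

end FrobeniusEquations

/-! ### Descent of subspaces and of lattices -/

section Descent

/-- Galois descent for subspaces of `L^ι`: the vectors of minimal support of a stable subspace are,
once normalized, defined over the base field, and they span. -/
theorem le_span_of_forall_galois_stable {K : Type*} {L : Type*} [Field K] [Field L] [Algebra K L]
    [IsGalois K L] {ι : Type*} [Finite ι] (W : Submodule L (ι → L))
    (hW : ∀ g : L ≃ₐ[K] L, ∀ x ∈ W, g ∘ x ∈ W) :
    W ≤ Submodule.span L {x | x ∈ W ∧ ∀ i, x i ∈ Set.range (algebraMap K L)} := by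
  classical
  have := Fintype.ofFinite ι
  let supp : (ι → L) → Finset ι := fun x => Finset.univ.filter fun i => x i ≠ 0
  have hsupp : ∀ x i, i ∈ supp x ↔ x i ≠ 0 := fun x i => by simp [supp]
  suffices H : ∀ (m : ℕ) (w : ι → L), w ∈ W → (supp w).card = m →
      w ∈ Submodule.span L {x | x ∈ W ∧ ∀ i, x i ∈ Set.range (algebraMap K L)} from
    fun w hw => H _ w hw rfl
  intro m
  induction m using Nat.strong_induction_on with
  | _ m ih =>
    intro w hw hm
    by_cases hw0 : w = 0
    · rw [hw0]; exact zero_mem _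
    obtain ⟨c, ⟨hcW, hc0, hcw⟩, hmin⟩ := exists_minimalFor_of_wellFoundedLT
      (fun c => c ∈ W ∧ c ≠ 0 ∧ supp c ⊆ supp w) (fun c => (supp c).card)
      ⟨w, hw, hw0, Finset.Subset.refl _⟩
    obtain ⟨i₀, hi₀⟩ := Function.ne_iff.1 hc0
    rw [Pi.zero_apply] at hi₀
    let c' : ι → L := (c i₀)⁻¹ • c
    have hc'W : c' ∈ W := W.smul_mem _ hcW
    have hc'1 : c' i₀ = 1 := by simp [c', hi₀]
    have hc's : ∀ i, c' i ≠ 0 → c i ≠ 0 := fun i hi h0 => hi (by simp [c', h0])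
    have hfix : ∀ g : L ≃ₐ[K] L, g ∘ c' = c' := by
      intro g
      by_contra hne
      have hd : g ∘ c' - c' ≠ 0 := sub_ne_zero.2 hne
      have hss : supp (g ∘ c' - c') ⊆ (supp c).erase i₀ := by
        intro i hi
        rw [hsupp] at hi
        rw [Finset.mem_erase, hsupp]
        constructor
        · rintro rfl
          simp [hc'1] at hi
        · refine hc's i fun h0 => hi ?_
          simp [h0]
      have hlt : (supp (g ∘ c' - c')).card < (supp c).card :=
        (Finset.card_le_card hss).trans_lt
          (Finset.card_erase_lt_of_mem ((hsupp _ _).2 hi₀))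
      have := hmin (j := g ∘ c' - c') ⟨W.sub_mem (hW g _ hc'W) hc'W, hd,
        (hss.trans (Finset.erase_subset _ _)).trans hcw⟩ hlt.le
      exact absurd hlt (not_lt.2 this)
    have hcK : ∀ i, c' i ∈ Set.range (algebraMap K L) := fun i =>
      (InfiniteGalois.mem_range_algebraMap_iff_fixed _).2 fun g => congrFun (hfix g) i
    have hw' : w - w i₀ • c' ∈ W := W.sub_mem hw (W.smul_mem _ hc'W)
    have hss : supp (w - w i₀ • c') ⊆ (supp w).erase i₀ := by
      intro i hi
      rw [hsupp] at hi
      rw [Finset.mem_erase]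
      constructor
      · rintro rfl
        simp [hc'1] at hi
      · by_contra hiw
        have h1 : w i = 0 := by
          rw [hsupp] at hiw
          exact not_not.1 hiw
        have h2 : c' i = 0 := by
          by_contra h2
          exact hiw (hcw ((hsupp _ _).2 (hc's i h2)))
        simp [h1, h2] at hi
    have hlt : (supp (w - w i₀ • c')).card < m := by
      rw [← hm]
      exact (Finset.card_le_card hss).trans_lt
        (Finset.card_erase_lt_of_mem (hcw ((hsupp _ _).2 hi₀)))
    have h3 := ih _ hlt _ hw' rfl
    have h4 : w = (w - w i₀ • c') + w i₀ • c' := by abel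
    rw [h4]
    exact add_mem h3 (Submodule.smul_mem _ _ (Submodule.subset_span ⟨hc'W, hcK⟩))

variable {F : Type u} [Field F] {L : Type v} [Field L] [Algebra F L]

/-- Extension of scalars along `F⟦X⟧ → L⟦X⟧` does not enlarge a submodule: an `F`-linear retraction
`L → F` induces an `F⟦X⟧`-linear retraction `L⟦X⟧ → F⟦X⟧`. -/
theorem mem_of_map_mem_span {n : Type*} (T : Submodule (PowerSeries F) (n → PowerSeries F))
    {x : n → PowerSeries F}
    (hx : PowerSeries.map (algebraMap F L) ∘ x ∈ Submodule.span (PowerSeries L)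
      {z | ∃ t ∈ T, z = PowerSeries.map (algebraMap F L) ∘ t}) : x ∈ T := by
  obtain ⟨r, hr⟩ := (Algebra.linearMap F L).exists_leftInverse_of_injective
    (LinearMap.ker_eq_bot.2 (algebraMap F L).injective)
  have hr' : ∀ a, r (algebraMap F L a) = a := fun a => LinearMap.congr_fun hr a
  let ρ : PowerSeries L →+ PowerSeries F :=
    { toFun := fun s => PowerSeries.mk fun m => r (PowerSeries.coeff m s)
      map_zero' := by ext; simp
      map_add' := fun x y => by ext; simp }
  have hρ : ∀ (a : PowerSeries F) (s : PowerSeries L),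
      ρ (s * PowerSeries.map (algebraMap F L) a) = ρ s * a := by
    intro a s
    ext m
    simp only [ρ, AddMonoidHom.coe_mk, ZeroHom.coe_mk, PowerSeries.coeff_mk, PowerSeries.coeff_mul,
      map_sum, PowerSeries.coeff_map]
    refine Finset.sum_congr rfl fun p _ => ?_
    rw [mul_comm, ← Algebra.smul_def, map_smul, smul_eq_mul, mul_comm]
  have hρ1 : ∀ a : PowerSeries F, ρ (PowerSeries.map (algebraMap F L) a) = a := by
    intro a
    ext m
    simp [ρ, hr']
  rw [Submodule.mem_span_set'] at hx
  obtain ⟨N, s, g, hg⟩ := hx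
  choose t ht hgt using fun i => (g i).2
  have h1 : x = ∑ i, ρ (s i) • t i := by
    ext1 j
    rw [← hρ1 (x j)]
    have h2 := congrFun hg j
    rw [Function.comp_apply] at h2
    rw [← h2, Finset.sum_apply, map_sum, Finset.sum_apply]
    refine Finset.sum_congr rfl fun i _ => ?_
    rw [Pi.smul_apply, Pi.smul_apply, hgt, Function.comp_apply, smul_eq_mul, hρ, smul_eq_mul]
  rw [h1]
  exact Submodule.sum_mem _ fun i _ => T.smul_mem _ (ht i)

end Descent

section FixedVectors

variable {Fq : Type u} [Field Fq] [Fintype Fq] {L : Type v} [Field L] [Algebra Fq L]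

/-- A power series fixed by the partial Frobenius has coefficients in `Fq`. -/
theorem exists_map_of_partialFrob {x : PowerSeries L} (hx : partialFrob Fq L x = x) :
    ∃ c : PowerSeries Fq, PowerSeries.map (algebraMap Fq L) c = x := by
  have h : ∀ m, ∃ a : Fq, algebraMap Fq L a = PowerSeries.coeff m x := fun m =>
    exists_algebraMap_of_pow_card (by
      conv_rhs => rw [← hx]
      rfl)
  choose c hc using h
  exact ⟨PowerSeries.mk c, by ext m; simp [hc]⟩

theorem partialFrob_map_algebraMap (c : PowerSeries Fq) :
    partialFrob Fq L (PowerSeries.map (algebraMap Fq L) c) = PowerSeries.map (algebraMap Fq L) c := by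
  ext m
  simp [partialFrob]

theorem map_comp_mulVec {R S : Type*} [CommRing R] [CommRing S] (σ : R →+* S) {m n : Type*}
    [Fintype n] (A : Matrix m n R) (x : n → R) : σ ∘ A.mulVec x = (A.map σ).mulVec (σ ∘ x) := by
  ext i
  exact RingHom.map_mulVec σ A x i

/-- The fixed vectors of a trivialized Frobenius structure. -/
theorem fixed_iff_of_trivialization {n : Type*} [Fintype n] [DecidableEq n]
    {A Y : Matrix n n (PowerSeries L)} (hY : IsUnit Y.det) (hAY : A * Y.map (partialFrob Fq L) = Y)
    (x : n → PowerSeries L) : A.mulVec (partialFrob Fq L ∘ x) = x ↔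
      ∃ c : n → PowerSeries Fq, x = Y.mulVec (PowerSeries.map (algebraMap Fq L) ∘ c) := by
  constructor
  · intro hx
    have hσ : IsUnit (Y.map (partialFrob Fq L)).det := by
      have := hY.map (partialFrob Fq L)
      rwa [RingHom.map_det] at this
    have h1 : x = Y.mulVec (Y⁻¹.mulVec x) := by
      rw [Matrix.mulVec_mulVec, Matrix.mul_nonsing_inv _ hY, Matrix.one_mulVec]
    have h2 : partialFrob Fq L ∘ (Y⁻¹.mulVec x) = Y⁻¹.mulVec x := by
      have h3 : Y.mulVec (partialFrob Fq L ∘ (Y⁻¹.mulVec x)) = x := by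
        conv_rhs => rw [← hx, h1, map_comp_mulVec, Matrix.mulVec_mulVec, hAY]
      conv_rhs => rw [← h3, Matrix.mulVec_mulVec, Matrix.nonsing_inv_mul _ hY, Matrix.one_mulVec]
    choose c hc using fun i => exists_map_of_partialFrob (congrFun h2 i)
    refine ⟨c, ?_⟩
    rw [show PowerSeries.map (algebraMap Fq L) ∘ c = Y⁻¹.mulVec x from funext hc]
    exact h1
  · rintro ⟨c, rfl⟩
    rw [map_comp_mulVec, Matrix.mulVec_mulVec, hAY]
    congr 1
    ext1 i
    exact partialFrob_map_algebraMap _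

/-- An invertible Frobenius structure over a field has only finitely many fixed vectors. -/
theorem finite_fixed [IsSepClosed L] {n : Type*} [Fintype n] [DecidableEq n] {A : Matrix n n L}
    (hA : IsUnit A.det) : {x : n → L | A.mulVec (frob Fq L ∘ x) = x}.Finite := by
  have hAC : IsUnit (A.map (PowerSeries.C (R := L))).det := by
    have := hA.map (PowerSeries.C (R := L))
    rwa [RingHom.map_det] at this
  obtain ⟨Y, hY, hAY⟩ := exists_trivialization (Fq := Fq) hAC
  refine (Set.finite_range fun c : n → Fq =>
    (Y.map (PowerSeries.constantCoeff (R := L))).mulVec (algebraMap Fq L ∘ c)).subset ?_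
  intro x hx
  rw [Set.mem_ofPred_eq] at hx
  have h1 : (A.map (PowerSeries.C (R := L))).mulVec
      (partialFrob Fq L ∘ (PowerSeries.C (R := L) ∘ x)) = PowerSeries.C (R := L) ∘ x := by
    conv_rhs => rw [← hx, map_comp_mulVec]
    congr 1
    ext1 i
    simp [partialFrob]
  obtain ⟨c, hc⟩ := (fixed_iff_of_trivialization hY hAY _).1 h1
  refine ⟨PowerSeries.constantCoeff ∘ c, ?_⟩
  have h2 : x = PowerSeries.constantCoeff (R := L) ∘ (PowerSeries.C (R := L) ∘ x) := by
    ext i; simp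
  rw [h2, hc, map_comp_mulVec]
  dsimp only
  congr 1

end FixedVectors

/-! ### Saturated submodules over `k⟦u⟧⟦π₀⟧` -/

section Saturated

variable {k : Type v} [Field k]

/-- Coefficientwise reduction modulo `u`, `k⟦u⟧⟦π₀⟧ → k⟦π₀⟧`. -/
noncomputable abbrev redU (k : Type v) [Field k] :
    PowerSeries (PowerSeries k) →+* PowerSeries k :=
  PowerSeries.map (PowerSeries.constantCoeff (R := k))

theorem redU_surjective : Function.Surjective (redU k) := fun f =>
  ⟨PowerSeries.map PowerSeries.C f, by ext m; simp⟩

theorem ker_redU :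
    RingHom.ker (redU k) = Ideal.span {PowerSeries.C (PowerSeries.X : PowerSeries k)} := by
  ext f
  rw [RingHom.mem_ker, Ideal.mem_span_singleton]
  constructor
  · intro hf
    have h : ∀ m, ∃ g : PowerSeries k, PowerSeries.coeff m f = PowerSeries.X * g := by
      intro m
      refine PowerSeries.X_dvd_iff.2 ?_
      simpa using congrArg (PowerSeries.coeff m) hf
    choose g hg using h
    exact ⟨PowerSeries.mk g, by ext1 m; rw [PowerSeries.coeff_C_mul, PowerSeries.coeff_mk, hg]⟩
  · rintro ⟨g, rfl⟩
    rw [map_mul]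
    simp

open Pointwise in
/-- A submodule of a finite free module over the two-dimensional regular ring `k⟦u⟧⟦π₀⟧` is free as
soon as the quotient has no `u`-torsion: modulo `u` it is a submodule of a free module over the
principal ideal domain `k⟦π₀⟧`. -/
theorem free_of_saturated {n : Type*} [Finite n]
    (M : Submodule (PowerSeries (PowerSeries k)) (n → PowerSeries (PowerSeries k)))
    (hM : ∀ x, PowerSeries.C (PowerSeries.X : PowerSeries k) • x ∈ M → x ∈ M) :
    Module.Free (PowerSeries (PowerSeries k)) M := by
  classical
  have := Fintype.ofFinite n
  set S := PowerSeries (PowerSeries k)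
  set u : S := PowerSeries.C (PowerSeries.X : PowerSeries k) with hu
  have hu0 : u ≠ 0 := by
    intro h
    have := congrArg (PowerSeries.coeff 0) h
    simp [hu] at this
  let e : S ⧸ Ideal.span {u} ≃+* PowerSeries k :=
    (Ideal.quotEquivOfEq ker_redU.symm).trans
      (RingHom.quotientKerEquivOfSurjective redU_surjective)
  have hdom : IsDomain (S ⧸ Ideal.span {u}) := e.toMulEquiv.isDomain
  have hpid : IsPrincipalIdealRing (S ⧸ Ideal.span {u}) :=
    IsPrincipalIdealRing.of_surjective (e.symm : PowerSeries k →+* _) e.symm.surjective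
  have hjac : u ∈ (⊥ : Ideal S).jacobson := by
    rw [IsLocalRing.jacobson_eq_maximalIdeal _ bot_ne_top, mem_maximalIdeal, mem_nonunits_iff]
    intro h
    have h1 := h.map (redU k)
    rw [hu, PowerSeries.map_C, ← PowerSeries.coeff_zero_eq_constantCoeff_apply,
      PowerSeries.coeff_zero_X, map_zero] at h1
    exact not_isUnit_zero h1
  have hreg : IsSMulRegular M u := by
    intro x y hxy
    refine Subtype.ext (funext fun i => ?_)
    have := congrFun (congrArg Subtype.val hxy) i
    exact mul_left_cancel₀ hu0 this
  have hnoeth : IsNoetherian S M := inferInstance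
  have hfp : Module.FinitePresentation S M := Module.finitePresentation_of_finite S M
  rw [← Module.free_quotSMulTop_iff_free S M hjac hreg]
  let f : M →ₗ[S] (n → S ⧸ Ideal.span {u}) :=
    (LinearMap.pi fun i => (Submodule.mkQ (Ideal.span {u})).comp (LinearMap.proj i)).comp M.subtype
  have hf : ∀ x : M, f x = 0 ↔ x ∈ u • (⊤ : Submodule S M) := by
    intro x
    rw [Submodule.mem_smul_pointwise_iff_exists]
    constructor
    · intro hx
      have h1 : ∀ i, ∃ c, (x : n → S) i = u * c := fun i => by
        have := congrFun hx i
        exact Ideal.mem_span_singleton.1 ((Submodule.Quotient.mk_eq_zero _).1 this)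
      choose c hc using h1
      have h2 : (x : n → S) = u • c := funext hc
      exact ⟨⟨c, hM c (h2 ▸ x.2)⟩, trivial, Subtype.ext h2.symm⟩
    · rintro ⟨y, -, rfl⟩
      ext1 i
      refine (Submodule.Quotient.mk_eq_zero _).2 (Ideal.mem_span_singleton.2 ⟨(y : n → S) i, rfl⟩)
  let f' : QuotSMulTop u M →ₗ[S] (n → S ⧸ Ideal.span {u}) :=
    Submodule.liftQ _ f fun x hx => (hf x).2 hx
  have hf' : Function.Injective f' := by
    refine LinearMap.ker_eq_bot.1 (Submodule.ker_liftQ_eq_bot _ f _ ?_)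
    exact fun x hx => (hf x).1 hx
  let f'' : QuotSMulTop u M →ₗ[S ⧸ Ideal.span {u}] (n → S ⧸ Ideal.span {u}) :=
    f'.extendScalarsOfSurjective Ideal.Quotient.mk_surjective
  have hf'' : Function.Injective f'' := hf'
  exact Module.Free.of_equiv (LinearEquiv.ofInjective f'' hf'').symm

end Saturated

/-! ### Lattices over `k⟦u⟧⟦π₀⟧` cut out by Galois stable subspaces -/

section Lattices

variable (k : Type v) [Field k]

/-- The inclusion `k⟦u⟧ → K^sep`. -/
noncomputable def emb : PowerSeries k →+* Ksep k :=
  (algebraMap (LocalField k) (Ksep k)).comp (algebraMap (PowerSeries k) (LocalField k))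

/-- The coefficientwise inclusion `k⟦u⟧⟦π₀⟧ → K^sep⟦π₀⟧`. -/
noncomputable abbrev toUr : PowerSeries (PowerSeries k) →+* PowerSeries (Ksep k) :=
  PowerSeries.map (emb k)

variable {k}

theorem emb_injective : Function.Injective (emb k) :=
  (algebraMap (LocalField k) (Ksep k)).injective.comp
    (IsFractionRing.injective (PowerSeries k) (LocalField k))

theorem emb_X_ne_zero : emb k PowerSeries.X ≠ 0 := fun h =>
  PowerSeries.X_ne_zero (emb_injective (h.trans (map_zero _).symm))

theorem galois_emb (g : GK k) (a : PowerSeries k) : g (emb k a) = emb k a :=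
  g.commutes _

theorem galois_toUr (g : GK k) (a : PowerSeries (PowerSeries k)) :
    PowerSeries.map (g : Ksep k →+* Ksep k) (toUr k a) = toUr k a := by
  ext m
  simp [toUr, galois_emb]

/-- Finitely many elements of `K` have a common denominator `u^N`. -/
theorem exists_denominator {ι : Type*} [Finite ι] (c : ι → LocalField k) :
    ∃ (N : ℕ) (b : ι → PowerSeries k), ∀ i,
      emb k PowerSeries.X ^ N * algebraMap (LocalField k) (Ksep k) (c i) = emb k (b i) := by
  have hloc : IsLocalization (Submonoid.powers (PowerSeries.X : PowerSeries k)) (LocalField k) :=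
    LaurentSeries.of_powerSeries_localization
  obtain ⟨⟨_, N, rfl⟩, hb⟩ := IsLocalization.exist_integer_multiples_of_finite
    (Submonoid.powers (PowerSeries.X : PowerSeries k)) c
  choose b hb using hb
  refine ⟨N, b, fun i => ?_⟩
  have h1 := congrArg (algebraMap (LocalField k) (Ksep k)) (hb i)
  simp only [Algebra.smul_def, map_mul, map_pow] at h1
  simp only [emb, RingHom.comp_apply]
  exact h1.symm

variable {n : Type*}

/-- The vectors over `O⟦π₀⟧` lying in a given subspace over `L⟦π₀⟧`, for a map `O → L`. -/
noncomputable def integralVectors {O : Type*} {L : Type*} [CommRing O] [CommRing L] (e : O →+* L)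
    (W : Submodule (PowerSeries L) (n → PowerSeries L)) :
    Submodule (PowerSeries O) (n → PowerSeries O) where
  carrier := {m | PowerSeries.map e ∘ m ∈ W}
  add_mem' {x y} hx hy := by
    have : PowerSeries.map e ∘ (x + y) = PowerSeries.map e ∘ x + PowerSeries.map e ∘ y := by
      ext1 i; simp
    rw [Set.mem_ofPred_eq] at *
    rw [this]
    exact add_mem hx hy
  zero_mem' := by
    have : PowerSeries.map e ∘ (0 : n → PowerSeries O) = 0 := by ext1 i; simp
    rw [Set.mem_ofPred_eq, this]
    exact zero_mem _
  smul_mem' c x hx := by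
    have : PowerSeries.map e ∘ (c • x) = PowerSeries.map e c • (PowerSeries.map e ∘ x) := by
      ext1 i; simp
    rw [Set.mem_ofPred_eq] at *
    rw [this]
    exact W.smul_mem _ hx

theorem mem_integralVectors {O : Type*} {L : Type*} [CommRing O] [CommRing L] {e : O →+* L}
    {W : Submodule (PowerSeries L) (n → PowerSeries L)} {m : n → PowerSeries O} :
    m ∈ integralVectors e W ↔ PowerSeries.map e ∘ m ∈ W := Iff.rfl

theorem integralVectors_saturated
    (W : Submodule (PowerSeries (Ksep k)) (n → PowerSeries (Ksep k)))
    (x : n → PowerSeries (PowerSeries k))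
    (hx : PowerSeries.C (PowerSeries.X : PowerSeries k) • x ∈ integralVectors (emb k) W) :
    x ∈ integralVectors (emb k) W := by
  rw [mem_integralVectors] at *
  have h1 : toUr k ∘ (PowerSeries.C (PowerSeries.X : PowerSeries k) • x) =
      PowerSeries.C (emb k PowerSeries.X) • (toUr k ∘ x) := by
    ext1 i
    simp [toUr]
  rw [h1] at hx
  have h2 := W.smul_mem (PowerSeries.C (emb k PowerSeries.X)⁻¹) hx
  rwa [smul_smul, ← map_mul, inv_mul_cancel₀ emb_X_ne_zero, map_one, one_smul] at h2

theorem sub_X_pow_smul_mem {L : Type*} [Field L] {W : Submodule (PowerSeries L) (n → PowerSeries L)}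
    {N : ℕ} (hN : ∀ x : n → PowerSeries L, (PowerSeries.X : PowerSeries L) ^ N • x ∈ W)
    {x y : n → PowerSeries L} (hxy : ∀ i, ∀ m < N, PowerSeries.coeff m (x i) =
      PowerSeries.coeff m (y i)) : x - y ∈ W := by
  have h1 : ∀ i, ∃ c, x i - y i = (PowerSeries.X : PowerSeries L) ^ N * c := fun i =>
    PowerSeries.X_pow_dvd_iff.2 fun m hm => by rw [map_sub, hxy i m hm, sub_self]
  choose c hc using h1
  rw [show x - y = (PowerSeries.X : PowerSeries L) ^ N • c from funext hc]
  exact hN c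

/-- A Galois stable subspace over `K^sep⟦π₀⟧` of finite colength is spanned by its integral
vectors. -/
theorem le_span_integralVectors [Finite n]
    (W : Submodule (PowerSeries (Ksep k)) (n → PowerSeries (Ksep k)))
    (hW : ∀ (g : GK k), ∀ x ∈ W, PowerSeries.map (g : Ksep k →+* Ksep k) ∘ x ∈ W) {N : ℕ}
    (hN : ∀ x : n → PowerSeries (Ksep k), (PowerSeries.X : PowerSeries (Ksep k)) ^ N • x ∈ W) :
    W ≤ Submodule.span (PowerSeries (Ksep k)) {z | ∃ m ∈ integralVectors (emb k) W, z = toUr k ∘ m} := by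
  classical
  have := Fintype.ofFinite n
  set W₁ := Submodule.span (PowerSeries (Ksep k)) {z | ∃ m ∈ integralVectors (emb k) W, z = toUr k ∘ m}
  have hN₁ : ∀ x : n → PowerSeries (Ksep k), (PowerSeries.X : PowerSeries (Ksep k)) ^ N • x ∈ W₁ := by
    intro x
    rw [pi_eq_sum_univ x, Finset.smul_sum]
    refine Submodule.sum_mem _ fun i _ => ?_
    rw [smul_comm]
    refine Submodule.smul_mem _ _ (Submodule.subset_span
      ⟨(PowerSeries.X : PowerSeries (PowerSeries k)) ^ N • (fun j => if i = j then 1 else 0), ?_, ?_⟩)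
    · rw [mem_integralVectors]
      convert hN (fun j => if i = j then 1 else 0) using 1
      ext1 j
      by_cases h : i = j <;> simp [h]
    · ext1 j
      by_cases h : i = j <;> simp [h, toUr]
  let tr : (n → PowerSeries (Ksep k)) →ₗ[Ksep k] (n × Fin N → Ksep k) :=
    { toFun := fun x p => PowerSeries.coeff p.2 (x p.1)
      map_add' := fun x y => by ext; simp
      map_smul' := fun c x => by ext; simp }
  have htr : ∀ x p, tr x p = PowerSeries.coeff p.2 (x p.1) := fun _ _ => rfl
  let Wbar : Submodule (Ksep k) (n × Fin N → Ksep k) := (W.restrictScalars (Ksep k)).map tr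
  have hWbar : ∀ g : GK k, ∀ x ∈ Wbar, g ∘ x ∈ Wbar := by
    rintro g _ ⟨x, hx, rfl⟩
    exact ⟨_, hW g x hx, by ext p; simp [htr]⟩
  have hdesc := le_span_of_forall_galois_stable Wbar hWbar
  have key : ∀ y ∈ Submodule.span (Ksep k) {x | x ∈ Wbar ∧
      ∀ i, x i ∈ Set.range (algebraMap (LocalField k) (Ksep k))}, ∃ w ∈ W₁, tr w = y := by
    intro y hy
    induction hy using Submodule.span_induction with
    | mem x hx =>
      obtain ⟨⟨w, hw, rfl⟩, hx⟩ := hx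
      choose c hc using hx
      obtain ⟨e, b, hb⟩ := exists_denominator c
      let m : n → PowerSeries (PowerSeries k) := fun i => PowerSeries.mk fun j =>
        if h : j < N then b (i, ⟨j, h⟩) else 0
      have hm : ∀ i, ∀ j < N, PowerSeries.coeff j ((toUr k ∘ m) i) =
          PowerSeries.coeff j ((PowerSeries.C (emb k PowerSeries.X ^ e) • w) i) := by
        intro i j hj
        have h1 := hb (i, ⟨j, hj⟩)
        rw [hc, htr] at h1
        simp only [Function.comp_apply, toUr, PowerSeries.coeff_map, m, PowerSeries.coeff_mk,
          dif_pos hj, Pi.smul_apply, smul_eq_mul, PowerSeries.coeff_C_mul]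
        exact h1.symm
      have hmW : toUr k ∘ m ∈ W := by
        have h1 := sub_X_pow_smul_mem hN hm
        have h2 := add_mem h1 (W.smul_mem (PowerSeries.C (emb k PowerSeries.X ^ e)) hw)
        rwa [sub_add_cancel] at h2
      refine ⟨PowerSeries.C ((emb k PowerSeries.X ^ e)⁻¹) • (toUr k ∘ m),
        W₁.smul_mem _ (Submodule.subset_span ⟨m, hmW, rfl⟩), ?_⟩
      ext p
      rw [htr, htr, Pi.smul_apply, smul_eq_mul, PowerSeries.coeff_C_mul, hm _ _ p.2.2,
        Pi.smul_apply, smul_eq_mul, PowerSeries.coeff_C_mul, inv_mul_cancel_left₀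
        (pow_ne_zero _ emb_X_ne_zero)]
    | zero => exact ⟨0, zero_mem _, map_zero _⟩
    | add x y _ _ hx hy =>
      obtain ⟨a, ha, rfl⟩ := hx
      obtain ⟨b, hb, rfl⟩ := hy
      exact ⟨a + b, add_mem ha hb, map_add _ _ _⟩
    | smul c x _ hx =>
      obtain ⟨a, ha, rfl⟩ := hx
      exact ⟨c • a, (W₁.restrictScalars (Ksep k)).smul_mem c ha, tr.map_smul c a⟩
  intro w hw
  obtain ⟨w₁, hw₁, h⟩ := key (tr w) (hdesc ⟨w, hw, rfl⟩)
  have h1 : w - w₁ ∈ W₁ := sub_X_pow_smul_mem hN₁ fun i m hm =>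
    (congrFun h (i, ⟨m, hm⟩)).symm
  have h2 := add_mem h1 hw₁
  rwa [sub_add_cancel] at h2

end Lattices

/-! ### Sublattices of the fixed vectors -/

section Sublattice

set_option linter.unusedSectionVars false

variable {Fq : Type u} [Field Fq] [Fintype Fq] {O : Type v} [CommRing O] [IsDomain O] [Algebra Fq O]
  {L : Type w} [Field L] [Algebra Fq L] {e : O →+* L}
  {n : Type*} [Fintype n] [DecidableEq n]

/-- The `L⟦π₀⟧`-span of the vectors `Y c`, `c ∈ C`, for a submodule `C` of `Fq⟦π₀⟧^n`. -/
noncomputable def spanLattice (Y : Matrix n n (PowerSeries L))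
    (C : Submodule (PowerSeries Fq) (n → PowerSeries Fq)) :
    Submodule (PowerSeries L) (n → PowerSeries L) :=
  Submodule.span (PowerSeries L) {z | ∃ c ∈ C, z = Y.mulVec (PowerSeries.map (algebraMap Fq L) ∘ c)}

theorem mulVec_mem_spanLattice {Y : Matrix n n (PowerSeries L)}
    {C : Submodule (PowerSeries Fq) (n → PowerSeries Fq)} {c : n → PowerSeries Fq} (hc : c ∈ C) :
    Y.mulVec (PowerSeries.map (algebraMap Fq L) ∘ c) ∈ spanLattice Y C :=
  Submodule.subset_span ⟨c, hc, rfl⟩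

theorem mem_of_mulVec_mem_spanLattice {Y : Matrix n n (PowerSeries L)} (hY : IsUnit Y.det)
    {C : Submodule (PowerSeries Fq) (n → PowerSeries Fq)} {c : n → PowerSeries Fq}
    (hc : Y.mulVec (PowerSeries.map (algebraMap Fq L) ∘ c) ∈ spanLattice Y C) : c ∈ C := by
  refine mem_of_map_mem_span (L := L) C ?_
  have h1 := Submodule.mem_map_of_mem (f := Y⁻¹.mulVecLin) hc
  rw [spanLattice, Submodule.map_span, Matrix.mulVecLin_apply, Matrix.mulVec_mulVec,
    Matrix.nonsing_inv_mul _ hY, Matrix.one_mulVec] at h1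
  refine Submodule.span_mono ?_ h1
  rintro _ ⟨_, ⟨t, ht, rfl⟩, rfl⟩
  refine ⟨t, ht, ?_⟩
  rw [Matrix.mulVecLin_apply, Matrix.mulVec_mulVec, Matrix.nonsing_inv_mul _ hY, Matrix.one_mulVec]

theorem X_pow_smul_mem_spanLattice {Y : Matrix n n (PowerSeries L)} (hY : IsUnit Y.det)
    {C : Submodule (PowerSeries Fq) (n → PowerSeries Fq)} {N : ℕ}
    (hC : ∀ c : n → PowerSeries Fq, (PowerSeries.X : PowerSeries Fq) ^ N • c ∈ C)
    (x : n → PowerSeries L) : (PowerSeries.X : PowerSeries L) ^ N • x ∈ spanLattice Y C := by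
  have h1 : x = Y.mulVec (Y⁻¹.mulVec x) := by
    rw [Matrix.mulVec_mulVec, Matrix.mul_nonsing_inv _ hY, Matrix.one_mulVec]
  rw [h1, pi_eq_sum_univ' (Y⁻¹.mulVec x), Matrix.mulVec_sum, Finset.smul_sum]
  refine Submodule.sum_mem _ fun i _ => ?_
  rw [Matrix.mulVec_smul, smul_comm]
  refine Submodule.smul_mem _ _ ?_
  convert mulVec_mem_spanLattice (Y := Y) (hC (Pi.single i 1)) using 1
  rw [← Matrix.mulVec_smul]
  congr 1
  ext1 j
  by_cases h : j = i <;> simp [h]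

/-- `x ↦ A σ(x)` preserves the span of a set of its fixed vectors. -/
theorem phi_mem_spanLattice {A Y : Matrix n n (PowerSeries L)}
    (hAY : A * Y.map (partialFrob Fq L) = Y)
    {C : Submodule (PowerSeries Fq) (n → PowerSeries Fq)} {x : n → PowerSeries L}
    (hx : x ∈ spanLattice Y C) : A.mulVec (partialFrob Fq L ∘ x) ∈ spanLattice Y C := by
  have hfix : ∀ c : n → PowerSeries Fq, A.mulVec (partialFrob Fq L ∘
      Y.mulVec (PowerSeries.map (algebraMap Fq L) ∘ c)) =
      Y.mulVec (PowerSeries.map (algebraMap Fq L) ∘ c) := by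
    intro c
    rw [map_comp_mulVec, Matrix.mulVec_mulVec, hAY]
    congr 1
    ext1 i
    exact partialFrob_map_algebraMap _
  induction hx using Submodule.span_induction with
  | mem x hx =>
    obtain ⟨c, hc, rfl⟩ := hx
    rw [hfix]
    exact mulVec_mem_spanLattice hc
  | zero =>
    have : partialFrob Fq L ∘ (0 : n → PowerSeries L) = 0 := by ext1 i; simp
    rw [this, Matrix.mulVec_zero]
    exact zero_mem _
  | add x y _ _ hx hy =>
    have : partialFrob Fq L ∘ (x + y) = partialFrob Fq L ∘ x + partialFrob Fq L ∘ y := by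
      ext1 i; simp
    rw [this, Matrix.mulVec_add]
    exact add_mem hx hy
  | smul c x _ hx =>
    have : partialFrob Fq L ∘ (c • x) = partialFrob Fq L c • (partialFrob Fq L ∘ x) := by
      ext1 i; simp
    rw [this, Matrix.mulVec_smul]
    exact Submodule.smul_mem _ _ hx

theorem phi_mem_integralVectors {A : Matrix n n (PowerSeries O)} {Y : Matrix n n (PowerSeries L)}
    (hAY : A.map (PowerSeries.map e) * Y.map (partialFrob Fq L) = Y)
    {C : Submodule (PowerSeries Fq) (n → PowerSeries Fq)} {x : n → PowerSeries O}
    (hx : x ∈ integralVectors e (spanLattice Y C)) :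
    A.mulVec (partialFrob Fq O ∘ x) ∈ integralVectors e (spanLattice Y C) := by
  rw [mem_integralVectors] at *
  have := phi_mem_spanLattice hAY hx
  rw [map_comp_mulVec]
  convert this using 2
  ext1 i
  exact (partialFrob_map Fq e (x i)).symm

theorem matrix_cancel_of_injective {R : Type*} [CommRing R] {m l : Type*} [Fintype m]
    {D : Matrix n m R} (hD : ∀ x : m → R, D.mulVec x = 0 → x = 0) {E F : Matrix m l R}
    (h : D * E = D * F) : E = F := by
  ext i j
  have h1 : D.mulVec (fun i => E i j - F i j) = 0 := by
    ext a
    have := congrFun (congrFun h a) j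
    rw [Matrix.mul_apply, Matrix.mul_apply] at this
    simp only [Matrix.mulVec, dotProduct, mul_sub, Finset.sum_sub_distrib, this, sub_self,
      Pi.zero_apply]
  exact sub_eq_zero.1 (congrFun (hD _ h1) i)

theorem partialFrob_X (R : Type*) [CommRing R] [Algebra Fq R] :
    partialFrob Fq R PowerSeries.X = PowerSeries.X := by
  simp [partialFrob]

/-- A submodule `C` of finite colength of the fixed vectors of `(A, Y)` is again the module of fixed
vectors of some `(A₁, Y₁)` with `A₁` dividing the same scalar `P`, provided that the span of `C` is
generated by its integral vectors and that these form a free module. The basis matrix `D` of the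
integral vectors transports the Frobenius structure. -/
theorem exists_sublattice_matrices (he : Function.Injective e) {A B : Matrix n n (PowerSeries O)}
    {P : PowerSeries O} (hAB : A * B = P • (1 : Matrix n n (PowerSeries O)))
    {Y : Matrix n n (PowerSeries L)} (hY : IsUnit Y.det)
    (hAY : A.map (PowerSeries.map e) * Y.map (partialFrob Fq L) = Y)
    {C : Submodule (PowerSeries Fq) (n → PowerSeries Fq)} {N : ℕ}
    (hC : ∀ c : n → PowerSeries Fq, (PowerSeries.X : PowerSeries Fq) ^ N • c ∈ C)
    [Module.Free (PowerSeries O) (integralVectors e (spanLattice Y C))]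
    [Module.Finite (PowerSeries O) (integralVectors e (spanLattice Y C))]
    (hspan : spanLattice Y C ≤ Submodule.span (PowerSeries L)
      {z | ∃ m ∈ integralVectors e (spanLattice Y C), z = PowerSeries.map e ∘ m}) :
    ∃ (s : ℕ) (D : Matrix n (Fin s) (PowerSeries O)) (A₁ B₁ : Matrix (Fin s) (Fin s) (PowerSeries O)),
      A₁ * B₁ = P • (1 : Matrix (Fin s) (Fin s) (PowerSeries O)) ∧
      A * D.map (partialFrob Fq O) = D * A₁ ∧
      IsUnit (A₁.map (PowerSeries.map e)).det ∧
      (∀ x : Fin s → PowerSeries L, (D.map (PowerSeries.map e)).mulVec x = 0 → x = 0) ∧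
      (∀ y, y ∈ spanLattice Y C ↔ ∃ x, (D.map (PowerSeries.map e)).mulVec x = y) := by
  classical
  set W := spanLattice Y C with hW
  set M := integralVectors e W with hM
  let b := Module.finBasis (PowerSeries O) M
  let s := Module.finrank (PowerSeries O) M
  let D : Matrix n (Fin s) (PowerSeries O) := Matrix.of fun i j => (b j : n → PowerSeries O) i
  set E := PowerSeries.map e with hE
  have hEinj : Function.Injective E := PowerSeries.map_injective _ he
  have hDvec : ∀ x : Fin s → PowerSeries O, D.mulVec x = (∑ j, x j • b j : M) := by
    intro x
    ext1 i
    simp only [Matrix.mulVec, dotProduct, D, Matrix.of_apply, Submodule.coe_sum, Finset.sum_apply,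
      Submodule.coe_smul, Pi.smul_apply, smul_eq_mul, mul_comm]
  have hDmem : ∀ x : Fin s → PowerSeries O, D.mulVec x ∈ M := fun x => by
    rw [hDvec]; exact Subtype.prop _
  have hDsurj : ∀ m ∈ M, ∃ x, D.mulVec x = m := fun m hm =>
    ⟨fun j => b.repr ⟨m, hm⟩ j, by rw [hDvec, b.sum_repr]⟩
  have hDinj : ∀ x : Fin s → PowerSeries O, D.mulVec x = 0 → x = 0 := by
    intro x hx
    rw [hDvec] at hx
    exact funext (Fintype.linearIndependent_iff.1 b.linearIndependent x (Subtype.ext hx))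
  -- the Frobenius structure on the integral vectors
  have hA₁ : ∀ j, ∃ a : Fin s → PowerSeries O,
      D.mulVec a = A.mulVec (partialFrob Fq O ∘ D.col j) := fun j =>
    hDsurj _ (phi_mem_integralVectors hAY (b j).2)
  choose a ha using hA₁
  let A₁ : Matrix (Fin s) (Fin s) (PowerSeries O) := Matrix.of fun i j => a j i
  have hAD : A * D.map (partialFrob Fq O) = D * A₁ := by
    ext1 i j
    exact (congrFun (ha j) i).symm
  -- an inverse of `D` up to a power of the variable
  have hD' : ∀ j : n, ∃ a : Fin s → PowerSeries O,
      D.mulVec a = (PowerSeries.X : PowerSeries O) ^ N • (Pi.single j 1 : n → PowerSeries O) := by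
    intro j
    refine hDsurj _ ?_
    rw [hM, mem_integralVectors]
    convert X_pow_smul_mem_spanLattice hY hC (Pi.single j 1) using 1
    ext1 i
    by_cases h : i = j
    · subst h; simp
    · simp [h]
  choose a' ha' using hD'
  let D' : Matrix (Fin s) n (PowerSeries O) := Matrix.of fun i j => a' j i
  have hDD' : D * D' = (PowerSeries.X : PowerSeries O) ^ N • (1 : Matrix n n (PowerSeries O)) := by
    ext1 i j
    refine (congrFun (ha' j) i).trans ?_
    simp [Matrix.one_apply, Pi.single_apply]
  have hD'D : D' * D = (PowerSeries.X : PowerSeries O) ^ N • (1 : Matrix (Fin s) (Fin s) _) := by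
    refine matrix_cancel_of_injective hDinj ?_
    rw [← Matrix.mul_assoc, hDD']
    simp
  have hDUinj : ∀ x : Fin s → PowerSeries L, (D.map E).mulVec x = 0 → x = 0 := by
    intro x hx
    have h1 := congrArg (D'.map E).mulVec hx
    rw [Matrix.mulVec_mulVec, ← Matrix.map_mul, hD'D, Matrix.mulVec_zero] at h1
    ext1 i
    have h2 := congrFun h1 i
    have h3 : ((PowerSeries.X : PowerSeries O) ^ N • (1 : Matrix (Fin s) (Fin s) _)).map E =
        (PowerSeries.X : PowerSeries L) ^ N • (1 : Matrix (Fin s) (Fin s) _) := by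
      ext1 i j
      by_cases h : i = j
      · subst h; simp [hE]
      · simp [h]
    rw [h3, Matrix.smul_mulVec, Matrix.one_mulVec] at h2
    simpa using h2
  have hWD : ∀ y, y ∈ W ↔ ∃ x, (D.map E).mulVec x = y := by
    intro y
    constructor
    · intro hy
      have h1 : Submodule.span (PowerSeries L) {z | ∃ m ∈ M, z = E ∘ m} ≤
          LinearMap.range (D.map E).mulVecLin := by
        rw [Submodule.span_le]
        rintro _ ⟨m, hm, rfl⟩
        obtain ⟨x, rfl⟩ := hDsurj m hm
        exact ⟨E ∘ x, (map_comp_mulVec E D x).symm⟩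
      exact h1 (hspan hy)
    · rintro ⟨x, rfl⟩
      rw [Matrix.mulVec_eq_sum]
      refine Submodule.sum_mem _ fun j _ => ?_
      rw [op_smul_eq_smul]
      exact Submodule.smul_mem _ _ (b j).2
  have hADU : A.map E * (D.map E).map (partialFrob Fq L) = D.map E * A₁.map E := by
    rw [← Matrix.map_mul, ← hAD, Matrix.map_mul]
    congr 1
    ext1 i j
    exact partialFrob_map Fq e _
  have hA₁U : IsUnit (A₁.map E).det := by
    rw [← Matrix.isUnit_iff_isUnit_det, ← Matrix.mulVec_surjective_iff_isUnit]
    have h1 : W ≤ (LinearMap.range (A₁.map E).mulVecLin).map (D.map E).mulVecLin := by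
      rw [hW, spanLattice, Submodule.span_le]
      rintro _ ⟨c, hc, rfl⟩
      obtain ⟨x, hx⟩ := (hWD _).1 (mulVec_mem_spanLattice (Y := Y) hc)
      refine ⟨(A₁.map E).mulVec (partialFrob Fq L ∘ x), ⟨_, rfl⟩, ?_⟩
      rw [Matrix.mulVecLin_apply, Matrix.mulVec_mulVec, ← hADU, ← Matrix.mulVec_mulVec,
        ← map_comp_mulVec, hx]
      exact (fixed_iff_of_trivialization hY hAY _).2 ⟨c, rfl⟩
    intro x
    obtain ⟨_, ⟨y, rfl⟩, hy⟩ := h1 ((hWD _).2 ⟨x, rfl⟩)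
    refine ⟨y, ?_⟩
    have h2 := hDUinj ((A₁.map E).mulVec y - x) (by
      rw [Matrix.mulVec_sub, sub_eq_zero]
      exact hy)
    exact sub_eq_zero.1 h2
  -- the complementary matrix of `A₁`
  let Q := D'.map (partialFrob Fq O) * B * D
  have hAQ : A₁ * Q = ((PowerSeries.X : PowerSeries O) ^ N * P) • (1 : Matrix (Fin s) (Fin s) _) := by
    refine matrix_cancel_of_injective hDinj ?_
    have h1 : D.map (partialFrob Fq O) * D'.map (partialFrob Fq O) =
        (PowerSeries.X : PowerSeries O) ^ N • (1 : Matrix n n (PowerSeries O)) := by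
      rw [← Matrix.map_mul, hDD']
      ext1 i j
      by_cases h : i = j
      · subst h; simp [partialFrob_X]
      · simp [h]
    calc D * (A₁ * Q) = A * (D.map (partialFrob Fq O) * D'.map (partialFrob Fq O)) * B * D := by
          simp only [Q, ← Matrix.mul_assoc, ← hAD]
      _ = _ := by
          rw [h1]
          simp only [Matrix.mul_smul, Matrix.mul_one, Matrix.smul_mul, hAB, Matrix.one_mul,
            smul_smul]
  have hQ : ∀ i j, ∃ c, Q i j = (PowerSeries.X : PowerSeries O) ^ N * c := by
    intro i j
    refine PowerSeries.X_pow_dvd_iff.2 fun m hm => ?_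
    have h1 : Q.map E = ((PowerSeries.X : PowerSeries L) ^ N * E P) • (A₁.map E)⁻¹ := by
      have h2 : A₁.map E * Q.map E = ((PowerSeries.X : PowerSeries L) ^ N * E P) • 1 := by
        rw [← Matrix.map_mul, hAQ]
        ext1 i j
        by_cases h : i = j
        · subst h; simp [hE]
        · simp [h]
      calc Q.map E = (A₁.map E)⁻¹ * (A₁.map E * Q.map E) := by
            rw [← mul_assoc, Matrix.nonsing_inv_mul _ hA₁U, one_mul]
        _ = _ := by rw [h2]; simp
    have h3 := congrFun (congrFun h1 i) j
    have h4 : PowerSeries.coeff m (E (Q i j)) = 0 := by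
      rw [Matrix.map_apply, Matrix.smul_apply, smul_eq_mul, mul_assoc] at h3
      rw [h3]
      exact PowerSeries.X_pow_dvd_iff.1 ⟨_, rfl⟩ m hm
    rw [hE, PowerSeries.coeff_map] at h4
    exact he (h4.trans (map_zero e).symm)
  choose B₁ hB₁ using hQ
  refine ⟨s, D, A₁, Matrix.of B₁, ?_, hAD, hA₁U, hDUinj, hWD⟩
  have h1 : Q = (PowerSeries.X : PowerSeries O) ^ N • Matrix.of B₁ := by
    ext1 i j
    exact hB₁ i j
  rw [h1, Matrix.mul_smul, mul_smul] at hAQ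
  ext1 i j
  exact mul_left_cancel₀ (pow_ne_zero N PowerSeries.X_ne_zero) (congrFun (congrFun hAQ i) j)

end Sublattice

/-! ### Frobenius modules over `k⟦u⟧` -/

section FrobeniusModules

set_option linter.unusedSectionVars false

variable {Fq : Type u} [Field Fq] [Fintype Fq] {O : Type v} [CommRing O] [IsDomain O] [Algebra Fq O]
  {L : Type w} [Field L] [Algebra Fq L] {e : O →+* L}
  {n : Type*} [Fintype n] [DecidableEq n]

theorem add_X_smul_mem {L : Type*} [Field L] {W : Submodule (PowerSeries L) (n → PowerSeries L)}
    (hX : ∀ x : n → PowerSeries L, (PowerSeries.X : PowerSeries L) • x ∈ W)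
    {x y : n → PowerSeries L} (hxy : ∀ i, PowerSeries.constantCoeff (x i) =
      PowerSeries.constantCoeff (y i)) (hx : x ∈ W) : y ∈ W := by
  have h1 := sub_X_pow_smul_mem (N := 1) (x := y) (y := x) (by simpa using hX) (by
    intro i m hm
    obtain rfl : m = 0 := by omega
    simpa using (hxy i).symm)
  simpa using add_mem h1 hx

theorem e_frob (e : O →+* L) (x : O) : e (frob Fq O x) = frob Fq L (e x) := by
  rw [frob_apply, frob_apply, map_pow]

theorem constantCoeff_map {R S : Type*} [CommRing R] [CommRing S] (f : R →+* S) (x : PowerSeries R) :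
    PowerSeries.constantCoeff (PowerSeries.map f x) = f (PowerSeries.constantCoeff x) := by
  rw [← PowerSeries.coeff_zero_eq_constantCoeff_apply, ← PowerSeries.coeff_zero_eq_constantCoeff_apply]
  exact PowerSeries.coeff_map _ _ _

theorem constantCoeff_partialFrob {R : Type*} [CommRing R] [Algebra Fq R] (x : PowerSeries R) :
    PowerSeries.constantCoeff (partialFrob Fq R x) = frob Fq R (PowerSeries.constantCoeff x) := by
  exact constantCoeff_map _ _

/-- If `C ⊇ π₀ Fq⟦π₀⟧^n`, the quotient of `Fq⟦π₀⟧^n` by `C` embeds into the fixed vectors of a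
Frobenius structure `A'` over the principal ideal domain `O`, which divides the reduction of `P`. The
structure `A'` lives on the torsion-free quotient of `O^n` by the integral vectors of the span of
`C`. -/
theorem exists_quotient_matrices [IsPrincipalIdealRing O] (he : Function.Injective e)
    {A B : Matrix n n (PowerSeries O)}
    {P : PowerSeries O} (hAB : A * B = P • (1 : Matrix n n (PowerSeries O)))
    {Y : Matrix n n (PowerSeries L)} (hY : IsUnit Y.det)
    (hAY : A.map (PowerSeries.map e) * Y.map (partialFrob Fq L) = Y)
    {C : Submodule (PowerSeries Fq) (n → PowerSeries Fq)}
    (hC : ∀ c : n → PowerSeries Fq, (PowerSeries.X : PowerSeries Fq) • c ∈ C)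
    (hspan : spanLattice Y C ≤ Submodule.span (PowerSeries L)
      {z | ∃ m ∈ integralVectors e (spanLattice Y C), z = PowerSeries.map e ∘ m}) :
    ∃ (s : ℕ) (A' B' : Matrix (Fin s) (Fin s) O) (E : Matrix (Fin s) n O),
      A' * B' = PowerSeries.constantCoeff P • (1 : Matrix (Fin s) (Fin s) O) ∧
      (∀ c : n → PowerSeries Fq, (A'.map e).mulVec (frob Fq L ∘ (E.map e).mulVec
        (PowerSeries.constantCoeff ∘ Y.mulVec (PowerSeries.map (algebraMap Fq L) ∘ c))) =
        (E.map e).mulVec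
        (PowerSeries.constantCoeff ∘ Y.mulVec (PowerSeries.map (algebraMap Fq L) ∘ c))) ∧
      (∀ c : n → PowerSeries Fq, (E.map e).mulVec (PowerSeries.constantCoeff ∘
        Y.mulVec (PowerSeries.map (algebraMap Fq L) ∘ c)) = 0 ↔ c ∈ C) ∧
      ⊤ ≤ Submodule.span L (Set.range fun c : n → PowerSeries Fq => (E.map e).mulVec
        (PowerSeries.constantCoeff ∘ Y.mulVec (PowerSeries.map (algebraMap Fq L) ∘ c))) := by
  classical
  set W := spanLattice Y C with hW
  set cc := PowerSeries.constantCoeff (R := O) with hcc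
  set ccL := PowerSeries.constantCoeff (R := L) with hccL
  have hXW : ∀ x : n → PowerSeries L, (PowerSeries.X : PowerSeries L) • x ∈ W := by
    simpa using X_pow_smul_mem_spanLattice (N := 1) hY (by simpa using hC)
  -- the integral vectors modulo the variable
  let M : Submodule O (n → O) :=
    { carrier := {x | (PowerSeries.C (R := L)) ∘ e ∘ x ∈ W}
      add_mem' := fun {x y} hx hy => by
        have : (PowerSeries.C (R := L)) ∘ e ∘ (x + y) =
            (PowerSeries.C (R := L)) ∘ e ∘ x + (PowerSeries.C (R := L)) ∘ e ∘ y := by ext1 i; simp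
        rw [Set.mem_ofPred_eq, this]
        exact add_mem hx hy
      zero_mem' := by
        have : (PowerSeries.C (R := L)) ∘ e ∘ (0 : n → O) = 0 := by ext1 i; simp
        rw [Set.mem_ofPred_eq, this]
        exact zero_mem _
      smul_mem' := fun c x hx => by
        have : (PowerSeries.C (R := L)) ∘ e ∘ (c • x) =
            PowerSeries.C (e c) • ((PowerSeries.C (R := L)) ∘ e ∘ x) := by ext1 i; simp
        rw [Set.mem_ofPred_eq, this]
        exact W.smul_mem _ hx }
  have hM : ∀ x, x ∈ M ↔ (PowerSeries.C (R := L)) ∘ e ∘ x ∈ W := fun _ => Iff.rfl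
  have hMint : ∀ m, m ∈ integralVectors e W → cc ∘ m ∈ M := by
    intro m hm
    rw [hM]
    rw [mem_integralVectors] at hm
    refine add_X_smul_mem hXW (fun i => ?_) hm
    exact constantCoeff_map e (m i)
  have hMφ : ∀ x ∈ M, (A.map cc).mulVec (frob Fq O ∘ x) ∈ M := by
    intro x hx
    have h1 : (PowerSeries.C (R := O)) ∘ x ∈ integralVectors e W := by
      rw [mem_integralVectors]
      rw [hM] at hx
      convert hx using 1
      ext1 i
      simp
    have h2 := hMint _ (phi_mem_integralVectors hAY h1)
    rw [map_comp_mulVec] at h2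
    convert h2 using 2
    ext1 i
    rw [Function.comp_apply, Function.comp_apply, Function.comp_apply, constantCoeff_partialFrob]
    simp
  have htf : Module.IsTorsionFree O ((n → O) ⧸ M) := by
    refine ⟨fun r hr => isSMulRegular_iff_right_eq_zero_of_smul.2 fun x hx => ?_⟩
    obtain ⟨x, rfl⟩ := M.mkQ_surjective x
    rw [← map_smul, Submodule.mkQ_apply, Submodule.Quotient.mk_eq_zero, hM] at hx
    rw [Submodule.mkQ_apply, Submodule.Quotient.mk_eq_zero, hM]
    have hr0 : e r ≠ 0 := fun h0 => hr.ne_zero (he (h0.trans (map_zero e).symm))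
    have h1 := W.smul_mem (PowerSeries.C (e r)⁻¹) hx
    convert h1 using 1
    ext1 i
    simp only [Function.comp_apply, Pi.smul_apply, smul_eq_mul, map_mul]
    rw [← mul_assoc, ← map_mul, inv_mul_cancel₀ hr0, map_one, one_mul]
  let β := Module.finBasis O ((n → O) ⧸ M)
  let E : Matrix (Fin (Module.finrank O ((n → O) ⧸ M))) n O :=
    LinearMap.toMatrix' (β.equivFun.toLinearMap.comp M.mkQ)
  have hE : ∀ x, E.mulVec x = β.equivFun (M.mkQ x) := fun x => LinearMap.toMatrix'_mulVec _ _
  have hEM : ∀ x, E.mulVec x = 0 ↔ x ∈ M := fun x => by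
    rw [hE, LinearEquiv.map_eq_zero_iff, Submodule.mkQ_apply, Submodule.Quotient.mk_eq_zero]
  have hEsurj : ∀ j, ∃ x, E.mulVec x = Pi.single j 1 := fun j => by
    obtain ⟨x, hx⟩ := M.mkQ_surjective (β.equivFun.symm (Pi.single j 1))
    exact ⟨x, by rw [hE, hx, LinearEquiv.apply_symm_apply]⟩
  choose a' ha' using hEsurj
  let E' : Matrix n (Fin (Module.finrank O ((n → O) ⧸ M))) O := Matrix.of fun i j => a' j i
  have hEE' : E * E' = 1 := by
    ext1 i j
    refine (congrFun (ha' j) i).trans ?_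
    simp [Matrix.one_apply, Pi.single_apply]
  have hR : ∀ j, (1 - E' * E).col j ∈ M := by
    intro j
    rw [← hEM]
    have : E * (1 - E' * E) = 0 := by
      rw [Matrix.mul_sub, ← Matrix.mul_assoc, hEE']; simp
    ext1 i
    exact congrFun (congrFun this i) j
  let A₀ := A.map cc
  let B₀ := B.map cc
  have hAB₀ : A₀ * B₀ = cc P • 1 := by
    rw [← Matrix.map_mul, hAB]
    ext1 i j
    by_cases h : i = j
    · subst h; simp
    · simp [h]
  have hfrob : E * A₀ * (1 - E' * E).map (frob Fq O) = 0 := by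
    ext1 i j
    have h1 := (hEM _).2 (hMφ _ (hR j))
    rw [Matrix.mulVec_mulVec] at h1
    exact congrFun h1 i
  let A' := E * A₀ * E'.map (frob Fq O)
  have hA' : A' * E.map (frob Fq O) = E * A₀ := by
    have h1 : (1 - E' * E).map (frob Fq O) = 1 - E'.map (frob Fq O) * E.map (frob Fq O) := by
      rw [Matrix.map_sub _ (map_sub _), Matrix.map_mul, Matrix.map_one _ (map_zero _) (map_one _)]
    rw [h1, Matrix.mul_sub, Matrix.mul_one, sub_eq_zero, ← Matrix.mul_assoc] at hfrob
    exact hfrob.symm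
  have hkill : ∀ w ∈ W, (E.map e).mulVec (ccL ∘ w) = 0 := by
    intro w hw
    have h1 := hspan hw
    clear hw
    induction h1 using Submodule.span_induction with
    | mem x hx =>
      obtain ⟨m, hm, rfl⟩ := hx
      have h2 := (hEM _).2 (hMint m hm)
      have h3 : ccL ∘ PowerSeries.map e ∘ m = e ∘ cc ∘ m := by
        ext1 i
        exact constantCoeff_map e (m i)
      rw [h3, ← map_comp_mulVec, h2]
      ext1 i; simp
    | zero =>
      have : ccL ∘ (0 : n → PowerSeries L) = 0 := by ext1 i; simp
      rw [this, Matrix.mulVec_zero]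
    | add x y _ _ hx hy =>
      have : ccL ∘ (x + y) = ccL ∘ x + ccL ∘ y := by ext1 i; simp
      rw [this, Matrix.mulVec_add, hx, hy, add_zero]
    | smul c x _ hx =>
      have : ccL ∘ (c • x) = ccL c • (ccL ∘ x) := by ext1 i; simp
      rw [this, Matrix.mulVec_smul, hx, smul_zero]
  have hEE'L : E.map e * E'.map e = 1 := by
    rw [← Matrix.map_mul, hEE', Matrix.map_one _ (map_zero _) (map_one _)]
  have hY₀ : IsUnit (Y.map ccL).det := by
    have := hY.map ccL
    rwa [RingHom.map_det] at this
  refine ⟨_, A', E.map (frob Fq O) * B₀ * E', E, ?_, fun c => ?_, fun c => ⟨fun h => ?_, fun h => ?_⟩,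
    fun z _ => ?_⟩
  · calc A' * (E.map (frob Fq O) * B₀ * E') = A' * E.map (frob Fq O) * B₀ * E' := by
          simp only [Matrix.mul_assoc]
      _ = E * (A₀ * B₀) * E' := by rw [hA']; simp only [Matrix.mul_assoc]
      _ = _ := by rw [hAB₀, Matrix.mul_smul, Matrix.mul_one, Matrix.smul_mul, hEE']
  · have h1 := (fixed_iff_of_trivialization hY hAY _).2 ⟨c, rfl⟩
    set y := Y.mulVec (PowerSeries.map (algebraMap Fq L) ∘ c)
    have h2 : (A₀.map e).mulVec (frob Fq L ∘ ccL ∘ y) = ccL ∘ y := by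
      have h3 := congrArg (fun z => ccL ∘ z) h1
      rw [map_comp_mulVec] at h3
      convert h3 using 2
      · ext1 i j
        exact (constantCoeff_map e _).symm
      · ext1 i
        exact (constantCoeff_partialFrob _).symm
    have h4 : (E.map e).map (frob Fq L) = (E.map (frob Fq O)).map e := by
      ext1 i j
      exact (e_frob e _).symm
    rw [map_comp_mulVec, Matrix.mulVec_mulVec, h4, ← Matrix.map_mul, hA', Matrix.map_mul,
      ← Matrix.mulVec_mulVec, h2]
  · refine mem_of_mulVec_mem_spanLattice hY ?_
    set y := Y.mulVec (PowerSeries.map (algebraMap Fq L) ∘ c)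
    have h1 : ccL ∘ y = ((1 - E' * E).map e).mulVec (ccL ∘ y) := by
      rw [Matrix.map_sub _ (map_sub _), Matrix.map_one _ (map_zero _) (map_one _), Matrix.sub_mulVec,
        Matrix.one_mulVec, Matrix.map_mul, ← Matrix.mulVec_mulVec, h, Matrix.mulVec_zero, sub_zero]
    have h2 : (PowerSeries.C (R := L)) ∘ ccL ∘ y ∈ W := by
      rw [h1, map_comp_mulVec, Matrix.mulVec_eq_sum]
      refine Submodule.sum_mem _ fun j _ => ?_
      rw [op_smul_eq_smul]
      exact W.smul_mem _ (hR j)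
    refine add_X_smul_mem hXW (fun i => ?_) h2
    simp [hccL]
  · exact hkill _ (mulVec_mem_spanLattice h)
  · have h1 : z = (E.map e).mulVec ((Y.map ccL).mulVec
        ((Y.map ccL)⁻¹.mulVec ((E'.map e).mulVec z))) := by
      rw [Matrix.mulVec_mulVec _ (Y.map ccL), Matrix.mul_nonsing_inv _ hY₀, Matrix.one_mulVec,
        Matrix.mulVec_mulVec, hEE'L, Matrix.one_mulVec]
    rw [h1, pi_eq_sum_univ' ((Y.map ccL)⁻¹.mulVec _), Matrix.mulVec_sum, Matrix.mulVec_sum]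
    refine Submodule.sum_mem _ fun i _ => ?_
    rw [Matrix.mulVec_smul, Matrix.mulVec_smul]
    refine Submodule.smul_mem _ _ (Submodule.subset_span ⟨Pi.single i 1, ?_⟩)
    dsimp only
    rw [map_comp_mulVec]
    congr 2
    ext1 j
    by_cases h : j = i
    · subst h; simp
    · simp [h]

/-- Equations over power series that determine each coefficient by the lower ones are solvable. -/
theorem exists_fixedPoint_of_contracting {F : Type*} [Semiring F] {ι : Type*}
    (T : (ι → PowerSeries F) → (ι → PowerSeries F))
    (hT : ∀ (m : ℕ) (x y : ι → PowerSeries F),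
      (∀ i, ∀ l < m, PowerSeries.coeff l (x i) = PowerSeries.coeff l (y i)) →
      ∀ i, PowerSeries.coeff m (T x i) = PowerSeries.coeff m (T y i)) :
    ∃ x, T x = x := by
  classical
  obtain ⟨z, hz⟩ := exists_strongRec (α := ι → F) fun m ih => fun i =>
    PowerSeries.coeff m (T (fun i => PowerSeries.mk fun l => if h : l < m then ih l h i else 0) i)
  refine ⟨fun i => PowerSeries.mk fun m => z m i, ?_⟩
  ext i m
  rw [PowerSeries.coeff_mk, hz m]
  refine hT m _ _ (fun i l hl => ?_) i
  rw [PowerSeries.coeff_mk, PowerSeries.coeff_mk, dif_pos hl]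

/-- Frobenius structures over `k⟦u⟧` dividing `p ≠ 0` that agree modulo a power of `u` depending only
on `p` are isomorphic: the change of basis solves a contracting fixed point equation. -/
theorem exists_isom_of_congr {k : Type v} [Field k] [Algebra Fq k] {p : PowerSeries k} (hp : p ≠ 0) :
    ∃ M₀ : ℕ, ∀ (s : ℕ) (A A' B : Matrix (Fin s) (Fin s) (PowerSeries k)),
      A * B = p • (1 : Matrix (Fin s) (Fin s) (PowerSeries k)) →
      (∀ i j, (PowerSeries.X : PowerSeries k) ^ M₀ ∣ A' i j - A i j) →
      ∃ Z : Matrix (Fin s) (Fin s) (PowerSeries k), Z.det ≠ 0 ∧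
        Z * A = A' * Z.map (frob Fq (PowerSeries k)) := by
  classical
  have hq : 2 ≤ Fintype.card Fq := Fintype.one_lt_card
  obtain ⟨m, v, hpv⟩ : ∃ (m : ℕ) (v : (PowerSeries k)ˣ), p = PowerSeries.X ^ m * (v : PowerSeries k) := by
    obtain ⟨m, v, h⟩ := IsDiscreteValuationRing.eq_unit_mul_pow_irreducible hp
      (PowerSeries.X_prime (R := k)).irreducible
    exact ⟨m, v, by rw [h, mul_comm]⟩
  refine ⟨m + 1 + m, fun s A A' B hAB hcong => ?_⟩
  choose Δ hΔ using hcong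
  obtain ⟨r, hr⟩ : ∃ r, Fintype.card Fq * (m + 1) = m + 1 + m + (r + 1) :=
    ⟨Fintype.card Fq * (m + 1) - (m + 1 + m + 1), by
      have := Nat.mul_le_mul_right (m + 1) hq
      omega⟩
  set x : PowerSeries k := PowerSeries.X
  let T : Matrix (Fin s) (Fin s) (PowerSeries k) → Matrix (Fin s) (Fin s) (PowerSeries k) := fun E =>
    (↑v⁻¹ : PowerSeries k) • (Matrix.of Δ * B) +
      (↑v⁻¹ * x ^ (r + 1)) • (A' * E.map (frob Fq (PowerSeries k)) * B)
  have hT : ∃ E, T E = E := by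
    let T' : (Fin s × Fin s → PowerSeries k) → (Fin s × Fin s → PowerSeries k) := fun E p =>
      T (Matrix.of fun i j => E (i, j)) p.1 p.2
    obtain ⟨E, hE⟩ := exists_fixedPoint_of_contracting T' (by
      rintro m E E' h ⟨i, j⟩
      have h1 : ∀ p, ∃ c, E p - E' p = x ^ m * c := fun p =>
        PowerSeries.X_pow_dvd_iff.2 fun l hl => by rw [map_sub, h p l hl, sub_self]
      choose c hc using h1
      have h2 : T (Matrix.of fun i j => E (i, j)) - T (Matrix.of fun i j => E' (i, j)) =
          (↑v⁻¹ * x ^ (r + 1) * frob Fq (PowerSeries k) (x ^ m)) •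
          (A' * (Matrix.of fun i j => c (i, j)).map (frob Fq (PowerSeries k)) * B) := by
        have h3 : (Matrix.of fun i j => E (i, j)) = (Matrix.of fun i j => E' (i, j)) +
            x ^ m • (Matrix.of fun i j => c (i, j)) := by
          ext1 i j
          simp only [Matrix.of_apply, Matrix.add_apply, Matrix.smul_apply, smul_eq_mul, ← hc]
          ring
        have h4 : (x ^ m • (Matrix.of fun i j => c (i, j))).map (frob Fq (PowerSeries k)) =
            frob Fq (PowerSeries k) (x ^ m) •
              (Matrix.of fun i j => c (i, j)).map (frob Fq (PowerSeries k)) := by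
          ext1 i j
          exact map_mul (frob Fq (PowerSeries k)) _ _
        rw [h3]
        simp only [T]
        rw [Matrix.map_add _ (map_add _), h4]
        simp only [Matrix.mul_add, Matrix.add_mul, smul_add, Matrix.mul_smul, Matrix.smul_mul,
          smul_smul]
        abel
      have h5 : x ^ (m + 1) ∣ T' E (i, j) - T' E' (i, j) := by
        refine Dvd.intro (↑v⁻¹ * x ^ r * x ^ (m * (Fintype.card Fq - 1)) *
            (A' * (Matrix.of fun i j => c (i, j)).map (frob Fq (PowerSeries k)) * B) i j)
            (Eq.trans ?_ (congrFun (congrFun h2 i) j).symm)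
        · rw [Matrix.smul_apply, smul_eq_mul, frob_apply]
          obtain ⟨q', hq'⟩ : ∃ q', Fintype.card Fq = q' + 1 := ⟨Fintype.card Fq - 1, by omega⟩
          rw [hq', Nat.add_sub_cancel]
          ring
      have h6 := PowerSeries.X_pow_dvd_iff.1 h5 m (by omega)
      rw [map_sub, sub_eq_zero] at h6
      exact h6)
    refine ⟨Matrix.of fun i j => E (i, j), ?_⟩
    ext1 i j
    exact congrFun hE (i, j)
  obtain ⟨E, hE⟩ := hT
  refine ⟨1 + x ^ (m + 1) • E, ?_, ?_⟩
  · intro h0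
    have h1 := congrArg (PowerSeries.constantCoeff (R := k)) h0
    rw [RingHom.map_det, map_zero] at h1
    have h2 : (PowerSeries.constantCoeff (R := k)).mapMatrix (1 + x ^ (m + 1) • E) = 1 := by
      rw [map_add, map_one]
      ext i j
      simp [x]
    rw [h2, Matrix.det_one] at h1
    exact one_ne_zero h1
  · have hdetB : B.det ≠ 0 := by
      intro h0
      have h1 := congrArg Matrix.det hAB
      rw [Matrix.det_mul, h0, mul_zero, Matrix.det_smul, Matrix.det_one, mul_one] at h1
      exact pow_ne_zero _ hp h1.symm
    have hcancel : ∀ Z : Matrix (Fin s) (Fin s) (PowerSeries k), Z * B = 0 → Z = 0 := by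
      intro Z hZ
      have h1 : (Z * B) * B.adjugate = 0 := by rw [hZ, Matrix.zero_mul]
      rw [Matrix.mul_assoc, Matrix.mul_adjugate, Matrix.mul_smul, Matrix.mul_one] at h1
      ext1 i j
      exact (mul_eq_zero.1 (congrFun (congrFun h1 i) j)).resolve_left hdetB
    rw [← sub_eq_zero]
    refine hcancel _ ?_
    have hA' : A' = A + x ^ (m + 1 + m) • Matrix.of Δ := by
      ext1 i j
      rw [Matrix.add_apply, Matrix.smul_apply, smul_eq_mul, Matrix.of_apply, ← hΔ]
      ring
    have hmap : (1 + x ^ (m + 1) • E).map (frob Fq (PowerSeries k)) =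
        1 + x ^ (Fintype.card Fq * (m + 1)) • E.map (frob Fq (PowerSeries k)) := by
      ext1 i j
      rw [Matrix.map_apply, Matrix.add_apply, Matrix.smul_apply, map_add, smul_eq_mul, map_mul,
        Matrix.add_apply, Matrix.smul_apply, smul_eq_mul, Matrix.map_apply, map_pow,
        frob_apply Fq x, ← pow_mul]
      congr 1
      by_cases h : i = j
      · subst h; simp
      · simp [h]
    have hpE : p • E = x ^ m • (Matrix.of Δ * B) +
        x ^ (m + r + 1) • (A' * E.map (frob Fq (PowerSeries k)) * B) := by
      conv_lhs => rw [← hE]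
      simp only [T, smul_add, smul_smul, hpv]
      congr 2
      · rw [mul_assoc, Units.mul_inv, mul_one]
      · rw [← mul_assoc, mul_assoc (x ^ m), Units.mul_inv, mul_one]
        ring
    have h1 : (1 + x ^ (m + 1) • E) * A * B = p • 1 + x ^ (m + 1) • (p • E) := by
      rw [Matrix.mul_assoc, hAB, Matrix.mul_smul, Matrix.mul_one, smul_add, smul_comm p]
    have h2 : A' * (1 + x ^ (m + 1) • E).map (frob Fq (PowerSeries k)) * B =
        A' * B + x ^ (m + 1 + m + (r + 1)) • (A' * E.map (frob Fq (PowerSeries k)) * B) := by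
      rw [hmap, hr, Matrix.mul_add, Matrix.mul_one, Matrix.add_mul, Matrix.mul_smul,
        Matrix.smul_mul]
    have h3 : A' * B = p • 1 + x ^ (m + 1 + m) • (Matrix.of Δ * B) := by
      rw [hA', Matrix.add_mul, hAB, Matrix.smul_mul]
    rw [Matrix.sub_mul, h1, h2, h3, hpE, smul_add, smul_smul, smul_smul, ← pow_add, ← pow_add,
      show m + 1 + (m + r + 1) = m + 1 + m + (r + 1) by ring]
    abel

end FrobeniusModules

/-! ### Local shtukas in coordinates -/

section Coordinates

variable {Fq : Type u} [Field Fq] [Fintype Fq] {k : Type v} [Field k] [Algebra Fq k]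
  {ι : PowerSeries Fq →ₐ[Fq] PowerSeries k} {h : ℕ}

/-- The coefficientwise inclusion `Fq⟦π₀⟧ → K^sep⟦π₀⟧`. -/
noncomputable abbrev coeffUr (Fq : Type u) [Field Fq] [Fintype Fq] (k : Type v) [Field k]
    [Algebra Fq k] : PowerSeries Fq →+* PowerSeries (Ksep k) :=
  PowerSeries.map (algebraMap Fq (Ksep k))

/-- The basis of `K^sep⟦π₀⟧ ⊗ 𝔐` induced by a basis of `𝔐`. -/
noncomputable def basisUr {n : Type} {M : Type v} [AddCommGroup M] [Module (SRing k) M]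
    (b : Module.Basis n (SRing k) M) : Module.Basis n (OEur k) (OEur k ⊗[OE k] (OE k ⊗[SRing k] M)) :=
  (b.baseChange (OE k)).baseChange (OEur k)

theorem basisUr_apply {n : Type} {M : Type v} [AddCommGroup M] [Module (SRing k) M]
    (b : Module.Basis n (SRing k) M) (i : n) : basisUr b i = 1 ⊗ₜ (1 ⊗ₜ b i) := by
  rw [basisUr, Module.Basis.baseChange_apply, Module.Basis.baseChange_apply]

theorem coe_galRep {M : Type w} [AddCommGroup M] [Module (OE k) M] (φ : M →ₛₗ[sigmaE Fq k] M)
    (g : GK k) (x : TE φ) : (galRep φ g x : OEur k ⊗[OE k] M) =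
      (galAct g).toLinearMap.rTensor M (x : OEur k ⊗[OE k] M) := rfl

/-- The matrix of a semilinear endomorphism. -/
noncomputable def phiMatrix {n : Type} (𝔐 : EffectiveLocalShtuka ι h)
    (b : Module.Basis n (SRing k) 𝔐.carrier) : Matrix n n (PowerSeries (PowerSeries k)) :=
  Matrix.of fun i j => b.repr (𝔐.phi (b j)) i

variable {n : Type} [Fintype n] [DecidableEq n] (𝔐 : EffectiveLocalShtuka ι h)
  (b : Module.Basis n (SRing k) 𝔐.carrier)

/-- The identification of `K^sep⟦π₀⟧` with the power series ring it is by definition. -/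
noncomputable def toOEur : PowerSeries (Ksep k) ≃+* OEur k := RingEquiv.refl _

/-- The coordinates of an element of `K^sep⟦π₀⟧ ⊗ 𝔐` in the basis induced by a basis of `𝔐`. -/
noncomputable def coordUr {n : Type} [Fintype n] {M : Type v} [AddCommGroup M] [Module (SRing k) M]
    (b : Module.Basis n (SRing k) M) :
    OEur k ⊗[OE k] (OE k ⊗[SRing k] M) ≃+ (n → PowerSeries (Ksep k)) :=
  (basisUr b).equivFun.toAddEquiv

omit [DecidableEq n] in
theorem coordUr_smul (c : PowerSeries (Ksep k))
    (x : OEur k ⊗[OE k] (OE k ⊗[SRing k] 𝔐.carrier)) :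
    coordUr b (toOEur c • x) = c • coordUr b x :=
  map_smul (basisUr b).equivFun (toOEur c) x

omit [DecidableEq n] in
theorem coordUr_symm_apply (c : n → PowerSeries (Ksep k)) :
    (coordUr b).symm c = ∑ j, toOEur (c j) • basisUr b j :=
  (basisUr b).equivFun_symm_apply c

omit [DecidableEq n] in
theorem coordUr_sum_smul (c : n → PowerSeries (Ksep k)) :
    coordUr b (∑ j, toOEur (c j) • basisUr b j) = c := by
  rw [← coordUr_symm_apply, AddEquiv.apply_symm_apply]

omit [DecidableEq n] in
theorem phiUr_basisUr (j : n) : phiUr 𝔐.phiE (basisUr b j) =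
    ∑ i, toOEur (toUr k (phiMatrix 𝔐 b i j)) • basisUr b i := by
  have hφ : phiUr 𝔐.phiE (basisUr b j) =
      ∑ i, (algebraMap (OE k) (OEur k) (algebraMap (SRing k) (OE k) (b.repr (𝔐.phi (b j)) i))) •
        basisUr b i := by
    rw [basisUr_apply]
    change (sigmaUr Fq k 1) ⊗ₜ[OE k] ((sigmaE Fq k 1) ⊗ₜ[SRing k] 𝔐.phi (b j)) = _
    conv_lhs => rw [← b.sum_repr (𝔐.phi (b j))]
    rw [map_one, map_one, TensorProduct.tmul_sum, TensorProduct.tmul_sum]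
    refine Finset.sum_congr rfl fun i _ => ?_
    rw [basisUr_apply, TensorProduct.tmul_smul, algebraMap_smul,
      ← algebraMap_smul (OE k) (b.repr (𝔐.phi (b j)) i), TensorProduct.tmul_smul]
  exact hφ

omit [DecidableEq n] in
theorem coordUr_phiUr (x : OEur k ⊗[OE k] (OE k ⊗[SRing k] 𝔐.carrier)) :
    coordUr b (phiUr 𝔐.phiE x) =
      ((phiMatrix 𝔐 b).map (toUr k)).mulVec (partialFrob Fq (Ksep k) ∘ coordUr b x) := by
  obtain ⟨c, rfl⟩ := (coordUr b).symm.surjective x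
  have h1 : ∀ j, coordUr b (phiUr 𝔐.phiE (toOEur (c j) • basisUr b j)) =
      partialFrob Fq (Ksep k) (c j) • fun i => toUr k (phiMatrix 𝔐 b i j) := fun j => by
    have h2 : phiUr 𝔐.phiE (toOEur (c j) • basisUr b j) =
      toOEur (partialFrob Fq (Ksep k) (c j)) • phiUr 𝔐.phiE (basisUr b j) :=
        (phiUr 𝔐.phiE).map_smulₛₗ _ _
    rw [h2, coordUr_smul, phiUr_basisUr, coordUr_sum_smul]
  rw [AddEquiv.apply_symm_apply, coordUr_symm_apply, map_sum, map_sum,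
    Finset.sum_congr rfl fun j _ => h1 j]
  ext1 i
  rw [Finset.sum_apply, Matrix.mulVec, dotProduct]
  exact Finset.sum_congr rfl fun j _ => mul_comm _ _

omit [DecidableEq n] in
theorem coordUr_rTensor (g : GK k) (x : OEur k ⊗[OE k] (OE k ⊗[SRing k] 𝔐.carrier)) :
    coordUr b ((galAct g).toLinearMap.rTensor _ x) =
      PowerSeries.map (g : Ksep k →+* Ksep k) ∘ coordUr b x := by
  have key : ∀ (c : OEur k) (y : OEur k ⊗[OE k] (OE k ⊗[SRing k] 𝔐.carrier)),
      (galAct g).toLinearMap.rTensor (OE k ⊗[SRing k] 𝔐.carrier) (c • y) =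
        galAct g c • (galAct g).toLinearMap.rTensor (OE k ⊗[SRing k] 𝔐.carrier) y := by
    intro c y
    induction y with
    | zero => simp
    | add y y' hy hy' => rw [smul_add, map_add, hy, hy', map_add, smul_add]
    | tmul a m =>
      rw [smul_tmul', LinearMap.rTensor_tmul, LinearMap.rTensor_tmul, smul_tmul', smul_eq_mul,
        smul_eq_mul, AlgHom.toLinearMap_apply, AlgHom.toLinearMap_apply, map_mul]
  obtain ⟨c, rfl⟩ := (coordUr b).symm.surjective x
  have h2 : ∀ j, (galAct g).toLinearMap.rTensor (OE k ⊗[SRing k] 𝔐.carrier)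
      (toOEur (c j) • basisUr b j) =
        toOEur (PowerSeries.map (g : Ksep k →+* Ksep k) (c j)) • basisUr b j := fun j => by
    rw [key, basisUr_apply, LinearMap.rTensor_tmul, AlgHom.toLinearMap_apply, map_one]
    rfl
  rw [AddEquiv.apply_symm_apply, coordUr_symm_apply, map_sum, Finset.sum_congr rfl fun j _ => h2 j,
    coordUr_sum_smul]
  rfl

/-- A trivialization of the Frobenius matrix of a local shtuka gives coordinates on the lattice of
`φ`-invariants. -/
theorem exists_coordinates {Y : Matrix n n (PowerSeries (Ksep k))} (hY : IsUnit Y.det)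
    (hAY : (phiMatrix 𝔐 b).map (toUr k) * Y.map (partialFrob Fq (Ksep k)) = Y) :
    ∃ e : TE 𝔐.phiE ≃ₗ[PowerSeries Fq] (n → PowerSeries Fq), ∀ g x,
      Y.mulVec (coeffUr Fq k ∘ e (galRep 𝔐.phiE g x)) =
        PowerSeries.map (g : Ksep k →+* Ksep k) ∘ Y.mulVec (coeffUr Fq k ∘ e x) := by
  have hYinj : Function.Injective Y.mulVec := Matrix.mulVec_injective_of_isUnit
    ((Matrix.isUnit_iff_isUnit_det Y).2 hY)
  have hcinj : Function.Injective (coeffUr Fq k) :=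
    PowerSeries.map_injective _ (algebraMap Fq (Ksep k)).injective
  obtain ⟨v, hv⟩ : ∃ v : (n → PowerSeries Fq) → OEur k ⊗[OE k] (OE k ⊗[SRing k] 𝔐.carrier),
      ∀ c, coordUr b (v c) = Y.mulVec (coeffUr Fq k ∘ c) :=
    ⟨fun c => (coordUr b).symm (Y.mulVec (coeffUr Fq k ∘ c)), fun c =>
      AddEquiv.apply_symm_apply _ _⟩
  have hfix : ∀ x, x ∈ TE 𝔐.phiE ↔ ∃ c, x = v c := by
    intro x
    have h1 : x ∈ TE 𝔐.phiE ↔ phiUr 𝔐.phiE x = x := Iff.rfl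
    rw [h1, ← (coordUr b).injective.eq_iff, coordUr_phiUr, fixed_iff_of_trivialization hY hAY]
    exact exists_congr fun c => by
      rw [← hv, (coordUr b).injective.eq_iff]
  obtain ⟨f, hfv⟩ : ∃ f : (n → PowerSeries Fq) →ₗ[PowerSeries Fq] TE 𝔐.phiE,
      ∀ c, (f c : OEur k ⊗[OE k] (OE k ⊗[SRing k] 𝔐.carrier)) = v c :=
   ⟨{ toFun := fun c => ⟨v c, (hfix _).2 ⟨c, rfl⟩⟩
      map_add' := fun c c' => Subtype.ext <| (coordUr b).injective <| by
        rw [Submodule.coe_add, map_add, hv, hv, hv, ← Matrix.mulVec_add]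
        congr 1
        ext1 i
        simp
      map_smul' := fun a c => Subtype.ext <| (coordUr b).injective <| by
        have h1 : (coeffUr Fq k ∘ (a • c) : n → PowerSeries (Ksep k)) =
            coeffUr Fq k a • (coeffUr Fq k ∘ c) := by
          ext1 i
          simp
        have h2 : a • v c = toOEur (coeffUr Fq k a) • v c :=
          (algebraMap_smul (OEur k) a (v c)).symm
        rw [RingHom.id_apply, Submodule.coe_smul, hv, h2, coordUr_smul, hv, h1,
          Matrix.mulVec_smul] }, fun _ => rfl⟩
  have hf : Function.Bijective f := by
    constructor
    · intro c c' hcc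
      have h1 := congrArg (fun x : TE 𝔐.phiE => coordUr b x.1) hcc
      rw [hfv, hfv, hv, hv] at h1
      exact funext fun i => hcinj (congrFun (hYinj h1) i)
    · rintro ⟨x, hx⟩
      obtain ⟨c, rfl⟩ := (hfix x).1 hx
      exact ⟨c, Subtype.ext (hfv c)⟩
  have hback : ∀ x : TE 𝔐.phiE,
      Y.mulVec (coeffUr Fq k ∘ (LinearEquiv.ofBijective f hf).symm x) = coordUr b x.1 := fun x => by
    obtain ⟨c, rfl⟩ := hf.2 x
    rw [LinearEquiv.ofBijective_symm_apply_apply, hfv, hv]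
  refine ⟨(LinearEquiv.ofBijective f hf).symm, fun g x => ?_⟩
  rw [hback, hback, coe_galRep, coordUr_rTensor]

end Coordinates

/-! ### The lattices of height `≤ h` in coordinates -/

section LatticeCoordinates

variable {Fq : Type u} [Field Fq] [Fintype Fq] {k : Type v} [Field k] [Algebra Fq k]

theorem map_X_ne_zero (ι : PowerSeries Fq →ₐ[Fq] PowerSeries k) [Finite k]
    (hι : (ι : PowerSeries Fq →+* PowerSeries k).Finite) : ι PowerSeries.X ≠ 0 := by
  intro h0
  have hconst : ∀ f : PowerSeries Fq, ι f = algebraMap Fq (PowerSeries k)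
      (PowerSeries.constantCoeff f) := fun f => by
    obtain ⟨f', hf'⟩ := PowerSeries.X_dvd_iff (φ := f - algebraMap Fq _ (PowerSeries.constantCoeff f))
      |>.2 (by simp)
    rw [sub_eq_iff_eq_add] at hf'
    conv_lhs => rw [hf']
    rw [map_add, map_mul, h0, zero_mul, zero_add, AlgHom.commutes]
  let _ : Algebra (PowerSeries Fq) (PowerSeries k) := (ι : PowerSeries Fq →+* PowerSeries k).toAlgebra
  obtain ⟨s, hs⟩ := (hι : Module.Finite (PowerSeries Fq) (PowerSeries k)).fg_top
  have h1 : Submodule.span Fq (s : Set (PowerSeries k)) = ⊤ := by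
    refine eq_top_iff.2 fun x _ => ?_
    have hx : x ∈ Submodule.span (PowerSeries Fq) (s : Set (PowerSeries k)) := hs ▸ trivial
    induction hx using Submodule.span_induction with
    | mem x hx => exact Submodule.subset_span hx
    | zero => exact zero_mem _
    | add x y _ _ hx hy => exact add_mem (hx trivial) (hy trivial)
    | smul a x _ hx =>
      have h2 : a • x = PowerSeries.constantCoeff a • x := by
        rw [Algebra.smul_def, Algebra.smul_def]
        exact congrArg (· * x) (hconst a)
      rw [h2]
      exact Submodule.smul_mem _ _ (hx trivial)
  have h2 : Module.Finite Fq (PowerSeries k) := ⟨⟨s, h1⟩⟩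
  have h3 : Finite (PowerSeries k) := Module.finite_of_finite Fq
  have h4 : Function.Injective fun n : ℕ => (PowerSeries.X : PowerSeries k) ^ n := fun m n hmn => by
    have := congrArg PowerSeries.order hmn
    simpa [PowerSeries.order_X_pow] using this
  exact not_injective_infinite_finite _ h4

/-- `π₀ - u₀` as a power series over `k⟦u⟧`. -/
noncomputable def piSub (ι : PowerSeries Fq →ₐ[Fq] PowerSeries k) : PowerSeries (PowerSeries k) :=
  curlyP ι

omit [Fintype Fq] in
theorem constantCoeff_piSub (ι : PowerSeries Fq →ₐ[Fq] PowerSeries k) :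
    PowerSeries.constantCoeff (piSub ι) = -ι PowerSeries.X := by
  have : piSub ι = (PowerSeries.X - PowerSeries.C (ι PowerSeries.X) :
    PowerSeries (PowerSeries k)) := rfl
  rw [this]
  simp

omit [Fintype Fq] in
theorem isUnit_toUr_piSub {ι : PowerSeries Fq →ₐ[Fq] PowerSeries k} (hu : ι PowerSeries.X ≠ 0) :
    IsUnit (toUr k (piSub ι)) := by
  rw [PowerSeries.isUnit_iff_constantCoeff, constantCoeff_map, constantCoeff_piSub,
    isUnit_iff_ne_zero, map_neg, neg_ne_zero]
  exact fun h => hu (emb_injective (h.trans (map_zero _).symm))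

variable {ι : PowerSeries Fq →ₐ[Fq] PowerSeries k} {h : ℕ}

omit [Fintype Fq] in
theorem isUnit_det_map_toUr {n : Type*} [Fintype n] [DecidableEq n] (hu : ι PowerSeries.X ≠ 0)
    {A B : Matrix n n (PowerSeries (PowerSeries k))}
    (hAB : A * B = piSub ι ^ h • (1 : Matrix n n (PowerSeries (PowerSeries k)))) :
    IsUnit (A.map (toUr k)).det := by
  have h1 := congrArg (fun M => (toUr k) (Matrix.det M)) hAB
  simp only [Matrix.det_mul, map_mul, Matrix.det_smul, Matrix.det_one, mul_one, map_pow] at h1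
  rw [← RingHom.mapMatrix_apply, ← RingHom.map_det]
  exact isUnit_of_mul_isUnit_left (h1 ▸ ((isUnit_toUr_piSub hu).pow _).pow _)

/-- Coordinates for a representation of height `≤ h`: a matrix `A` over `k⟦u⟧⟦π₀⟧` dividing
`(π₀ - u₀)^h`, a trivialization `Y` of `A` over `K^sep⟦π₀⟧`, and an isomorphism of the module with
`Fq⟦π₀⟧^n ≅ Y Fq⟦π₀⟧^n`, which is equivariant up to the twist by `χ_LT^h`. -/
def HasShtukaCoordinates (ι : PowerSeries Fq →ₐ[Fq] PowerSeries k) (h : ℕ)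
    {T : Type w} [AddCommMonoid T] [Module (PowerSeries Fq) T]
    (τ : Representation (PowerSeries Fq) (GK k) T) : Prop :=
  ∃ (n : Type) (_ : Fintype n) (_ : DecidableEq n) (A B : Matrix n n (PowerSeries (PowerSeries k)))
    (Y : Matrix n n (PowerSeries (Ksep k))) (e : T ≃ₗ[PowerSeries Fq] (n → PowerSeries Fq)),
    A * B = piSub ι ^ h • (1 : Matrix n n (PowerSeries (PowerSeries k))) ∧ IsUnit Y.det ∧
    A.map (toUr k) * Y.map (partialFrob Fq (Ksep k)) = Y ∧
    ∀ g x, Y.mulVec (coeffUr Fq k ∘ e (τ g x)) = coeffUr Fq k (chiLT ι g ^ h) •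
      (PowerSeries.map (g : Ksep k →+* Ksep k) ∘ Y.mulVec (coeffUr Fq k ∘ e x))

theorem coeffUr_comp_smul {n : Type*} (a : PowerSeries Fq) (c : n → PowerSeries Fq) :
    (coeffUr Fq k ∘ (a • c) : n → PowerSeries (Ksep k)) = coeffUr Fq k a • (coeffUr Fq k ∘ c) := by
  ext1 i
  simp

theorem mulVec_coeffUr_injective {n : Type*} [Fintype n] [DecidableEq n]
    {Y : Matrix n n (PowerSeries (Ksep k))} (hY : IsUnit Y.det) :
    Function.Injective fun c : n → PowerSeries Fq => Y.mulVec (coeffUr Fq k ∘ c) := fun _ _ hcc =>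
  funext fun i => PowerSeries.map_injective _ (algebraMap Fq (Ksep k)).injective
    (congrFun (Matrix.mulVec_injective_of_isUnit ((Matrix.isUnit_iff_isUnit_det Y).2 hY) hcc) i)

/-- The shtuka on `k⟦u⟧⟦π₀⟧^n` with Frobenius matrix `A`. -/
noncomputable def shtukaOfMatrix {n : Type} [Fintype n] [DecidableEq n]
    {A B : Matrix n n (SRing k)}
    (hAB : A * B = curlyP ι ^ h • (1 : Matrix n n (SRing k))) :
    EffectiveLocalShtuka ι h where
  carrier := n → SRing k
  phi :=
    { toFun := fun x => A.mulVec (sigmaS Fq k ∘ x)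
      map_add' := fun x y => by
        rw [← Matrix.mulVec_add]
        congr 1
        ext1 i
        simp
      map_smul' := fun a x => by
        rw [← Matrix.mulVec_smul]
        congr 1
        ext1 i
        simp }
  height_le m := by
    have h1 : curlyP ι ^ h • m = ∑ j, (B.mulVec m j) •
        (A.mulVec (sigmaS Fq k ∘ Pi.single j 1)) := by
      have h2 : ∀ j, A.mulVec (sigmaS Fq k ∘ Pi.single j 1) =
          A.mulVec (Pi.single j 1) := fun j => by
        congr 1
        ext1 i
        rw [Function.comp_apply]
        by_cases hij : i = j
        · subst hij; simp
        · simp [hij]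
      simp_rw [h2, ← Matrix.mulVec_smul]
      rw [← Matrix.mulVec_sum]
      have h3 : ∑ j, B.mulVec m j • (Pi.single j 1 : n → SRing k) =
          B.mulVec m := by
        ext1 i
        simp [Finset.sum_apply, Pi.single_apply]
      rw [h3, Matrix.mulVec_mulVec]
      rw [hAB, Matrix.smul_mulVec, Matrix.one_mulVec]
    rw [h1]
    exact sum_mem fun j _ => Submodule.smul_mem _ _ (Submodule.subset_span ⟨_, rfl⟩)

theorem phiMatrix_shtukaOfMatrix {n : Type} [Fintype n] [DecidableEq n]
    {A B : Matrix n n (SRing k)}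
    (hAB : A * B = curlyP ι ^ h • (1 : Matrix n n (SRing k))) :
    phiMatrix (shtukaOfMatrix hAB) (Pi.basisFun (SRing k) n) = A := by
  ext1 i j
  change A.mulVec (sigmaS Fq k ∘ Pi.basisFun (SRing k) n j) i = A i j
  have : (sigmaS Fq k ∘ Pi.basisFun (SRing k) n j : n → SRing k) = Pi.single j 1 := by
    ext1 i
    rw [Function.comp_apply, Pi.basisFun_apply]
    by_cases hij : i = j
    · subst hij; simp
    · simp [hij]
  rw [this, Matrix.mulVec_single_one]
  rfl

/-- The coordinates of the lattice attached to a local shtuka. -/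
theorem hasShtukaCoordinates_galRep (hu : ι PowerSeries.X ≠ 0) (𝔐 : EffectiveLocalShtuka ι h) :
    HasShtukaCoordinates ι h 𝔐.galRep := by
  classical
  have : Nontrivial (SRing k) := inferInstanceAs (Nontrivial (PowerSeries (PowerSeries k)))
  let b := Module.finBasis (SRing k) 𝔐.carrier
  have hspan : ∀ m ∈ Submodule.span (SRing k) (Set.range 𝔐.phi),
      ∃ c : Fin (Module.finrank (SRing k) 𝔐.carrier) → SRing k, ∑ j, c j • 𝔐.phi (b j) = m := by
    intro m hm
    refine (Submodule.mem_span_range_iff_exists_fun (SRing k)).1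
      (Submodule.span_le.2 (Set.range_subset_iff.2 fun x => ?_) hm)
    rw [← b.sum_repr x, map_sum]
    simp_rw [map_smulₛₗ]
    exact sum_mem fun j _ => Submodule.smul_mem _ _ (Submodule.subset_span ⟨j, rfl⟩)
  choose c hc using fun j => hspan _ (𝔐.height_le (b j))
  let B : Matrix _ _ (PowerSeries (PowerSeries k)) := Matrix.of fun i j => c j i
  have hAB : phiMatrix 𝔐 b * B = piSub ι ^ h • (1 : Matrix _ _ (PowerSeries (PowerSeries k))) := by
    ext1 i j
    have h1 := congrArg (fun m => b.repr m i) (hc j)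
    simp only [map_sum, map_smul, Finsupp.coe_finsetSum, Finset.sum_apply, Finsupp.smul_apply,
      Module.Basis.repr_self] at h1
    rw [Matrix.mul_apply, Matrix.smul_apply, Matrix.one_apply]
    refine Eq.trans (Finset.sum_congr rfl fun l _ => mul_comm _ _) (h1.trans ?_)
    rw [Finsupp.single_apply]
    exact congrArg (fun x : SRing k => curlyP ι ^ h * x) (if_congr eq_comm rfl rfl)
  obtain ⟨Y, hY, hAY⟩ := exists_trivialization (Fq := Fq) (isUnit_det_map_toUr hu hAB)
  obtain ⟨e, he⟩ := exists_coordinates 𝔐 b hY hAY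
  refine ⟨_, _, inferInstance, _, B, Y, e, hAB, hY, hAY, fun g x => ?_⟩
  rw [← he, ← Matrix.mulVec_smul, ← coeffUr_comp_smul, ← map_smul]
  rfl

theorem HasShtukaCoordinates.congr {T : Type w} [AddCommMonoid T] [Module (PowerSeries Fq) T]
    {τ : Representation (PowerSeries Fq) (GK k) T} {T' : Type t} [AddCommMonoid T']
    [Module (PowerSeries Fq) T'] {τ' : Representation (PowerSeries Fq) (GK k) T'}
    (f : τ.Equiv τ') (hτ : HasShtukaCoordinates ι h τ') : HasShtukaCoordinates ι h τ := by
  obtain ⟨n, _, _, A, B, Y, e, hAB, hY, hAY, he⟩ := hτ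
  refine ⟨n, _, _, A, B, Y, f.toLinearEquiv.trans e, hAB, hY, hAY, fun g x => ?_⟩
  have h1 : f.toLinearEquiv (τ g x) = τ' g (f.toLinearEquiv x) :=
    LinearMap.congr_fun (f.toIntertwiningMap.isIntertwining' g) x
  rw [LinearEquiv.trans_apply, LinearEquiv.trans_apply, h1, he]

/-- A lattice is of height `≤ h` if and only if it admits coordinates. -/
theorem latticeHeightLE_iff (hu : ι PowerSeries.X ≠ 0) {T : Type w} [AddCommGroup T]
    [Module (PowerSeries Fq) T] {τ : Representation (PowerSeries Fq) (GK k) T} :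
    LatticeHeightLE ι h τ ↔ IsLatticeRep τ ∧ HasShtukaCoordinates ι h τ := by
  refine and_congr_right fun _ => ⟨fun ⟨𝔐, ⟨f⟩⟩ => (hasShtukaCoordinates_galRep hu 𝔐).congr f, ?_⟩
  rintro ⟨n, _, _, A, B, Y, e, hAB, hY, hAY, he⟩
  let 𝔐 : EffectiveLocalShtuka ι h := shtukaOfMatrix (A := A) (B := B) hAB
  refine ⟨𝔐, ?_⟩
  have hA : phiMatrix 𝔐 (Pi.basisFun (SRing k) n) = A := phiMatrix_shtukaOfMatrix (A := A) hAB
  obtain ⟨e', he'⟩ := exists_coordinates 𝔐 (Pi.basisFun (SRing k) n) hY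
    (by rw [hA, hAY])
  have h1 : ∀ g x, e' (𝔐.galRep g (e'.symm (e x))) = e (τ g x) := fun g x => by
    refine mulVec_coeffUr_injective hY ?_
    have h2 : 𝔐.galRep g (e'.symm (e x)) =
      chiLT ι g ^ h • galRep 𝔐.phiE g (e'.symm (e x)) := rfl
    dsimp only
    rw [he, h2, map_smul, coeffUr_comp_smul, Matrix.mulVec_smul, he', LinearEquiv.apply_symm_apply]
  refine ⟨.mk (e.trans e'.symm) fun g => LinearMap.ext fun x => e'.injective ?_⟩
  rw [LinearMap.comp_apply, LinearMap.comp_apply]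
  exact (e'.apply_symm_apply _).trans (h1 g x).symm

end LatticeCoordinates

/-! ### Sublattices and products of lattices of height `≤ h` -/

section LatticeOperations

set_option linter.unusedSectionVars false

variable {Fq : Type u} [Field Fq] [Fintype Fq] {k : Type v} [Field k] [Algebra Fq k]
  {ι : PowerSeries Fq →ₐ[Fq] PowerSeries k} {h : ℕ}
  {T : Type w} [AddCommGroup T] [Module (PowerSeries Fq) T]
  {τ : Representation (PowerSeries Fq) (GK k) T}

theorem mulVec_map_injective {L : Type w} [Field L] [Algebra Fq L] {n : Type*} [Fintype n]
    [DecidableEq n] {Y : Matrix n n (PowerSeries L)} (hY : IsUnit Y.det) :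
    Function.Injective fun c : n → PowerSeries Fq =>
      Y.mulVec (PowerSeries.map (algebraMap Fq L) ∘ c) := fun _ _ hcc =>
  funext fun i => PowerSeries.map_injective _ (algebraMap Fq L).injective
    (congrFun (Matrix.mulVec_injective_of_isUnit ((Matrix.isUnit_iff_isUnit_det Y).2 hY) hcc) i)

theorem map_comp_smul {R S : Type*} [CommRing R] [CommRing S] (f : R →+* S) {m : Type*} (a : R)
    (c : m → R) : f ∘ (a • c) = f a • (f ∘ c) := by
  ext1 i
  simp

theorem map_comp_add {R S : Type*} [CommRing R] [CommRing S] (f : R →+* S) {m : Type*}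
    (c c' : m → R) : f ∘ (c + c') = f ∘ c + f ∘ c' := by
  ext1 i
  simp

/-- If `D` is a basis of the integral vectors in the span of `C` and `A₁` is the Frobenius on it, then
`C` is the lattice of fixed vectors of `A₁`. -/
theorem exists_equiv_of_sublattice_matrices {O : Type v} [CommRing O] [Algebra Fq O]
    {L : Type w} [Field L] [Algebra Fq L] {e : O →+* L} {n : Type*} [Fintype n] [DecidableEq n]
    {A : Matrix n n (PowerSeries O)} {Y : Matrix n n (PowerSeries L)} (hY : IsUnit Y.det)
    (hAY : A.map (PowerSeries.map e) * Y.map (partialFrob Fq L) = Y)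
    {C : Submodule (PowerSeries Fq) (n → PowerSeries Fq)} {s : ℕ}
    {D : Matrix n (Fin s) (PowerSeries O)} {A₁ : Matrix (Fin s) (Fin s) (PowerSeries O)}
    (hAD : A * D.map (partialFrob Fq O) = D * A₁)
    (hDinj : ∀ x : Fin s → PowerSeries L, (D.map (PowerSeries.map e)).mulVec x = 0 → x = 0)
    (hDW : ∀ y, y ∈ spanLattice Y C ↔ ∃ x, (D.map (PowerSeries.map e)).mulVec x = y)
    {Y₁ : Matrix (Fin s) (Fin s) (PowerSeries L)} (hY₁ : IsUnit Y₁.det)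
    (hAY₁ : A₁.map (PowerSeries.map e) * Y₁.map (partialFrob Fq L) = Y₁) :
    ∃ e₁ : C ≃ₗ[PowerSeries Fq] (Fin s → PowerSeries Fq), ∀ c : C,
      (D.map (PowerSeries.map e)).mulVec (Y₁.mulVec (PowerSeries.map (algebraMap Fq L) ∘ e₁ c)) =
        Y.mulVec (PowerSeries.map (algebraMap Fq L) ∘ (c : n → PowerSeries Fq)) := by
  have hDinj' : Function.Injective (D.map (PowerSeries.map e)).mulVec := fun x y hxy => by
    rw [← sub_eq_zero]
    refine hDinj _ ?_
    rw [Matrix.mulVec_sub, sub_eq_zero]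
    exact hxy
  -- the two descriptions of the fixed vectors in `W`
  have hADσ : ∀ x, (A.map (PowerSeries.map e)).mulVec
      (partialFrob Fq L ∘ (D.map (PowerSeries.map e)).mulVec x) =
      (D.map (PowerSeries.map e)).mulVec ((A₁.map (PowerSeries.map e)).mulVec (partialFrob Fq (L) ∘ x)) := by
    intro x
    rw [map_comp_mulVec, Matrix.mulVec_mulVec, Matrix.mulVec_mulVec, ← Matrix.map_mul, ← hAD,
      Matrix.map_mul]
    congr 2
    ext1 i j
    exact partialFrob_map Fq e _
  have h1 : ∀ c₁ : Fin s → PowerSeries Fq, ∃ c : n → PowerSeries Fq,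
      Y.mulVec (PowerSeries.map (algebraMap Fq L) ∘ c) =
        (D.map (PowerSeries.map e)).mulVec (Y₁.mulVec (PowerSeries.map (algebraMap Fq L) ∘ c₁)) := by
    intro c₁
    have h2 := (fixed_iff_of_trivialization hY hAY
      ((D.map (PowerSeries.map e)).mulVec (Y₁.mulVec (PowerSeries.map (algebraMap Fq L) ∘ c₁)))).1 (by
        rw [hADσ, (fixed_iff_of_trivialization hY₁ hAY₁ _).2 ⟨c₁, rfl⟩])
    exact ⟨h2.choose, h2.choose_spec.symm⟩
  choose f hf using h1
  have hfC : ∀ c, c ∈ C ↔ ∃ c₁, f c₁ = c := by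
    intro c
    constructor
    · intro hc
      obtain ⟨x, hx⟩ := (hDW _).1 (mulVec_mem_spanLattice (Y := Y) hc)
      have h2 : (A₁.map (PowerSeries.map e)).mulVec (partialFrob Fq (L) ∘ x) = x := by
        refine hDinj' ?_
        rw [← hADσ]
        refine Eq.trans ?_ hx.symm
        exact (congrArg (fun y => (A.map (PowerSeries.map e)).mulVec (partialFrob Fq (L) ∘ y)) hx).trans
          ((fixed_iff_of_trivialization hY hAY _).2 ⟨c, rfl⟩)
      obtain ⟨c₁, rfl⟩ := (fixed_iff_of_trivialization hY₁ hAY₁ _).1 h2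
      exact ⟨c₁, mulVec_map_injective hY ((hf c₁).trans hx)⟩
    · rintro ⟨c₁, rfl⟩
      refine mem_of_mulVec_mem_spanLattice hY ((hDW _).2 ⟨_, (hf c₁).symm⟩)
  let F : (Fin s → PowerSeries Fq) →ₗ[PowerSeries Fq] (n → PowerSeries Fq) :=
    { toFun := f
      map_add' := fun c c' => mulVec_map_injective hY <| by
        dsimp only
        rw [map_comp_add, Matrix.mulVec_add, hf, hf, hf, map_comp_add, Matrix.mulVec_add, Matrix.mulVec_add]
      map_smul' := fun a c => mulVec_map_injective hY <| by
        dsimp only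
        rw [RingHom.id_apply, map_comp_smul, Matrix.mulVec_smul, hf, hf, map_comp_smul,
          Matrix.mulVec_smul, Matrix.mulVec_smul] }
  have hF : Function.Injective F := fun c c' hcc =>
    mulVec_map_injective hY₁ (hDinj' (((hf c).symm.trans
      (congrArg (fun c => Y.mulVec (PowerSeries.map (algebraMap Fq L) ∘ c)) hcc)).trans (hf c')))
  have hrange : LinearMap.range F = C := by
    ext c
    exact (hfC c).symm
  refine ⟨((LinearEquiv.ofInjective F hF).trans (LinearEquiv.ofEq _ _ hrange)).symm, fun c => ?_⟩
  rw [← hf]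
  congr 2
  have h2 := ((LinearEquiv.ofInjective F hF).trans (LinearEquiv.ofEq _ _ hrange)).apply_symm_apply c
  exact congrArg Subtype.val h2

theorem map_galois_comp_mulVec {m n : Type*} [Fintype n] (g : GK k)
    (D : Matrix m n (PowerSeries (PowerSeries k))) (x : n → PowerSeries (Ksep k)) :
    PowerSeries.map (g : Ksep k →+* Ksep k) ∘ (D.map (toUr k)).mulVec x =
      (D.map (toUr k)).mulVec (PowerSeries.map (g : Ksep k →+* Ksep k) ∘ x) := by
  rw [map_comp_mulVec]
  congr 1
  ext1 i j
  exact galois_toUr g _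

theorem chiLT_inv_mul (g : GK k) : chiLT ι g⁻¹ ^ h * chiLT ι g ^ h = 1 := by
  rw [← mul_pow, ← map_mul, inv_mul_cancel, map_one, one_pow]

theorem galois_mem_spanLattice {n : Type*} [Fintype n] {Y : Matrix n n (PowerSeries (Ksep k))}
    {C : Submodule (PowerSeries Fq) (n → PowerSeries Fq)} {g : GK k}
    (hC : ∀ c ∈ C, PowerSeries.map (g : Ksep k →+* Ksep k) ∘ Y.mulVec (coeffUr Fq k ∘ c) ∈
      spanLattice Y C) :
    ∀ x ∈ spanLattice Y C, PowerSeries.map (g : Ksep k →+* Ksep k) ∘ x ∈ spanLattice Y C := by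
  intro x hx
  rw [spanLattice] at hx
  induction hx using Submodule.span_induction with
  | mem x hx =>
    obtain ⟨c, hc, rfl⟩ := hx
    exact hC c hc
  | zero =>
    convert (spanLattice Y C).zero_mem using 1
    ext1 i; simp
  | add x y _ _ hx hy =>
    convert add_mem hx hy using 1
    ext1 i; simp
  | smul c x _ hx =>
    convert (spanLattice Y C).smul_mem (PowerSeries.map (g : Ksep k →+* Ksep k) c) hx using 1
    ext1 i; simp

/-- A Galois stable sublattice containing a power of `π₀` inherits coordinates: the integral vectors
in its `K^sep⟦π₀⟧`-span are a free `φ`-stable module, on which the Frobenius still divides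
`(π₀ - u₀)^h`. -/
theorem HasShtukaCoordinates.subrepresentation (hτ : HasShtukaCoordinates ι h τ)
    (T₁ : Submodule (PowerSeries Fq) T) (hT₁ : ∀ g, T₁ ≤ T₁.comap (τ g)) {N : ℕ}
    (hN : ∀ t : T, (PowerSeries.X : PowerSeries Fq) ^ N • t ∈ T₁) :
    HasShtukaCoordinates ι h (τ.subrepresentation T₁ hT₁) := by
  obtain ⟨n, _, _, A, B, Y, e, hAB, hY, hAY, he⟩ := hτ
  obtain ⟨C, E, hE⟩ : ∃ (C : Submodule (PowerSeries Fq) (n → PowerSeries Fq))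
      (E : T₁ ≃ₗ[PowerSeries Fq] C), ∀ t, (E t : n → PowerSeries Fq) = e t :=
    ⟨_, e.submoduleMap T₁, fun _ => rfl⟩
  have hmemC : ∀ t, e t ∈ C ↔ t ∈ T₁ := fun t => by
    constructor
    · intro ht
      obtain ⟨t', ht'⟩ := E.surjective ⟨_, ht⟩
      have h1 : e t' = e t := (hE t').symm.trans (congrArg Subtype.val ht')
      rw [← e.injective h1]
      exact t'.2
    · intro ht
      rw [← hE ⟨t, ht⟩]
      exact (E ⟨t, ht⟩).2
  have hCN : ∀ c : n → PowerSeries Fq, (PowerSeries.X : PowerSeries Fq) ^ N • c ∈ C := fun c => by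
    rw [← e.apply_symm_apply c, ← map_smul, hmemC]
    exact hN _
  obtain ⟨W, hWdef⟩ : ∃ W, W = spanLattice Y C := ⟨_, rfl⟩
  have hgal : ∀ (g : GK k) (t : T), PowerSeries.map (g : Ksep k →+* Ksep k) ∘
      Y.mulVec (coeffUr Fq k ∘ e t) =
        coeffUr Fq k (chiLT ι g⁻¹ ^ h) • Y.mulVec (coeffUr Fq k ∘ e (τ g t)) := fun g t => by
    rw [he, smul_smul, ← map_mul, chiLT_inv_mul, map_one, one_smul]
  have hWgal : ∀ (g : GK k), ∀ x ∈ W, PowerSeries.map (g : Ksep k →+* Ksep k) ∘ x ∈ W := by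
    rw [hWdef]
    refine fun g x => galois_mem_spanLattice (fun c hc => ?_) x
    obtain ⟨t, rfl⟩ := e.surjective c
    rw [hgal]
    exact Submodule.smul_mem _ _ (mulVec_mem_spanLattice ((hmemC _).2 (hT₁ g ((hmemC _).1 hc))))
  have hWN := X_pow_smul_mem_spanLattice hY hCN
  rw [← hWdef] at hWN
  have hfree := free_of_saturated (integralVectors (emb k) W) (integralVectors_saturated W)
  have hfin : Module.Finite (PowerSeries (PowerSeries k)) (integralVectors (emb k) W) :=
    inferInstance
  have hspan := le_span_integralVectors W hWgal hWN
  subst hWdef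
  obtain ⟨s, D, A₁, B₁, hAB₁, hAD, hA₁, hDinj, hDW⟩ := exists_sublattice_matrices emb_injective hAB
    hY hAY hCN hspan
  obtain ⟨Y₁, hY₁, hAY₁⟩ := exists_trivialization (Fq := Fq) hA₁
  have hDinj' : Function.Injective (D.map (toUr k)).mulVec := fun x y hxy => by
    rw [← sub_eq_zero]
    apply hDinj
    rw [Matrix.mulVec_sub, sub_eq_zero]
    exact hxy
  obtain ⟨e₂, he₂⟩ := exists_equiv_of_sublattice_matrices hY hAY hAD hDinj hDW hY₁ hAY₁
  have he₁ : ∀ t : T₁, (D.map (toUr k)).mulVec (Y₁.mulVec (coeffUr Fq k ∘ e₂ (E t))) =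
      Y.mulVec (coeffUr Fq k ∘ e t) := fun t => by
    rw [he₂, hE]
  have heq : ∀ (g : GK k) (x : T₁), Y₁.mulVec (coeffUr Fq k ∘ e₂ (E ⟨τ g x, hT₁ g x.2⟩)) =
      coeffUr Fq k (chiLT ι g ^ h) •
        (PowerSeries.map (g : Ksep k →+* Ksep k) ∘ Y₁.mulVec (coeffUr Fq k ∘ e₂ (E x))) := by
    intro g x
    apply hDinj'
    rw [Matrix.mulVec_smul, ← map_galois_comp_mulVec, he₁, he₁]
    exact he g x
  have hcoord : ∃ e' : T₁ ≃ₗ[PowerSeries Fq] (Fin s → PowerSeries Fq), ∀ x, e' x = e₂ (E x) :=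
    ⟨E.trans e₂, fun _ => rfl⟩
  obtain ⟨e', he'⟩ := hcoord
  refine ⟨Fin s, inferInstance, inferInstance, A₁, B₁, Y₁, e', hAB₁, hY₁, hAY₁, fun g x => ?_⟩
  rw [he', he']
  exact heq g x

/-- Continuity of a lattice representation modulo a stable open submodule. -/
theorem IsLatticeRep.isOpen_sub_mem (hτ : IsLatticeRep τ) (M : Submodule (PowerSeries Fq) T)
    (hM : ∀ g, M ≤ M.comap (τ g)) {m : ℕ}
    (hm : ∀ t : T, (PowerSeries.X : PowerSeries Fq) ^ m • t ∈ M) (x : T) :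
    IsOpen {g : GK k | τ g x - x ∈ M} := by
  have hle : Ideal.span {(PowerSeries.X : PowerSeries Fq) ^ m} •
      (⊤ : Submodule (PowerSeries Fq) T) ≤ M := by
    rw [Submodule.ideal_span_singleton_smul]
    rintro _ ⟨t, -, rfl⟩
    exact hm t
  rw [isOpen_iff_mem_nhds]
  intro g₀ hg₀
  have h1 : IsOpen {g : GK k | g₀⁻¹ * g ∈ {g : GK k | τ g x - x ∈
      Ideal.span {(PowerSeries.X : PowerSeries Fq) ^ m} • (⊤ : Submodule (PowerSeries Fq) T)}} :=
    (hτ.continuous m x).preimage (continuous_const_mul g₀⁻¹)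
  refine Filter.mem_of_superset (h1.mem_nhds ?_) fun g hg => ?_
  · rw [Set.mem_ofPred_eq, inv_mul_cancel, Set.mem_ofPred_eq, map_one, Module.End.one_apply, sub_self]
    exact zero_mem _
  · rw [Set.mem_ofPred_eq] at hg₀ ⊢
    have h2 : τ g x - x = τ g₀ (τ (g₀⁻¹ * g) x - x) + (τ g₀ x - x) := by
      rw [map_sub, ← Module.End.mul_apply, ← map_mul, mul_inv_cancel_left]
      abel
    rw [h2]
    exact add_mem (hM g₀ (hle hg)) hg₀

theorem IsLatticeRep.subrepresentation (hτ : IsLatticeRep τ)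
    (T₁ : Submodule (PowerSeries Fq) T) (hT₁ : ∀ g, T₁ ≤ T₁.comap (τ g)) {N : ℕ}
    (hN : ∀ t : T, (PowerSeries.X : PowerSeries Fq) ^ N • t ∈ T₁) :
    IsLatticeRep (τ.subrepresentation T₁ hT₁) := by
  have := hτ.free
  have := hτ.finite
  refine ⟨inferInstance, inferInstance, fun n x => ?_⟩
  set M' : Submodule (PowerSeries Fq) T₁ :=
    Ideal.span {(PowerSeries.X : PowerSeries Fq) ^ n} • ⊤ with hM'
  have hmem : ∀ y : T₁, y ∈ M' ↔ ∃ z : T₁, (PowerSeries.X : PowerSeries Fq) ^ n • z = y := fun y => by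
    rw [hM', Submodule.ideal_span_singleton_smul]
    exact ⟨fun ⟨z, _, hz⟩ => ⟨z, hz⟩, fun ⟨z, hz⟩ => ⟨z, trivial, hz⟩⟩
  have h1 := hτ.isOpen_sub_mem (M'.map T₁.subtype) (by
    rintro g _ ⟨y, hy, rfl⟩
    obtain ⟨z, rfl⟩ := (hmem y).1 hy
    exact ⟨_, (hmem _).2 ⟨⟨τ g z, hT₁ g z.2⟩, rfl⟩, by simp⟩) (m := n + N) (fun t =>
    ⟨_, (hmem _).2 ⟨⟨_, hN t⟩, rfl⟩, by simp [pow_add, mul_smul]⟩) x.1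
  convert h1 using 3 with g
  constructor
  · exact fun h => ⟨_, h, rfl⟩
  · rintro ⟨y, hy, h⟩
    have h2 : (τ.subrepresentation T₁ hT₁) g x - x = y := Subtype.ext h.symm
    exact h2 ▸ hy

/-- A Galois stable sublattice containing a power of `π₀` of a lattice of height `≤ h` is of height
`≤ h`. -/
theorem LatticeHeightLE.subrepresentation (hu : ι PowerSeries.X ≠ 0) (hτ : LatticeHeightLE ι h τ)
    (T₁ : Submodule (PowerSeries Fq) T) (hT₁ : ∀ g, T₁ ≤ T₁.comap (τ g)) {N : ℕ}
    (hN : ∀ t : T, (PowerSeries.X : PowerSeries Fq) ^ N • t ∈ T₁) :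
    LatticeHeightLE ι h (τ.subrepresentation T₁ hT₁) := by
  rw [latticeHeightLE_iff hu] at hτ ⊢
  exact ⟨hτ.1.subrepresentation T₁ hT₁ hN, hτ.2.subrepresentation T₁ hT₁ hN⟩

variable {T' : Type t} [AddCommGroup T'] [Module (PowerSeries Fq) T']
  {τ' : Representation (PowerSeries Fq) (GK k) T'}

theorem IsLatticeRep.prod (hτ : IsLatticeRep τ) (hτ' : IsLatticeRep τ') :
    IsLatticeRep (τ.prod τ') := by
  have := hτ.free
  have := hτ.finite
  have := hτ'.free
  have := hτ'.finite
  refine ⟨inferInstance, inferInstance, fun n x => ?_⟩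
  convert (hτ.continuous n x.1).inter (hτ'.continuous n x.2) using 1
  ext g
  simp only [Submodule.ideal_span_singleton_smul, Submodule.mem_smul_pointwise_iff_exists,
    Submodule.mem_top, true_and, Set.mem_ofPred_eq, Set.mem_inter_iff]
  constructor
  · rintro ⟨y, hy⟩
    exact ⟨⟨y.1, congrArg Prod.fst hy⟩, ⟨y.2, congrArg Prod.snd hy⟩⟩
  · rintro ⟨⟨y, hy⟩, ⟨y', hy'⟩⟩
    exact ⟨(y, y'), Prod.ext hy hy'⟩

theorem HasShtukaCoordinates.prod (hτ : HasShtukaCoordinates ι h τ)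
    (hτ' : HasShtukaCoordinates ι h τ') : HasShtukaCoordinates ι h (τ.prod τ') := by
  obtain ⟨n, _, _, A, B, Y, e, hAB, hY, hAY, he⟩ := hτ
  obtain ⟨n', _, _, A', B', Y', e', hAB', hY', hAY', he'⟩ := hτ'
  have hcomp : ∀ x : T × T', (coeffUr Fq k ∘ ((e.prodCongr e').trans
      (LinearEquiv.sumArrowLequivProdArrow n n' (PowerSeries Fq) (PowerSeries Fq)).symm) x :
        n ⊕ n' → PowerSeries (Ksep k)) =
      Sum.elim (coeffUr Fq k ∘ e x.1) (coeffUr Fq k ∘ e' x.2) := fun x => by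
    ext1 i
    rcases i with i | i <;> rfl
  refine ⟨n ⊕ n', inferInstance, inferInstance, Matrix.fromBlocks A 0 0 A',
    Matrix.fromBlocks B 0 0 B', Matrix.fromBlocks Y 0 0 Y', (e.prodCongr e').trans
      (LinearEquiv.sumArrowLequivProdArrow n n' (PowerSeries Fq) (PowerSeries Fq)).symm,
    ?_, ?_, ?_, fun g x => ?_⟩
  · rw [Matrix.fromBlocks_multiply, ← Matrix.fromBlocks_one, Matrix.fromBlocks_smul]
    simp [hAB, hAB']
  · rw [Matrix.det_fromBlocks_zero₂₁]
    exact hY.mul hY'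
  · rw [Matrix.fromBlocks_map, Matrix.fromBlocks_map, Matrix.fromBlocks_multiply]
    simp [hAY, hAY']
  · rw [hcomp, hcomp, Matrix.fromBlocks_mulVec, Matrix.fromBlocks_mulVec]
    simp only [Sum.elim_comp_inl, Sum.elim_comp_inr, Matrix.zero_mulVec, add_zero, zero_add]
    have h1 := he g x.1
    have h2 := he' g x.2
    ext1 i
    rcases i with i | i
    · exact congrFun h1 i
    · exact congrFun h2 i

theorem LatticeHeightLE.prod (hu : ι PowerSeries.X ≠ 0) (hτ : LatticeHeightLE ι h τ)
    (hτ' : LatticeHeightLE ι h τ') : LatticeHeightLE ι h (τ.prod τ') := by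
  rw [latticeHeightLE_iff hu] at hτ hτ' ⊢
  exact ⟨hτ.1.prod hτ'.1, hτ.2.prod hτ'.2⟩

end LatticeOperations

/-! ### Torsion representations of height `≤ h` -/

section Torsion

set_option linter.unusedSectionVars false

variable {Fq : Type u} [Field Fq] [Fintype Fq] {k : Type v} [Field k] [Algebra Fq k]
  {ι : PowerSeries Fq →ₐ[Fq] PowerSeries k} {h : ℕ}
  {V : Type w} [AddCommGroup V] [Module (PowerSeries Fq) V]
  {τV : Representation (PowerSeries Fq) (GK k) V}
  {V' : Type t} [AddCommGroup V'] [Module (PowerSeries Fq) V']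
  {τV' : Representation (PowerSeries Fq) (GK k) V'}

/-- A torsion representation is of height `≤ h` as soon as it is a quotient of a lattice of height
`≤ h`, since the kernel is then of height `≤ h`. -/
theorem torsionHeightLE_of_surjective (hu : ι PowerSeries.X ≠ 0) {N : ℕ}
    (hN : ∀ v : V, (PowerSeries.X : PowerSeries Fq) ^ N • v = 0)
    {T : Type u} [AddCommGroup T] [Module (PowerSeries Fq) T]
    {τ : Representation (PowerSeries Fq) (GK k) T} (hτ : LatticeHeightLE ι h τ)
    (f : T →ₗ[PowerSeries Fq] V) (hf : Function.Surjective f)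
    (hfτ : ∀ g x, f (τ g x) = τV g (f x)) : TorsionHeightLE ι h τV := by
  have hker : ∀ g, LinearMap.ker f ≤ (LinearMap.ker f).comap (τ g) := fun g x hx => by
    rw [Submodule.mem_comap, LinearMap.mem_ker, hfτ, LinearMap.mem_ker.1 hx, map_zero]
  refine ⟨T, _, _, τ, LinearMap.ker f, hker, hτ,
    hτ.subrepresentation hu _ _ (N := N) fun t => ?_, ?_⟩
  · rw [LinearMap.mem_ker, map_smul, hN]
  · have h1 : ∀ x, f.quotKerEquivOfSurjective hf ((LinearMap.ker f).mkQ x) = f x := fun x => rfl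
    refine ⟨Representation.Equiv.symm (.mk (f.quotKerEquivOfSurjective hf) fun g => ?_)⟩
    refine Submodule.linearMap_qext _ (LinearMap.ext fun x => ?_)
    exact hfτ g x

theorem TorsionHeightLE.exists_surjective (hV : TorsionHeightLE ι h τV) :
    ∃ (T : Type u) (_ : AddCommGroup T) (_ : Module (PowerSeries Fq) T)
      (τ : Representation (PowerSeries Fq) (GK k) T) (f : T →ₗ[PowerSeries Fq] V),
      LatticeHeightLE ι h τ ∧ Function.Surjective f ∧ ∀ g x, f (τ g x) = τV g (f x) := by
  obtain ⟨T, _, _, τ, T', hT', hτ, -, ⟨e⟩⟩ := hV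
  refine ⟨T, _, _, τ, e.symm.toLinearEquiv.toLinearMap.comp T'.mkQ, hτ,
    e.symm.toLinearEquiv.surjective.comp T'.mkQ_surjective, fun g x => ?_⟩
  exact LinearMap.congr_fun (e.symm.toIntertwiningMap.isIntertwining' g) (T'.mkQ x)

/-- Quotients of torsion representations of height `≤ h` are of height `≤ h`. -/
theorem TorsionHeightLE.of_surjective (hu : ι PowerSeries.X ≠ 0) (hV : TorsionHeightLE ι h τV)
    {N : ℕ} (hN : ∀ v : V', (PowerSeries.X : PowerSeries Fq) ^ N • v = 0)
    (f : V →ₗ[PowerSeries Fq] V') (hf : Function.Surjective f)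
    (hfτ : ∀ g x, f (τV g x) = τV' g (f x)) : TorsionHeightLE ι h τV' := by
  obtain ⟨T, _, _, τ, f', hτ, hf', hfτ'⟩ := hV.exists_surjective
  exact torsionHeightLE_of_surjective hu hN hτ (f.comp f') (hf.comp hf') fun g x => by
    rw [LinearMap.comp_apply, LinearMap.comp_apply, hfτ', hfτ]

/-- Subrepresentations of torsion representations of height `≤ h` are of height `≤ h`: the preimage
of a subrepresentation of `T / T'` is a stable sublattice of `T`. -/
theorem TorsionHeightLE.of_injective (hu : ι PowerSeries.X ≠ 0) (hV : TorsionHeightLE ι h τV)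
    {N : ℕ} (hN : ∀ v : V, (PowerSeries.X : PowerSeries Fq) ^ N • v = 0)
    (f : V' →ₗ[PowerSeries Fq] V) (hf : Function.Injective f)
    (hfτ : ∀ g x, f (τV' g x) = τV g (f x)) : TorsionHeightLE ι h τV' := by
  obtain ⟨T, _, _, τ, f', hτ, hf', hfτ'⟩ := hV.exists_surjective
  let T₁ : Submodule (PowerSeries Fq) T := (LinearMap.range f).comap f'
  have hT₁ : ∀ g, T₁ ≤ T₁.comap (τ g) := by
    rintro g x ⟨y, hy⟩
    exact ⟨τV' g y, by rw [hfτ, hy, hfτ']⟩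
  let F : T₁ →ₗ[PowerSeries Fq] V' := (LinearEquiv.ofInjective f hf).symm.toLinearMap.comp
    ((f'.comp T₁.subtype).codRestrict (LinearMap.range f) fun x => x.2)
  have hF : ∀ x : T₁, f (F x) = f' x := fun x =>
    congrArg Subtype.val ((LinearEquiv.ofInjective f hf).apply_symm_apply ⟨f' x, x.2⟩)
  refine torsionHeightLE_of_surjective hu (N := N) (fun v => hf ?_)
    (hτ.subrepresentation hu T₁ hT₁ (N := N) fun t => ?_) F (fun v => ?_) fun g x => hf ?_
  · rw [map_smul, hN, map_zero]
  · refine ⟨0, ?_⟩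
    rw [map_smul, hN, map_zero]
  · obtain ⟨x, hx⟩ := hf' (f v)
    exact ⟨⟨x, v, hx.symm⟩, hf ((hF _).trans hx)⟩
  · rw [hF, hfτ, hF]
    exact hfτ' g x

theorem TorsionHeightLE.prod (hu : ι PowerSeries.X ≠ 0) (hV : TorsionHeightLE ι h τV)
    (hV' : TorsionHeightLE ι h τV') {N : ℕ}
    (hN : ∀ v : V, (PowerSeries.X : PowerSeries Fq) ^ N • v = 0)
    (hN' : ∀ v : V', (PowerSeries.X : PowerSeries Fq) ^ N • v = 0) :
    TorsionHeightLE ι h (τV.prod τV') := by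
  obtain ⟨T, _, _, τ, f, hτ, hf, hfτ⟩ := hV.exists_surjective
  obtain ⟨T', _, _, τ', f', hτ', hf', hfτ'⟩ := hV'.exists_surjective
  exact torsionHeightLE_of_surjective hu (fun v => Prod.ext (hN v.1) (hN' v.2)) (hτ.prod hu hτ')
    (f.prodMap f') (hf.prodMap hf') fun g x => Prod.ext (hfτ g x.1) (hfτ' g x.2)

/-- The componentwise action on a finite power of a representation. -/
def powRep {R : Type*} [CommRing R] {G : Type*} [Group G] {V : Type*} [AddCommGroup V]
    [Module R V] (m : ℕ) (τ : Representation R G V) : Representation R G (Fin m → V) where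
  toFun g := (τ g).compLeft (Fin m)
  map_one' := by ext; simp
  map_mul' g g' := by ext; simp

theorem TorsionHeightLE.pow (hu : ι PowerSeries.X ≠ 0) (hV : TorsionHeightLE ι h τV)
    {N : ℕ} (hN : ∀ v : V, (PowerSeries.X : PowerSeries Fq) ^ N • v = 0) (m : ℕ) :
    TorsionHeightLE ι h (powRep m τV) := by
  induction m with
  | zero =>
    exact hV.of_surjective hu (N := N) (fun v => Subsingleton.elim _ _) 0
      (fun v => ⟨0, Subsingleton.elim _ _⟩) fun g x => Subsingleton.elim _ _
  | succ m ih =>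
    have hN' : ∀ v : Fin m → V, (PowerSeries.X : PowerSeries Fq) ^ N • v = 0 := fun v =>
      funext fun i => hN (v i)
    let f : (V × (Fin m → V)) →ₗ[PowerSeries Fq] (Fin (m + 1) → V) :=
      { toFun := fun x => Fin.cons x.1 x.2
        map_add' := fun x y => by
          ext i
          refine Fin.cases ?_ (fun i => ?_) i <;> simp
        map_smul' := fun a x => by
          ext i
          refine Fin.cases ?_ (fun i => ?_) i <;> simp }
    refine (hV.prod hu ih hN hN').of_surjective hu (N := N) (fun v => funext fun i => hN (v i)) f
      (fun v => ⟨(v 0, Fin.tail v), Fin.cons_self_tail v⟩) fun g x => ?_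
    ext i
    refine Fin.cases ?_ (fun i => ?_) i <;> rfl

/-- An embedding of `V` into the fixed vectors of a Frobenius structure `A` on `(K^sep)^s`,
equivariant up to the twist by the reduction of `χ_LT^h`. -/
def EmbedsInFixed (ι : PowerSeries Fq →ₐ[Fq] PowerSeries k) (h : ℕ)
    (τV : Representation (PowerSeries Fq) (GK k) V) {s : ℕ}
    (A : Matrix (Fin s) (Fin s) (PowerSeries k)) (j : V → (Fin s → Ksep k)) : Prop :=
  Function.Injective j ∧ (∀ x, (A.map (emb k)).mulVec (frob Fq (Ksep k) ∘ j x) = j x) ∧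
    ∀ g x i, j (τV g x) i =
      algebraMap Fq (Ksep k) (PowerSeries.constantCoeff (chiLT ι g ^ h)) * g (j x i)

/-- A finite representation of height `≤ h` killed by `π₀` embeds into the fixed vectors of a
Frobenius structure over `k⟦u⟧` of rank bounded by its cardinality, dividing `(-u₀)^h`. -/
theorem TorsionHeightLE.exists_embedsInFixed (hu : ι PowerSeries.X ≠ 0)
    (hV : TorsionHeightLE ι h τV) [Finite V]
    (hX : ∀ v : V, (PowerSeries.X : PowerSeries Fq) • v = 0) :
    ∃ (s : ℕ) (A B : Matrix (Fin s) (Fin s) (PowerSeries k)) (j : V → (Fin s → Ksep k)),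
      s ≤ Nat.card V ∧
      A * B = (-ι PowerSeries.X) ^ h • (1 : Matrix (Fin s) (Fin s) (PowerSeries k)) ∧
      EmbedsInFixed ι h τV A j := by
  obtain ⟨T, _, _, τ, f, hτ, hf, hfτ⟩ := hV.exists_surjective
  obtain ⟨-, n, _, _, A, B, Y, e, hAB, hY, hAY, he⟩ := (latticeHeightLE_iff hu).1 hτ
  obtain ⟨C, hC⟩ : ∃ C : Submodule (PowerSeries Fq) (n → PowerSeries Fq), ∀ t, e t ∈ C ↔ f t = 0 :=
    ⟨LinearMap.ker (f.comp e.symm.toLinearMap), fun t => by simp⟩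
  have hCX : ∀ c : n → PowerSeries Fq, (PowerSeries.X : PowerSeries Fq) • c ∈ C := fun c => by
    obtain ⟨t, rfl⟩ := e.surjective c
    rw [← map_smul, hC, map_smul, hX]
  have hgal : ∀ g : GK k, ∀ x ∈ spanLattice Y C,
      PowerSeries.map (g : Ksep k →+* Ksep k) ∘ x ∈ spanLattice Y C := fun g x =>
    galois_mem_spanLattice (fun c hc => by
      obtain ⟨t, rfl⟩ := e.surjective c
      have h1 : PowerSeries.map (g : Ksep k →+* Ksep k) ∘ Y.mulVec (coeffUr Fq k ∘ e t) =
          coeffUr Fq k (chiLT ι g⁻¹ ^ h) • Y.mulVec (coeffUr Fq k ∘ e (τ g t)) := by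
        rw [he, smul_smul, ← map_mul, chiLT_inv_mul, map_one, one_smul]
      rw [h1]
      refine Submodule.smul_mem _ _ (mulVec_mem_spanLattice ((hC _).2 ?_))
      rw [hfτ, (hC _).1 hc, map_zero]) x
  have hspan := le_span_integralVectors (spanLattice Y C) hgal
    (X_pow_smul_mem_spanLattice (N := 1) hY (by simpa using hCX))
  obtain ⟨s, A', B', E, hAB', hfix, hker, htop⟩ :=
    exists_quotient_matrices emb_injective hAB hY hAY hCX hspan
  obtain ⟨J, hJ⟩ : ∃ J : (n → PowerSeries Fq) → (Fin s → Ksep k), ∀ c, J c =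
      (E.map (emb k)).mulVec (PowerSeries.constantCoeff ∘ Y.mulVec (coeffUr Fq k ∘ c)) :=
    ⟨_, fun _ => rfl⟩
  have hfixJ : ∀ c, (A'.map (emb k)).mulVec (frob Fq (Ksep k) ∘ J c) = J c := fun c => by
    rw [hJ]
    exact hfix c
  have hkerJ : ∀ c, J c = 0 ↔ c ∈ C := fun c => by
    rw [hJ]
    exact hker c
  have htopJ : ⊤ ≤ Submodule.span (Ksep k) (Set.range J) := by
    rw [show J = _ from funext hJ]
    exact htop
  have hJsub : ∀ c c', J (c - c') = J c - J c' := fun c c' => by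
    rw [hJ, hJ, hJ, ← Matrix.mulVec_sub]
    congr 1
    have h1 : (coeffUr Fq k ∘ (c - c') : n → PowerSeries (Ksep k)) =
        coeffUr Fq k ∘ c - coeffUr Fq k ∘ c' := by ext1 i; simp
    rw [h1, Matrix.mulVec_sub]
    ext1 i
    simp
  have hJeq : ∀ t t', J (e t) = J (e t') ↔ f t = f t' := fun t t' => by
    rw [← sub_eq_zero, ← hJsub, hkerJ, ← map_sub, hC, map_sub, sub_eq_zero]
  have hJgal : ∀ g t i, J (e (τ g t)) i =
      algebraMap Fq (Ksep k) (PowerSeries.constantCoeff (chiLT ι g ^ h)) * g (J (e t) i) := by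
    intro g t i
    have h1 : PowerSeries.constantCoeff ∘ Y.mulVec (coeffUr Fq k ∘ e (τ g t)) =
        fun i => algebraMap Fq (Ksep k) (PowerSeries.constantCoeff (chiLT ι g ^ h)) *
          g (PowerSeries.constantCoeff (Y.mulVec (coeffUr Fq k ∘ e t) i)) := by
      rw [he]
      ext1 i
      rw [Function.comp_apply, Pi.smul_apply, smul_eq_mul, map_mul, constantCoeff_map,
        Function.comp_apply, constantCoeff_map]
      rfl
    rw [hJ, hJ, h1]
    simp only [Matrix.mulVec, dotProduct, map_sum, Finset.mul_sum, map_mul, Matrix.map_apply,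
      galois_emb, Function.comp_apply]
    exact Finset.sum_congr rfl fun _ _ => Finset.sum_congr rfl fun _ _ => mul_left_comm _ _ _
  choose r hr using hf
  have hj : ∀ t, J (e (r (f t))) = J (e t) := fun t => (hJeq _ _).2 (hr _)
  refine ⟨s, A', B', fun v => J (e (r v)), ?_, ?_, fun v v' hvv => ?_, fun v => hfixJ _,
    fun g v i => ?_⟩
  · have := Fintype.ofFinite V
    have h1 : Set.range J ⊆ Set.range fun v => J (e (r v)) := by
      rintro _ ⟨c, rfl⟩
      obtain ⟨t, rfl⟩ := e.surjective c
      exact ⟨f t, hj t⟩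
    have h2 := finrank_range_le_card (R := Ksep k) fun v => J (e (r v))
    rw [Set.finrank, top_le_iff.1 (htopJ.trans (Submodule.span_mono h1)), finrank_top,
      Module.finrank_fin_fun] at h2
    rwa [Nat.card_eq_fintype_card]
  · rw [hAB', map_pow, constantCoeff_piSub]
  · rw [← hr v, ← hr v', ← hJeq]
    exact hvv
  · dsimp only
    rw [← hJgal, ← hj (τ g (r v)), hfτ, hr]

/-- Transport of an embedding along an isogeny of Frobenius structures. -/
theorem EmbedsInFixed.mulVec {s : ℕ} {A A' Z : Matrix (Fin s) (Fin s) (PowerSeries k)}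
    {j : V → (Fin s → Ksep k)} (hj : EmbedsInFixed ι h τV A j) (hZ : Z.det ≠ 0)
    (hZA : Z * A = A' * Z.map (frob Fq (PowerSeries k))) :
    EmbedsInFixed ι h τV A' fun v => (Z.map (emb k)).mulVec (j v) := by
  have hZ' : IsUnit (Z.map (emb k)).det := by
    rw [← RingHom.mapMatrix_apply, ← RingHom.map_det, isUnit_iff_ne_zero]
    exact fun h0 => hZ (emb_injective (h0.trans (map_zero _).symm))
  refine ⟨fun v v' hvv => hj.1 (Matrix.mulVec_injective_of_isUnit
    ((Matrix.isUnit_iff_isUnit_det _).2 hZ') hvv), fun v => ?_, fun g v i => ?_⟩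
  · have h1 : (Z.map (emb k)).map (frob Fq (Ksep k)) = (Z.map (frob Fq (PowerSeries k))).map (emb k) := by
      ext1 i j
      exact (e_frob (emb k) _).symm
    dsimp only
    rw [map_comp_mulVec, Matrix.mulVec_mulVec, h1, ← Matrix.map_mul, ← hZA, Matrix.map_mul,
      ← Matrix.mulVec_mulVec, hj.2.1]
  · simp only [Matrix.mulVec, dotProduct, map_sum, Finset.mul_sum, map_mul, Matrix.map_apply,
      galois_emb, hj.2.2]
    exact Finset.sum_congr rfl fun _ _ => mul_left_comm _ _ _

/-- A representation embedded in the finite set of solutions of `A σ(x) = x` is determined by the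
embedding. -/
theorem finite_embedsInFixed [Finite V] {s : ℕ} {A : Matrix (Fin s) (Fin s) (PowerSeries k)}
    (hA : IsUnit (A.map (emb k)).det) :
    {τV : Representation (PowerSeries Fq) (GK k) V | ∃ j, EmbedsInFixed ι h τV A j}.Finite := by
  set S := {x : Fin s → Ksep k | (A.map (emb k)).mulVec (frob Fq (Ksep k) ∘ x) = x} with hS
  have hfin : Finite S := finite_fixed hA
  refine (Set.finite_iUnion fun j : V → S => Set.Subsingleton.finite
    (s := {τV : Representation (PowerSeries Fq) (GK k) V |
      EmbedsInFixed ι h τV A fun v => (j v : Fin s → Ksep k)}) ?_).subset ?_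
  · intro τ₁ h₁ τ₂ h₂
    ext g x
    refine h₁.1 (funext fun i => ?_)
    exact (h₁.2.2 g x i).trans (h₂.2.2 g x i).symm
  · rintro τV ⟨j, hj⟩
    exact Set.mem_iUnion.2 ⟨fun v => ⟨j v, hj.2.1 v⟩, hj⟩

/-- There are only finitely many representations of height `≤ h` on a given finite `Fq`-vector
space: the Frobenius structures of bounded rank dividing `(-u₀)^h` fall into finitely many isomorphism
classes, each having finitely many fixed vectors. -/
theorem finite_torsionHeightLE [Finite k] (hu : ι PowerSeries.X ≠ 0) [Finite V]
    (hX : ∀ v : V, (PowerSeries.X : PowerSeries Fq) • v = 0) :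
    {τV : Representation (PowerSeries Fq) (GK k) V | TorsionHeightLE ι h τV}.Finite := by
  have hp : (-ι PowerSeries.X) ^ h ≠ 0 := pow_ne_zero _ (neg_ne_zero.2 hu)
  obtain ⟨M₀, hM₀⟩ := exists_isom_of_congr (Fq := Fq) hp
  let Q : (s : ℕ) → (Fin s → Fin s → Fin M₀ → k) → Matrix (Fin s) (Fin s) (PowerSeries k) → Prop :=
    fun s κ A => (∀ i j (l : Fin M₀), PowerSeries.coeff l (A i j) = κ i j l) ∧
      ∃ B, A * B = (-ι PowerSeries.X) ^ h • (1 : Matrix (Fin s) (Fin s) (PowerSeries k))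
  refine (Set.finite_iUnion fun s : Fin (Nat.card V + 1) => Set.finite_iUnion
    fun κ : Fin s → Fin s → Fin M₀ → k =>
      show {τV : Representation (PowerSeries Fq) (GK k) V |
        ∃ A j, Q s κ A ∧ EmbedsInFixed ι h τV A j}.Finite from ?_).subset ?_
  · by_cases hκ : ∃ A, Q s κ A
    · obtain ⟨A₀, hA₀, B₀, hAB₀⟩ := hκ
      have hdet : IsUnit (A₀.map (emb k)).det := by
        rw [← RingHom.mapMatrix_apply, ← RingHom.map_det, isUnit_iff_ne_zero]
        intro h0
        have h1 : A₀.det = 0 := emb_injective (h0.trans (map_zero _).symm)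
        have h2 := congrArg Matrix.det hAB₀
        rw [Matrix.det_mul, h1, zero_mul, Matrix.det_smul, Matrix.det_one, mul_one] at h2
        exact pow_ne_zero _ hp h2.symm
      refine (finite_embedsInFixed (ι := ι) (h := h) (V := V) hdet).subset ?_
      rintro τV ⟨A, j, ⟨hA, B, hAB⟩, hj⟩
      obtain ⟨Z, hZ, hZA⟩ := hM₀ _ A A₀ B hAB fun i j => PowerSeries.X_pow_dvd_iff.2 fun l hl => by
        rw [map_sub, sub_eq_zero]
        exact (hA₀ i j ⟨l, hl⟩).trans (hA i j ⟨l, hl⟩).symm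
      exact ⟨_, hj.mulVec hZ hZA⟩
    · convert Set.finite_empty
      refine Set.eq_empty_of_forall_notMem ?_
      rintro τV ⟨A, j, hA, -⟩
      exact hκ ⟨A, hA⟩
  · intro τV hV
    obtain ⟨s, A, B, j, hs, hAB, hj⟩ := hV.exists_embedsInFixed hu hX
    exact Set.mem_iUnion.2 ⟨⟨s, by omega⟩, Set.mem_iUnion.2
      ⟨fun i j l => PowerSeries.coeff l (A i j), A, j, ⟨fun _ _ _ => rfl, B, hAB⟩, hj⟩⟩

end Torsion

/-! ### Deformation conditions -/

section Condition

/-- Base change of a matrix representation along a ring homomorphism. -/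
def mapRep {G : Type v} [Group G] {d : ℕ} {A : Type w} {B : Type t} [CommRing A] [CommRing B]
    (f : A →+* B) (ρ : G →* Matrix (Fin d) (Fin d) A) : G →* Matrix (Fin d) (Fin d) B :=
  (f.mapMatrix : Matrix (Fin d) (Fin d) A →+* Matrix (Fin d) (Fin d) B).toMonoidHom.comp ρ

theorem mapRep_apply {G : Type v} [Group G] {d : ℕ} {A : Type w} {B : Type t} [CommRing A]
    [CommRing B] (f : A →+* B) (ρ : G →* Matrix (Fin d) (Fin d) A) (g : G) (i j : Fin d) :
    mapRep f ρ g i j = f (ρ g i j) := rfl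

/-- A condition on matrix representations over finite `𝔬`-algebras which is stable under base change,
descends along jointly injective pairs of homomorphisms, is invariant under conjugation, implies
continuity, and is satisfied by only finitely many representations over the dual numbers. These are
the properties of the condition "of height `≤ h`" on which the deformation theory rests. -/
structure DeformationCondition (𝔬 : Type w) [CommRing 𝔬] [IsLocalRing 𝔬] (G : Type v) [Group G]
    [TopologicalSpace G] (d : ℕ) where
  Holds : ∀ {A : Type w} [CommRing A] [Algebra 𝔬 A], (G →* Matrix (Fin d) (Fin d) A) → Prop
  map : ∀ {A B : Type w} [CommRing A] [Algebra 𝔬 A] [CommRing B] [Algebra 𝔬 B] [Finite A] [Finite B]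
    (f : A →ₐ[𝔬] B) {ρ : G →* Matrix (Fin d) (Fin d) A}, Holds ρ → Holds (mapRep (f : A →+* B) ρ)
  of_injective : ∀ {A B C : Type w} [CommRing A] [Algebra 𝔬 A] [CommRing B] [Algebra 𝔬 B]
    [CommRing C] [Algebra 𝔬 C] [Finite B] [Finite C] (f : A →ₐ[𝔬] B) (f' : A →ₐ[𝔬] C)
    {ρ : G →* Matrix (Fin d) (Fin d) A}, (∀ x y, f x = f y → f' x = f' y → x = y) →
    Holds (mapRep (f : A →+* B) ρ) → Holds (mapRep (f' : A →+* C) ρ) → Holds ρ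
  conj : ∀ {A : Type w} [CommRing A] [Algebra 𝔬 A] [Finite A]
    {ρ ρ' : G →* Matrix (Fin d) (Fin d) A} (U : (Matrix (Fin d) (Fin d) A)ˣ),
    (∀ g, U * ρ g = ρ' g * U) → Holds ρ → Holds ρ'
  isOpen : ∀ {A : Type w} [CommRing A] [Algebra 𝔬 A] [Finite A] {ρ : G →* Matrix (Fin d) (Fin d) A},
    Holds ρ → IsOpen {g | ρ g = 1}
  finite : {ρ : G →* Matrix (Fin d) (Fin d) (DualNumber (ResidueField 𝔬)) | Holds ρ}.Finite

end Condition

section Height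

set_option linter.unusedSectionVars false

variable {Fq : Type u} [Field Fq] [Fintype Fq] {k : Type v} [Field k] [Algebra Fq k]
  {ι : PowerSeries Fq →ₐ[Fq] PowerSeries k} {h : ℕ} {d : ℕ}
  {𝔬 : Type w} [CommRing 𝔬] [IsLocalRing 𝔬] [Algebra (PowerSeries Fq) 𝔬]

/-- A representation on a finite `π₀^∞`-torsion module of height `≤ h` is continuous. -/
theorem TorsionHeightLE.isOpen_stabilizer {V : Type w} [AddCommGroup V] [Module (PowerSeries Fq) V]
    {τV : Representation (PowerSeries Fq) (GK k) V} (hV : TorsionHeightLE ι h τV) {N : ℕ}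
    (hN : ∀ v : V, (PowerSeries.X : PowerSeries Fq) ^ N • v = 0) (x : V) :
    IsOpen {g : GK k | τV g x = x} := by
  obtain ⟨T, _, _, τ, f, hτ, hf, hfτ⟩ := hV.exists_surjective
  obtain ⟨t, rfl⟩ := hf x
  convert hτ.1.isOpen_sub_mem (LinearMap.ker f) (fun g x hx => ?_) (m := N) (fun t => ?_) t using 3 with g
  · rw [LinearMap.mem_ker, map_sub, sub_eq_zero, hfτ]
  · rw [Submodule.mem_comap, LinearMap.mem_ker, hfτ, LinearMap.mem_ker.1 hx, map_zero]
  · rw [LinearMap.mem_ker, map_smul, hN]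

/-- The variable is nilpotent on finite modules, being topologically nilpotent in `𝔬`. -/
theorem exists_X_pow_smul_eq_zero [IsLocalHom (algebraMap (PowerSeries Fq) 𝔬)] (B : Type w)
    [CommRing B] [Algebra 𝔬 B] [Finite B] :
    ∃ N : ℕ, algebraMap 𝔬 B (algebraMap (PowerSeries Fq) 𝔬 (PowerSeries.X ^ N)) = 0 := by
  obtain ⟨m, n, hne, hmn⟩ := Finite.exists_ne_map_eq_of_infinite fun n : ℕ =>
    algebraMap 𝔬 B (algebraMap (PowerSeries Fq) 𝔬 (PowerSeries.X ^ n))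
  wlog hlt : m < n generalizing m n
  · exact this n m hne.symm hmn.symm (lt_of_le_of_ne (not_lt.1 hlt) hne.symm)
  refine ⟨m, ?_⟩
  set x := algebraMap (PowerSeries Fq) 𝔬 PowerSeries.X
  have hx : x ∈ maximalIdeal 𝔬 := fun h =>
    PowerSeries.X_prime.not_isUnit ((isUnit_map_iff (algebraMap (PowerSeries Fq) 𝔬) _).1 h)
  have h1 : IsUnit (1 - x ^ (n - m)) := isUnit_one_sub_self_of_mem_nonunits _
    (Ideal.pow_mem_of_mem _ hx _ (by omega))
  obtain ⟨y, hy⟩ := h1.map (algebraMap 𝔬 B)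
  rw [map_pow] at hmn ⊢
  rw [map_pow (algebraMap (PowerSeries Fq) 𝔬)] at hmn
  rw [← Units.mul_left_eq_zero y, hy, ← map_mul, mul_sub, mul_one, ← pow_add,
    Nat.add_sub_cancel' hlt.le, map_sub, hmn, map_pow, sub_self]

/-- The property of a matrix representation to be of height `≤ h`. -/
def MatRepHeightLE (ι : PowerSeries Fq →ₐ[Fq] PowerSeries k) (h : ℕ) (𝔬 : Type w) [CommRing 𝔬]
    [Algebra (PowerSeries Fq) 𝔬] {B : Type w} [CommRing B] [Algebra 𝔬 B]
    (ρ : GK k →* Matrix (Fin d) (Fin d) B) : Prop :=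
  RepHeightLE ι h 𝔬 ρ.toHomUnits

section Closure

variable [IsLocalHom (algebraMap (PowerSeries Fq) 𝔬)] {A B C : Type w} [CommRing A] [Algebra 𝔬 A]
  [CommRing B] [Algebra 𝔬 B] [CommRing C] [Algebra 𝔬 C]

/-- Base change along `f : A → B` preserves the height, because `B^d` is a quotient of a power of
`A^d`. -/
theorem MatRepHeightLE.map [Finite A] [Finite B] (hu : ι PowerSeries.X ≠ 0) (f : A →ₐ[𝔬] B)
    {ρ : GK k →* Matrix (Fin d) (Fin d) A} (hρ : MatRepHeightLE ι h 𝔬 ρ) :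
    MatRepHeightLE ι h 𝔬 (mapRep (f : A →+* B) ρ) := by
  classical
  let : Algebra (PowerSeries Fq) A := Algebra.compHom A (algebraMap (PowerSeries Fq) 𝔬)
  let : Algebra (PowerSeries Fq) B := Algebra.compHom B (algebraMap (PowerSeries Fq) 𝔬)
  obtain ⟨N, hN⟩ := exists_X_pow_smul_eq_zero (Fq := Fq) (𝔬 := 𝔬) A
  obtain ⟨N', hN'⟩ := exists_X_pow_smul_eq_zero (Fq := Fq) (𝔬 := 𝔬) B
  have hNA : ∀ v : Fin d → A, (PowerSeries.X : PowerSeries Fq) ^ N • v = 0 := fun v => funext fun i =>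
    (Algebra.smul_def _ _).trans ((congrArg (· * v i) hN).trans (zero_mul _))
  have hNB : ∀ v : Fin d → B, (PowerSeries.X : PowerSeries Fq) ^ N' • v = 0 := fun v => funext fun i =>
    (Algebra.smul_def _ _).trans ((congrArg (· * v i) hN').trans (zero_mul _))
  -- `B^d` is a quotient of a power of `A^d`
  let b := (Finite.equivFin B).symm
  let F : (Fin (Nat.card B) → Fin d → A) →ₗ[PowerSeries Fq] (Fin d → B) :=
    { toFun := fun v c => ∑ i, b i * f (v i c)
      map_add' := fun v v' => by
        ext c
        simp [mul_add, Finset.sum_add_distrib]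
      map_smul' := fun a v => by
        ext c
        have h1 : ∀ x : A, f (a • x) = a • f x := fun x => map_smul f (algebraMap (PowerSeries Fq) 𝔬 a) x
        simp [h1, Finset.smul_sum] }
  refine (TorsionHeightLE.pow hu hρ hNA (Nat.card B)).of_surjective hu hNB F (fun y => ?_)
    fun g v => ?_
  · refine ⟨fun i c => if b i = y c then 1 else 0, funext fun c => ?_⟩
    change ∑ i, b i * f (if b i = y c then 1 else 0) = y c
    rw [Finset.sum_eq_single (b.symm (y c))]
    · rw [Equiv.apply_symm_apply, if_pos rfl, map_one, mul_one]
    · intro i _ hi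
      rw [if_neg fun h => hi (by rw [← h, Equiv.symm_apply_apply]), map_zero, mul_zero]
    · exact fun h => absurd (Finset.mem_univ _) h
  · ext c
    change ∑ i, b i * f ((ρ g).mulVec (v i) c) =
      (f.toRingHom.mapMatrix (ρ g)).mulVec (fun c => ∑ i, b i * f (v i c)) c
    simp only [Matrix.mulVec, dotProduct, map_sum, map_mul, Finset.mul_sum]
    rw [Finset.sum_comm]
    exact Finset.sum_congr rfl fun i _ => Finset.sum_congr rfl fun j _ => mul_left_comm _ _ _

/-- If `A` embeds in `B × C`, then `A^d` is a subrepresentation of `B^d × C^d`. -/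
theorem MatRepHeightLE.of_injective [Finite B] [Finite C] (hu : ι PowerSeries.X ≠ 0) (f : A →ₐ[𝔬] B)
    (f' : A →ₐ[𝔬] C) {ρ : GK k →* Matrix (Fin d) (Fin d) A}
    (hf : ∀ x y, f x = f y → f' x = f' y → x = y)
    (hρ : MatRepHeightLE ι h 𝔬 (mapRep (f : A →+* B) ρ))
    (hρ' : MatRepHeightLE ι h 𝔬 (mapRep (f' : A →+* C) ρ)) : MatRepHeightLE ι h 𝔬 ρ := by
  let : Algebra (PowerSeries Fq) A := Algebra.compHom A (algebraMap (PowerSeries Fq) 𝔬)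
  let : Algebra (PowerSeries Fq) B := Algebra.compHom B (algebraMap (PowerSeries Fq) 𝔬)
  let : Algebra (PowerSeries Fq) C := Algebra.compHom C (algebraMap (PowerSeries Fq) 𝔬)
  obtain ⟨N, hN⟩ := exists_X_pow_smul_eq_zero (Fq := Fq) (𝔬 := 𝔬) (B × C)
  have hNB : ∀ v : Fin d → B, (PowerSeries.X : PowerSeries Fq) ^ N • v = 0 := fun v => funext fun i =>
    (Algebra.smul_def _ _).trans ((congrArg (· * v i) (congrArg Prod.fst hN)).trans (zero_mul _))
  have hNC : ∀ v : Fin d → C, (PowerSeries.X : PowerSeries Fq) ^ N • v = 0 := fun v => funext fun i =>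
    (Algebra.smul_def _ _).trans ((congrArg (· * v i) (congrArg Prod.snd hN)).trans (zero_mul _))
  let F : (Fin d → A) →ₗ[PowerSeries Fq] (Fin d → B) × (Fin d → C) :=
    { toFun := fun v => (f ∘ v, f' ∘ v)
      map_add' := fun v v' => by ext <;> simp
      map_smul' := fun a v => by
        have h1 : ∀ x : A, f (a • x) = a • f x := fun x => map_smul f (algebraMap (PowerSeries Fq) 𝔬 a) x
        have h2 : ∀ x : A, f' (a • x) = a • f' x := fun x => map_smul f' (algebraMap (PowerSeries Fq) 𝔬 a) x
        ext <;> simp [h1, h2] }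
  refine (TorsionHeightLE.prod hu hρ hρ' hNB hNC).of_injective hu (N := N)
    (fun v => Prod.ext (hNB v.1) (hNC v.2)) F (fun v v' hvv => ?_) fun g v => ?_
  · exact funext fun i => hf _ _ (congrFun (congrArg Prod.fst hvv) i)
      (congrFun (congrArg Prod.snd hvv) i)
  · exact Prod.ext (map_comp_mulVec (f : A →+* B) (ρ g) v) (map_comp_mulVec (f' : A →+* C) (ρ g) v)

theorem MatRepHeightLE.conj [Finite A] (hu : ι PowerSeries.X ≠ 0)
    {ρ ρ' : GK k →* Matrix (Fin d) (Fin d) A} (U : (Matrix (Fin d) (Fin d) A)ˣ)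
    (hU : ∀ g, U * ρ g = ρ' g * U) (hρ : MatRepHeightLE ι h 𝔬 ρ) : MatRepHeightLE ι h 𝔬 ρ' := by
  let : Algebra (PowerSeries Fq) A := Algebra.compHom A (algebraMap (PowerSeries Fq) 𝔬)
  obtain ⟨N, hN⟩ := exists_X_pow_smul_eq_zero (Fq := Fq) (𝔬 := 𝔬) A
  have hNA : ∀ v : Fin d → A, (PowerSeries.X : PowerSeries Fq) ^ N • v = 0 := fun v => funext fun i =>
    (Algebra.smul_def _ _).trans ((congrArg (· * v i) hN).trans (zero_mul _))
  refine TorsionHeightLE.of_surjective hu hρ hNA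
    ((Matrix.toLin' (U : Matrix (Fin d) (Fin d) A)).restrictScalars (PowerSeries Fq)) (fun y => ?_)
    fun g v => ?_
  · refine ⟨(↑U⁻¹ : Matrix (Fin d) (Fin d) A).mulVec y, ?_⟩
    change (U : Matrix (Fin d) (Fin d) A).mulVec _ = y
    rw [Matrix.mulVec_mulVec, Units.mul_inv, Matrix.one_mulVec]
  · change (U : Matrix (Fin d) (Fin d) A).mulVec ((ρ g).mulVec v) =
      (ρ' g).mulVec ((U : Matrix (Fin d) (Fin d) A).mulVec v)
    rw [Matrix.mulVec_mulVec, Matrix.mulVec_mulVec, hU]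

theorem MatRepHeightLE.isOpen [Finite A] {ρ : GK k →* Matrix (Fin d) (Fin d) A}
    (hρ : MatRepHeightLE ι h 𝔬 ρ) : IsOpen {g | ρ g = 1} := by
  let : Algebra (PowerSeries Fq) A := Algebra.compHom A (algebraMap (PowerSeries Fq) 𝔬)
  obtain ⟨N, hN⟩ := exists_X_pow_smul_eq_zero (Fq := Fq) (𝔬 := 𝔬) A
  have hNA : ∀ v : Fin d → A, (PowerSeries.X : PowerSeries Fq) ^ N • v = 0 := fun v => funext fun i =>
    (Algebra.smul_def _ _).trans ((congrArg (· * v i) hN).trans (zero_mul _))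
  have h1 := isOpen_iInter_of_finite fun v : Fin d → A => hρ.isOpen_stabilizer hNA v
  convert h1 using 1
  ext g
  rw [Set.mem_ofPred_eq, Set.mem_iInter]
  constructor
  · intro hg v
    change (ρ g).mulVec v = v
    rw [hg, Matrix.one_mulVec]
  · intro hg
    refine Matrix.toLin'.injective (LinearMap.ext fun v => ?_)
    rw [Matrix.toLin'_one]
    exact hg v

theorem finite_matRepHeightLE [Finite k] (hu : ι PowerSeries.X ≠ 0) [Finite A]
    (hX : algebraMap 𝔬 A (algebraMap (PowerSeries Fq) 𝔬 PowerSeries.X) = 0) :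
    {ρ : GK k →* Matrix (Fin d) (Fin d) A | MatRepHeightLE ι h 𝔬 ρ}.Finite := by
  let : Algebra (PowerSeries Fq) A := Algebra.compHom A (algebraMap (PowerSeries Fq) 𝔬)
  have hXA : ∀ v : Fin d → A, (PowerSeries.X : PowerSeries Fq) • v = 0 := fun v => funext fun i =>
    (Algebra.smul_def _ _).trans ((congrArg (· * v i) hX).trans (zero_mul _))
  refine Set.Finite.of_finite_image ((finite_torsionHeightLE (ι := ι) (h := h) hu hXA).subset ?_)
    (f := fun ρ => modRep (PowerSeries Fq) ρ.toHomUnits) ?_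
  · rintro _ ⟨ρ, hρ, rfl⟩
    exact hρ
  · intro ρ _ ρ' _ hρρ
    refine MonoidHom.ext fun g => Matrix.toLin'.injective (LinearMap.ext fun v => ?_)
    exact LinearMap.congr_fun (DFunLike.congr_fun hρρ g) v

end Closure

/-- The condition to be of height `≤ h`. -/
noncomputable def heightCondition [Finite k] [IsLocalHom (algebraMap (PowerSeries Fq) 𝔬)]
    [Finite (ResidueField 𝔬)] (hu : ι PowerSeries.X ≠ 0) (h d : ℕ) :
    DeformationCondition 𝔬 (GK k) d where
  Holds ρ := MatRepHeightLE ι h 𝔬 ρ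
  map f _ hρ := hρ.map hu f
  of_injective f f' _ hf hρ hρ' := MatRepHeightLE.of_injective hu f f' hf hρ hρ'
  conj U hU hρ := hρ.conj hu U hU
  isOpen hρ := hρ.isOpen
  finite := by
    have : Finite (DualNumber (ResidueField 𝔬)) :=
      inferInstanceAs (Finite (ResidueField 𝔬 × ResidueField 𝔬))
    refine finite_matRepHeightLE hu ?_
    have hx : residue 𝔬 (algebraMap (PowerSeries Fq) 𝔬 PowerSeries.X) = 0 :=
      (residue_eq_zero_iff _).2 fun h =>
        PowerSeries.X_prime.not_isUnit ((isUnit_map_iff (algebraMap (PowerSeries Fq) 𝔬) _).1 h)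
    exact (congrArg (TrivSqZeroExt.inl (M := ResidueField 𝔬)) hx).trans (TrivSqZeroExt.inl_zero _)

end Height

/-! ### Representations are determined by finitely many group elements -/

section Generation

/-- A representation whose entries lie in a subring is defined over the subring. -/
theorem exists_mapRep_eq {G : Type v} [Group G] {d : ℕ} {A : Type w} {B : Type t} [CommRing A]
    [CommRing B] (f : A →+* B) (hf : Function.Injective f) (ρ : G →* Matrix (Fin d) (Fin d) B)
    (h : ∀ g i j, ∃ a, f a = ρ g i j) : ∃ ρ' : G →* Matrix (Fin d) (Fin d) A, mapRep f ρ' = ρ := by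
  choose c hc using h
  have hinj : Function.Injective (f.mapMatrix : Matrix (Fin d) (Fin d) A →+* _) := fun M N hMN =>
    Matrix.ext fun i j => hf (congrFun (congrFun hMN i) j)
  have hr : ∀ g, f.mapMatrix (Matrix.of (c g)) = ρ g := fun g => Matrix.ext fun i j => hc g i j
  exact ⟨{ toFun := fun g => Matrix.of (c g)
           map_one' := hinj (by rw [hr, map_one, map_one])
           map_mul' := fun g g' => hinj (by rw [map_mul, hr, hr, hr, map_mul]) }, MonoidHom.ext hr⟩

variable {𝔬 : Type w} [CommRing 𝔬] [IsLocalRing 𝔬] {G : Type v} [Group G] [TopologicalSpace G]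
  {d : ℕ} (P : DeformationCondition 𝔬 G d)

/-- A family `γ` of group elements separates the representations over the dual numbers that satisfy
the condition `P`. -/
def DeformationCondition.Separates {σ : Type t} (γ : σ → G) : Prop :=
  ∀ ρ ρ' : G →* Matrix (Fin d) (Fin d) (DualNumber (ResidueField 𝔬)), P.Holds ρ → P.Holds ρ' →
    (∀ l, ρ (γ l) = ρ' (γ l)) → ρ = ρ'

/-- Any two of the finitely many representations over the dual numbers differ at some group element.
-/
theorem DeformationCondition.exists_separates : ∃ (s : ℕ) (γ : Fin s → G), P.Separates γ := by
  classical
  have := P.finite.to_subtype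
  let Q := {ρ : G →* Matrix (Fin d) (Fin d) (DualNumber (ResidueField 𝔬)) | P.Holds ρ}
  have h1 : ∀ p : Q × Q, ∃ g, p.1.1 g = p.2.1 g → p.1 = p.2 := by
    intro p
    by_contra! h
    exact (h 1).2 (Subtype.ext (MonoidHom.ext fun g => (h g).1))
  choose c hc using h1
  refine ⟨Nat.card (Q × Q), fun l => c ((Finite.equivFin (Q × Q)).symm l), fun ρ ρ' hρ hρ' h => ?_⟩
  have h2 := h (Finite.equivFin (Q × Q) (⟨ρ, hρ⟩, ⟨ρ', hρ'⟩))
  simp only [Equiv.symm_apply_apply] at h2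
  exact congrArg Subtype.val (hc (⟨ρ, hρ⟩, ⟨ρ', hρ'⟩) h2)

variable {P}

/-- A subalgebra which together with `N²` spans the whole algebra is the whole algebra, for a
nilpotent ideal `N` with residue field generated by the scalars. -/
theorem subalgebra_eq_top_of_sup_sq {R : Type v} {A : Type w} [CommRing R] [CommRing A]
    [Algebra R A] (N : Ideal A)
    (hN : IsNilpotent N) (hc : ∀ a : A, ∃ c : R, a - algebraMap R A c ∈ N) (S : Subalgebra R A)
    (h : ∀ a ∈ N, ∃ s ∈ S, a - s ∈ N ^ 2) : S = ⊤ := by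
  have h1 : ∀ k, ∀ a ∈ N, ∃ s ∈ S, a - s ∈ N ^ (k + 1) := by
    intro k
    induction k with
    | zero => exact fun a ha => ⟨0, zero_mem S, by simpa using ha⟩
    | succ k ih =>
      have h2 : ∀ y ∈ N * N, ∃ s ∈ S, y - s ∈ N ^ (k + 1 + 1) := by
        intro y hy
        induction hy using Submodule.mul_induction_on' with
        | mem_mul_mem a ha b hb =>
          obtain ⟨s, hs, has⟩ := ih a ha
          obtain ⟨s', hs', hbs⟩ := ih b hb
          refine ⟨s * s', mul_mem hs hs', ?_⟩
          have h3 : s ∈ N := by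
            have := sub_mem ha (Ideal.pow_le_self (by omega) has)
            rwa [sub_sub_cancel] at this
          have h4 : a * b - s * s' = (a - s) * b + (b - s') * s := by ring
          rw [h4, pow_succ]
          exact add_mem (Ideal.mul_mem_mul has hb) (Ideal.mul_mem_mul hbs h3)
        | add a _ b _ ha hb =>
          obtain ⟨s, hs, has⟩ := ha
          obtain ⟨s', hs', hbs⟩ := hb
          exact ⟨s + s', add_mem hs hs', by rw [add_sub_add_comm]; exact add_mem has hbs⟩
      intro a ha
      obtain ⟨s, hs, has⟩ := h a ha
      obtain ⟨s', hs', hbs⟩ := h2 (a - s) (by rwa [← pow_two])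
      exact ⟨s + s', add_mem hs hs', by rwa [← sub_sub]⟩
  obtain ⟨n, hn⟩ := hN
  refine eq_top_iff.2 fun a _ => ?_
  obtain ⟨c, hca⟩ := hc a
  obtain ⟨s, hs, has⟩ := h1 n _ hca
  have h2 : N ^ (n + 1) = ⊥ := by rw [pow_succ, hn, Ideal.zero_eq_bot, Ideal.bot_mul]
  rw [h2, Ideal.mem_bot, sub_sub, sub_eq_zero] at has
  rw [has]
  exact add_mem (S.algebraMap_mem c) hs

/-- A proper subalgebra is killed by a nonzero derivation into the residue field. -/
theorem exists_derivation {A : Type w} [CommRing A] [Algebra 𝔬 A] [Finite A]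
    (π : A →ₐ[𝔬] ResidueField 𝔬) (hπ : ∀ x, π x = 0 → IsNilpotent x) (S : Subalgebra 𝔬 A)
    (hS : S ≠ ⊤) : ∃ φ φ' : A →ₐ[𝔬] DualNumber (ResidueField 𝔬), φ ≠ φ' ∧ ∀ a ∈ S, φ a = φ' a := by
  let N := RingHom.ker π
  have hN : IsNilpotent N := (Ideal.FG.isNilpotent_iff_le_nilradical (IsNoetherian.noetherian N)).2
    fun x hx => hπ x hx
  have hc : ∀ a : A, ∃ c : 𝔬, a - algebraMap 𝔬 A c ∈ N := by
    intro a
    obtain ⟨c, hc⟩ := IsLocalRing.residue_surjective (π a)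
    refine ⟨c, ?_⟩
    rw [RingHom.mem_ker, map_sub, AlgHom.commutes, ← hc]
    exact sub_self _
  let T : Submodule 𝔬 A := Subalgebra.toSubmodule S ⊔ (N ^ 2).restrictScalars 𝔬
  have hT : T ≠ ⊤ := by
    intro hT
    refine hS (subalgebra_eq_top_of_sup_sq N hN hc S fun a _ => ?_)
    obtain ⟨s, hs, n, hn, hsn⟩ := Submodule.mem_sup.1 (hT ▸ Submodule.mem_top : a ∈ T)
    exact ⟨s, hs, by rw [← hsn, add_sub_cancel_left]; exact hn⟩
  have hmT : Module.IsTorsionBySet 𝔬 (A ⧸ T) (maximalIdeal 𝔬 : Set 𝔬) := by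
    intro q c
    obtain ⟨a, rfl⟩ := Submodule.Quotient.mk_surjective T q
    obtain ⟨b, hb⟩ := hc a
    rw [← Submodule.Quotient.mk_smul, Submodule.Quotient.mk_eq_zero]
    have h1 : (c : 𝔬) • a = algebraMap 𝔬 A (c * b) + algebraMap 𝔬 A c * (a - algebraMap 𝔬 A b) := by
      rw [Algebra.smul_def, map_mul]; ring
    rw [h1]
    refine Submodule.add_mem_sup (S.algebraMap_mem _) ?_
    rw [Submodule.restrictScalars_mem, pow_two]
    refine Ideal.mul_mem_mul ?_ hb
    rw [RingHom.mem_ker, AlgHom.commutes]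
    exact (residue_eq_zero_iff _).2 c.2
  let : Module (ResidueField 𝔬) (A ⧸ T) := hmT.module
  have : IsScalarTower 𝔬 (ResidueField 𝔬) (A ⧸ T) := hmT.isScalarTower
  have : Nontrivial (A ⧸ T) := Submodule.Quotient.nontrivial_iff.2 hT
  obtain ⟨q, hq⟩ := exists_ne (0 : A ⧸ T)
  obtain ⟨f, hf⟩ : ∃ f : Module.Dual (ResidueField 𝔬) (A ⧸ T), f q ≠ 0 := by
    by_contra! h
    exact hq ((Module.forall_dual_apply_eq_zero_iff (ResidueField 𝔬) q).1 h)
  let D : A →ₗ[𝔬] ResidueField 𝔬 := (f.restrictScalars 𝔬).comp T.mkQ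
  have hDT : ∀ a ∈ T, D a = 0 := fun a ha => by
    change f (T.mkQ a) = 0
    rw [Submodule.mkQ_apply, (Submodule.Quotient.mk_eq_zero T).2 ha, map_zero]
  have hDc : ∀ c, D (algebraMap 𝔬 A c) = 0 := fun c =>
    hDT _ (Submodule.mem_sup_left (S.algebraMap_mem c))
  have hsm : ∀ (c : 𝔬) (x : ResidueField 𝔬), c • x = residue 𝔬 c * x := fun c x =>
    Algebra.smul_def c x
  have hDmul : ∀ a b, D (a * b) = π a * D b + π b * D a := by
    intro a b
    obtain ⟨c, hca⟩ := hc a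
    obtain ⟨e, heb⟩ := hc b
    have h1 : a * b = c • b + e • a - algebraMap 𝔬 A (c * e) +
        (a - algebraMap 𝔬 A c) * (b - algebraMap 𝔬 A e) := by
      rw [Algebra.smul_def, Algebra.smul_def, map_mul]; ring
    have h2 : π a = residue 𝔬 c := by
      rw [RingHom.mem_ker, map_sub, AlgHom.commutes, sub_eq_zero] at hca
      exact hca
    have h3 : π b = residue 𝔬 e := by
      rw [RingHom.mem_ker, map_sub, AlgHom.commutes, sub_eq_zero] at heb
      exact heb
    have h4 : D ((a - algebraMap 𝔬 A c) * (b - algebraMap 𝔬 A e)) = 0 :=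
      hDT _ (Submodule.mem_sup_right (by
        rw [Submodule.restrictScalars_mem, pow_two]; exact Ideal.mul_mem_mul hca heb))
    rw [h1, map_add, h4, map_sub, hDc, map_add, map_smul, map_smul, h2, h3, hsm, hsm, sub_zero,
      add_zero]
  let φ : A →ₐ[𝔬] DualNumber (ResidueField 𝔬) := AlgHom.ofLinearMap
    { toFun := fun a => (TrivSqZeroExt.inl (π a) + TrivSqZeroExt.inr (D a) : DualNumber (ResidueField 𝔬))
      map_add' := fun a b => by ext <;> simp
      map_smul' := fun c a => by ext <;> simp }
    (by
      have h1 : D 1 = 0 := by simpa using hDc 1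
      ext <;> simp [h1])
    (fun a b => by
      ext
      · simp
      · simp [hDmul, mul_comm])
  let φ' : A →ₐ[𝔬] DualNumber (ResidueField 𝔬) :=
    (TrivSqZeroExt.inlAlgHom 𝔬 (ResidueField 𝔬) (ResidueField 𝔬)).comp π
  refine ⟨φ, φ', fun h => ?_, fun a ha => ?_⟩
  · obtain ⟨a, rfl⟩ := Submodule.Quotient.mk_surjective T q
    refine hf ?_
    have h1 := congrArg TrivSqZeroExt.snd (AlgHom.congr_fun h a)
    have h2 : 0 + D a = 0 := h1
    rwa [zero_add] at h2
  · have h1 : D a = 0 := hDT a (Submodule.mem_sup_left ha)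
    change (TrivSqZeroExt.inl (π a) + TrivSqZeroExt.inr (D a) : DualNumber (ResidueField 𝔬)) =
      TrivSqZeroExt.inl (π a)
    rw [h1, TrivSqZeroExt.inr_zero, add_zero]

variable [Finite (ResidueField 𝔬)] {A : Type w} [CommRing A] [Algebra 𝔬 A] [Finite A]
  {σ : Type t} {γ : σ → G}

/-- The matrix entries of `ρ` at a separating family of group elements generate all its matrix
entries: otherwise a derivation that vanishes on the former but not on the latter would give two
different representations over the dual numbers with the same values at the family. -/
theorem DeformationCondition.Separates.mem_subalgebra (hγ : P.Separates γ)
    (π : A →ₐ[𝔬] ResidueField 𝔬)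
    (hπ : ∀ x, π x = 0 → IsNilpotent x) {ρ : G →* Matrix (Fin d) (Fin d) A} (hρ : P.Holds ρ)
    (S : Subalgebra 𝔬 A) (hS : ∀ l i j, ρ (γ l) i j ∈ S) (g : G) (i j : Fin d) : ρ g i j ∈ S := by
  have : Finite (DualNumber (ResidueField 𝔬)) :=
    inferInstanceAs (Finite (ResidueField 𝔬 × ResidueField 𝔬))
  let A₀ := Algebra.adjoin 𝔬 (Set.range fun x : G × Fin d × Fin d => ρ x.1 x.2.1 x.2.2)
  have hmem : ∀ g i j, ρ g i j ∈ A₀ := fun g i j => Algebra.subset_adjoin ⟨(g, i, j), rfl⟩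
  obtain ⟨ρ₀, he⟩ := exists_mapRep_eq (A₀.val : A₀ →+* A) Subtype.val_injective ρ
    fun g i j => ⟨⟨ρ g i j, hmem g i j⟩, rfl⟩
  have he' : ∀ g i j, (ρ₀ g i j : A) = ρ g i j := fun g i j =>
    congrFun (congrFun (DFunLike.congr_fun he g) i) j
  have hρ₀ : P.Holds ρ₀ := P.of_injective A₀.val A₀.val (fun x y h _ => Subtype.ext h)
    (by rw [he]; exact hρ) (by rw [he]; exact hρ)
  by_contra hg
  have hS₀ : S.comap A₀.val ≠ ⊤ := fun h => hg (by
    have : ρ₀ g i j ∈ S.comap A₀.val := h ▸ Algebra.mem_top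
    rw [← he']
    exact this)
  obtain ⟨φ, φ', hne, hφ⟩ := exists_derivation (π.comp A₀.val)
    (fun x hx => (IsNilpotent.map_iff (f := A₀.val) Subtype.val_injective).1 (hπ _ hx)) _ hS₀
  have h1 : mapRep (φ : A₀ →+* _) ρ₀ = mapRep (φ' : A₀ →+* _) ρ₀ :=
    hγ _ _ (P.map φ hρ₀) (P.map φ' hρ₀) fun l => Matrix.ext fun i j => hφ _ (by
      rw [Subalgebra.mem_comap, Subalgebra.val_apply, he']
      exact hS l i j)
  refine hne (AlgHom.ext fun x => ?_)
  have h2 : A₀ ≤ (AlgHom.equalizer φ φ').map A₀.val := by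
    refine Algebra.adjoin_le ?_
    rintro _ ⟨⟨g, i, j⟩, rfl⟩
    exact ⟨ρ₀ g i j, congrFun (congrFun (DFunLike.congr_fun h1 g) i) j, he' g i j⟩
  obtain ⟨y, hy, hyx⟩ := h2 x.2
  rw [← Subtype.ext (a1 := y) (a2 := x) hyx]
  exact hy

omit [Finite (ResidueField 𝔬)] in
/-- Two representations with the same reduction come from the fibre product. -/
theorem DeformationCondition.exists_rep_equalizer {A' : Type w} [CommRing A'] [Algebra 𝔬 A']
    [Finite A'] {π : A →ₐ[𝔬] ResidueField 𝔬} {π' : A' →ₐ[𝔬] ResidueField 𝔬}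
    {ρ : G →* Matrix (Fin d) (Fin d) A} {ρ' : G →* Matrix (Fin d) (Fin d) A'}
    (hρ : P.Holds ρ) (hρ' : P.Holds ρ')
    (h : mapRep (π : A →+* ResidueField 𝔬) ρ = mapRep (π' : A' →+* ResidueField 𝔬) ρ') :
    ∃ r : G →* Matrix (Fin d) (Fin d)
        (AlgHom.equalizer (π.comp (AlgHom.fst 𝔬 A A')) (π'.comp (AlgHom.snd 𝔬 A A'))),
      P.Holds r ∧ ∀ g i j, (r g i j : A × A') = (ρ g i j, ρ' g i j) := by
  let B := AlgHom.equalizer (π.comp (AlgHom.fst 𝔬 A A')) (π'.comp (AlgHom.snd 𝔬 A A'))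
  let p : B →ₐ[𝔬] A := (AlgHom.fst 𝔬 A A').comp B.val
  let p' : B →ₐ[𝔬] A' := (AlgHom.snd 𝔬 A A').comp B.val
  let M : G → Matrix (Fin d) (Fin d) B := fun g => Matrix.of fun i j =>
    ⟨(ρ g i j, ρ' g i j), congrFun (congrFun (DFunLike.congr_fun h g) i) j⟩
  have hM : ∀ N N' : Matrix (Fin d) (Fin d) B,
      (p : B →+* A).mapMatrix N = (p : B →+* A).mapMatrix N' →
      (p' : B →+* A').mapMatrix N = (p' : B →+* A').mapMatrix N' → N = N' := fun N N' h1 h2 =>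
    Matrix.ext fun i j => Subtype.ext (Prod.ext (congrFun (congrFun h1 i) j)
      (congrFun (congrFun h2 i) j))
  have hMp : ∀ g, (p : B →+* A).mapMatrix (M g) = ρ g := fun g => rfl
  have hMp' : ∀ g, (p' : B →+* A').mapMatrix (M g) = ρ' g := fun g => rfl
  refine ⟨{ toFun := M
            map_one' := hM _ _ (by rw [hMp, map_one, map_one]) (by rw [hMp', map_one, map_one])
            map_mul' := fun g g' => hM _ _ (by rw [map_mul, hMp, hMp, hMp, map_mul])
              (by rw [map_mul, hMp', hMp', hMp', map_mul]) },
    P.of_injective p p' (fun x y hx hy => Subtype.ext (Prod.ext hx hy)) hρ hρ', fun _ _ _ => rfl⟩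

omit [Finite (ResidueField 𝔬)] [Finite A] in
theorem isNilpotent_of_mem_equalizer {A' : Type w} [CommRing A'] [Algebra 𝔬 A']
    {π : A →ₐ[𝔬] ResidueField 𝔬} {π' : A' →ₐ[𝔬] ResidueField 𝔬}
    (hπ : ∀ x, π x = 0 → IsNilpotent x) (hπ' : ∀ x, π' x = 0 → IsNilpotent x)
    (x : AlgHom.equalizer (π.comp (AlgHom.fst 𝔬 A A')) (π'.comp (AlgHom.snd 𝔬 A A')))
    (hx : π x.1.1 = 0) : IsNilpotent x := by
  have h2 : π' x.1.2 = 0 := (show π x.1.1 = π' x.1.2 from x.2).symm.trans hx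
  obtain ⟨m, hm⟩ := hπ _ hx
  obtain ⟨n, hn⟩ := hπ' _ h2
  refine ⟨m + n, Subtype.ext (Prod.ext ?_ ?_)⟩
  · change x.1.1 ^ (m + n) = 0
    rw [pow_add, hm, zero_mul]
  · change x.1.2 ^ (m + n) = 0
    rw [pow_add, hn, mul_zero]

/-- A representation descends to the image of any homomorphism whose image contains its entries at a
separating family. -/
theorem DeformationCondition.Separates.exists_rep_quotient_ker (hγ : P.Separates γ)
    {π : A →ₐ[𝔬] ResidueField 𝔬} (hπ : ∀ x, π x = 0 → IsNilpotent x)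
    {Λ : Type w} [CommRing Λ] [Algebra 𝔬 Λ] (f : Λ →ₐ[𝔬] A)
    {ρ : G →* Matrix (Fin d) (Fin d) A} (hρ : P.Holds ρ)
    (h : ∀ l i j, ρ (γ l) i j ∈ f.range) :
    ∃ ρ' : G →* Matrix (Fin d) (Fin d) (Λ ⧸ RingHom.ker f), P.Holds ρ' ∧
      ∀ g i j, Ideal.kerLiftAlg f (ρ' g i j) = ρ g i j := by
  obtain ⟨ρ', he⟩ := exists_mapRep_eq (Ideal.kerLiftAlg f : Λ ⧸ RingHom.ker f →+* A)
    (Ideal.kerLiftAlg_injective f) ρ fun g i j => by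
      obtain ⟨a, ha⟩ := hγ.mem_subalgebra π hπ hρ f.range h g i j
      exact ⟨Ideal.Quotient.mk _ a, ha⟩
  refine ⟨ρ', P.of_injective (Ideal.kerLiftAlg f) (Ideal.kerLiftAlg f)
    (fun x y hxy _ => Ideal.kerLiftAlg_injective f hxy) (by rw [he]; exact hρ)
    (by rw [he]; exact hρ), fun g i j => congrFun (congrFun (DFunLike.congr_fun he g) i) j⟩

/-- Two lifts of the same residual representation agreeing at a separating family are equal. -/
theorem DeformationCondition.Separates.rep_ext (hγ : P.Separates γ)
    {π : A →ₐ[𝔬] ResidueField 𝔬} (hπ : ∀ x, π x = 0 → IsNilpotent x)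
    {ρ ρ' : G →* Matrix (Fin d) (Fin d) A} (hρ : P.Holds ρ) (hρ' : P.Holds ρ')
    (h : mapRep (π : A →+* ResidueField 𝔬) ρ = mapRep (π : A →+* ResidueField 𝔬) ρ')
    (hl : ∀ l, ρ (γ l) = ρ' (γ l)) : ρ = ρ' := by
  -- apply the generation statement to `(ρ, ρ')` over the fibre product and its diagonal
  obtain ⟨r, hr, hrρ⟩ := P.exists_rep_equalizer hρ hρ' h
  let B := AlgHom.equalizer (π.comp (AlgHom.fst 𝔬 A A)) (π.comp (AlgHom.snd 𝔬 A A))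
  let p : B →ₐ[𝔬] A := (AlgHom.fst 𝔬 A A).comp B.val
  let p' : B →ₐ[𝔬] A := (AlgHom.snd 𝔬 A A).comp B.val
  refine MonoidHom.ext fun g => Matrix.ext fun i j => ?_
  have h1 : (r g i j : A × A).1 = (r g i j : A × A).2 :=
    hγ.mem_subalgebra (π.comp p) (fun x hx => isNilpotent_of_mem_equalizer hπ hπ x hx) hr
      (AlgHom.equalizer p p') (fun l i j => by
        change (r (γ l) i j : A × A).1 = (r (γ l) i j : A × A).2
        rw [hrρ, hl]) g i j
  rwa [hrρ] at h1

end Generation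

/-! ### Complete local algebras -/

namespace CompleteLocalAlg

variable {𝔬 : Type w} [CommRing 𝔬] [IsLocalRing 𝔬]

theorem residueMap_bijective (A : CompleteLocalAlg 𝔬) : Function.Bijective A.residueMap := by
  refine ⟨RingHom.injective _, fun x => ?_⟩
  obtain ⟨c, hc⟩ := A.residue_surjective x
  exact ⟨residue 𝔬 c, hc⟩

/-- The reduction map of `A` to the residue field of `𝔬`. -/
noncomputable def toResidue (A : CompleteLocalAlg 𝔬) : A →ₐ[𝔬] ResidueField 𝔬 where
  __ := (RingEquiv.ofBijective A.residueMap A.residueMap_bijective).symm.toRingHom.comp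
    (residue A.carrier)
  commutes' _ := (RingEquiv.symm_apply_eq _).2 rfl

theorem residueMap_toResidue (A : CompleteLocalAlg 𝔬) (a : A) :
    A.residueMap (A.toResidue a) = residue A.carrier a :=
  (RingEquiv.ofBijective A.residueMap A.residueMap_bijective).apply_symm_apply _

theorem toResidue_eq_zero_iff {A : CompleteLocalAlg 𝔬} {a : A} :
    A.toResidue a = 0 ↔ a ∈ maximalIdeal A.carrier := by
  rw [← A.residueMap_bijective.1.eq_iff, residueMap_toResidue, map_zero, residue_eq_zero_iff]

theorem exists_sub_algebraMap_mem (A : CompleteLocalAlg 𝔬) (a : A) :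
    ∃ c : 𝔬, a - algebraMap 𝔬 A c ∈ maximalIdeal A.carrier := by
  obtain ⟨c, hc⟩ := IsLocalRing.residue_surjective (A.toResidue a)
  refine ⟨c, ?_⟩
  rw [← toResidue_eq_zero_iff, map_sub, AlgHom.commutes, ← hc]
  exact sub_self _

/-- All homomorphisms to the residue field agree with the reduction map. -/
theorem algHom_eq_toResidue {A : CompleteLocalAlg 𝔬} (f : A →ₐ[𝔬] ResidueField 𝔬) :
    f = A.toResidue := by
  have hs : Function.Surjective (f : A →+* ResidueField 𝔬) := fun x => by
    obtain ⟨c, rfl⟩ := IsLocalRing.residue_surjective x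
    exact ⟨algebraMap 𝔬 A c, f.commutes c⟩
  have hk : RingHom.ker (f : A →+* ResidueField 𝔬) = maximalIdeal A.carrier :=
    IsLocalRing.eq_maximalIdeal (RingHom.ker_isMaximal_of_surjective _ hs)
  ext a
  obtain ⟨c, hc⟩ := A.exists_sub_algebraMap_mem a
  have h1 := toResidue_eq_zero_iff.2 hc
  rw [← hk, RingHom.mem_ker] at hc
  change f (a - algebraMap 𝔬 A c) = 0 at hc
  rw [map_sub, AlgHom.commutes, sub_eq_zero] at hc h1
  rw [hc, h1]

/-- Homomorphisms of `𝔬`-algebras between complete local algebras are local. -/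
def ofAlgHom {A B : CompleteLocalAlg 𝔬} (f : A →ₐ[𝔬] B) : A ⟶ B :=
  ⟨f, ((local_hom_TFAE (f : A →+* B)).out 0 4).2 (by
    ext a
    rw [Ideal.mem_comap, ← toResidue_eq_zero_iff, ← toResidue_eq_zero_iff,
      ← algHom_eq_toResidue (B.toResidue.comp f)]
    rfl)⟩

@[ext]
theorem hom_ext {A B : CompleteLocalAlg 𝔬} {f g : A ⟶ B} (h : ∀ a, ringHom f a = ringHom g a) :
    f = g := Hom.ext (AlgHom.ext h)

theorem ringHom_algebraMap {A B : CompleteLocalAlg 𝔬} (f : A ⟶ B) (c : 𝔬) :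
    ringHom f (algebraMap 𝔬 A c) = algebraMap 𝔬 B c := f.toAlgHom.commutes c

theorem toResidue_ringHom {A B : CompleteLocalAlg 𝔬} (f : A ⟶ B) (a : A) :
    B.toResidue (ringHom f a) = A.toResidue a :=
  AlgHom.congr_fun (algHom_eq_toResidue (B.toResidue.comp f.toAlgHom)) a

theorem ringHom_mem {A B : CompleteLocalAlg 𝔬} (f : A ⟶ B) {a : A}
    (ha : a ∈ maximalIdeal A.carrier) : ringHom f a ∈ maximalIdeal B.carrier := by
  rwa [← toResidue_eq_zero_iff, toResidue_ringHom, toResidue_eq_zero_iff]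

theorem ringHom_mem_pow {A B : CompleteLocalAlg 𝔬} (f : A ⟶ B) {n : ℕ} {a : A}
    (ha : a ∈ maximalIdeal A.carrier ^ n) : ringHom f a ∈ maximalIdeal B.carrier ^ n := by
  have h1 : (maximalIdeal A.carrier).map (ringHom f) ≤ maximalIdeal B.carrier :=
    Ideal.map_le_iff_le_comap.2 fun x hx => ringHom_mem f hx
  exact Ideal.pow_right_mono h1 n (Ideal.map_pow (ringHom f) _ n ▸ Ideal.mem_map_of_mem _ ha)

instance [Finite (ResidueField 𝔬)] (A : CompleteLocalAlg 𝔬) (n : ℕ) :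
    Finite (A ⧸ maximalIdeal A.carrier ^ n) := by
  have : Finite (A ⧸ maximalIdeal A.carrier) := Finite.of_surjective _ A.residueMap_bijective.2
  exact Ideal.finite_quotient_pow (IsNoetherian.noetherian _) n

theorem finite_quotient [Finite (ResidueField 𝔬)] {A : CompleteLocalAlg 𝔬} {I : Ideal A} {n : ℕ}
    (h : maximalIdeal A.carrier ^ n ≤ I) : Finite (A ⧸ I) :=
  Finite.of_surjective _ (Ideal.Quotient.factor_surjective h)

theorem eq_zero_of_forall_mem_pow {A : CompleteLocalAlg 𝔬} {a : A}
    (h : ∀ n, a ∈ maximalIdeal A.carrier ^ n) : a = 0 :=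
  IsHausdorff.haus (inferInstance : IsHausdorff (maximalIdeal A.carrier) A.carrier) a fun n => by
    rw [SModEq.zero, smul_eq_mul, Ideal.mul_top]
    exact h n

/-- All ideals of a complete local noetherian ring are closed. -/
theorem mem_of_forall_mem_sup_pow {A : CompleteLocalAlg 𝔬} {J : Ideal A} {a : A}
    (h : ∀ n, a ∈ J ⊔ maximalIdeal A.carrier ^ n) : a ∈ J := by
  rw [← Ideal.Quotient.eq_zero_iff_mem]
  refine IsHausdorff.haus (inferInstance : IsHausdorff (maximalIdeal A.carrier) (A.carrier ⧸ J))
    _ fun n => ?_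
  rw [SModEq.zero]
  obtain ⟨x, hx, y, hy, hxy⟩ := Submodule.mem_sup.1 (h n)
  rw [← hxy, map_add, Ideal.Quotient.eq_zero_iff_mem.2 hx, zero_add]
  have h1 : Ideal.Quotient.mk J y = y • (1 : A ⧸ J) := by
    rw [Algebra.smul_def, mul_one]; rfl
  rw [h1]
  exact Submodule.smul_mem_smul hy Submodule.mem_top

theorem exists_limit {A : CompleteLocalAlg 𝔬} (x : ℕ → A)
    (h : ∀ n, x (n + 1) - x n ∈ maximalIdeal A.carrier ^ n) :
    ∃ y, ∀ n, y - x n ∈ maximalIdeal A.carrier ^ n := by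
  obtain ⟨y, hy⟩ := IsPrecomplete.prec
    (inferInstance : IsPrecomplete (maximalIdeal A.carrier) A.carrier) (f := x) (fun {m n} hmn => by
      rw [SModEq.comm, SModEq.sub_mem, smul_eq_mul, Ideal.mul_top]
      induction n, hmn using Nat.le_induction with
      | base => simp
      | succ n hmn ih =>
        rw [← sub_add_sub_cancel _ (x n)]
        exact add_mem (Ideal.pow_le_pow_right hmn (h n)) ih)
  refine ⟨y, fun n => ?_⟩
  have := hy n
  rwa [SModEq.comm, SModEq.sub_mem, smul_eq_mul, Ideal.mul_top] at this

/-- The quotient of a complete local algebra by a proper ideal. -/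
noncomputable def quot (A : CompleteLocalAlg 𝔬) (J : Ideal A) (hJ : J ≤ maximalIdeal A.carrier) :
    CompleteLocalAlg 𝔬 :=
  have hnt : Nontrivial (A ⧸ J) := Ideal.Quotient.nontrivial_iff.2 fun h =>
    (maximalIdeal.isMaximal A.carrier).ne_top (top_le_iff.1 (h ▸ hJ))
  have hloc : IsLocalRing (A ⧸ J) :=
    IsLocalRing.of_surjective' (Ideal.Quotient.mk J) Ideal.Quotient.mk_surjective
  have hmap : (maximalIdeal A.carrier).map (Ideal.Quotient.mk J) = maximalIdeal (A ⧸ J) :=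
    map_maximalIdeal_of_surjective _ Ideal.Quotient.mk_surjective
  have hpow : ∀ n x, x ∈ maximalIdeal (A ⧸ J) ^ n →
      ∃ a ∈ maximalIdeal A.carrier ^ n, Ideal.Quotient.mk J a = x := fun n x hx => by
    rw [← hmap, ← Ideal.map_pow] at hx
    exact (Ideal.mem_map_iff_of_surjective _ Ideal.Quotient.mk_surjective).1 hx
  have hcomplete : IsAdicComplete (maximalIdeal (A ⧸ J)) (A ⧸ J) :=
    { prec' := fun f hf => by
        obtain ⟨x, hx⟩ : ∃ x : ℕ → A, ∀ n, Ideal.Quotient.mk J (x n) = f n ∧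
            x (n + 1) - x n ∈ maximalIdeal A.carrier ^ n := by
          choose! e he using fun n => hpow n (f (n + 1) - f n) (by
            have := hf (Nat.le_succ n)
            rwa [SModEq.comm, SModEq.sub_mem, smul_eq_mul, Ideal.mul_top] at this)
          obtain ⟨x0, hx0⟩ := Ideal.Quotient.mk_surjective (f 0)
          refine ⟨fun n => x0 + ∑ i ∈ Finset.range n, e i, fun n => ⟨?_, ?_⟩⟩
          · beta_reduce
            rw [map_add, hx0, map_sum, Finset.sum_congr rfl fun i _ => (he i).2,
              Finset.sum_range_sub, add_sub_cancel]
          · beta_reduce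
            rw [Finset.sum_range_succ, ← add_assoc, add_sub_cancel_left]
            exact (he n).1
        obtain ⟨y, hy⟩ := exists_limit x fun n => (hx n).2
        refine ⟨Ideal.Quotient.mk J y, fun n => ?_⟩
        rw [SModEq.comm, SModEq.sub_mem, smul_eq_mul, Ideal.mul_top, ← (hx n).1, ← map_sub, ← hmap,
          ← Ideal.map_pow]
        exact Ideal.mem_map_of_mem _ (hy n) }
  have hlh : IsLocalHom (algebraMap 𝔬 (A ⧸ J)) := by
    have h1 : IsLocalHom (Ideal.Quotient.mk J) :=
      ((local_hom_TFAE (Ideal.Quotient.mk J)).out 0 1).2 (by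
        rintro _ ⟨a, ha, rfl⟩
        rw [← hmap]
        exact Ideal.mem_map_of_mem _ ha)
    exact ⟨fun c hc => IsLocalHom.map_nonunit (f := algebraMap 𝔬 A) c
      (IsLocalHom.map_nonunit (f := Ideal.Quotient.mk J) _ hc)⟩
  { carrier := A ⧸ J
    residue_surjective := fun y => by
      obtain ⟨x, rfl⟩ := IsLocalRing.residue_surjective y
      obtain ⟨a, rfl⟩ := Ideal.Quotient.mk_surjective x
      obtain ⟨c, hc⟩ := A.exists_sub_algebraMap_mem a
      refine ⟨c, ?_⟩
      change residue (A ⧸ J) (Ideal.Quotient.mk J (algebraMap 𝔬 A c)) = _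
      rw [eq_comm, ← sub_eq_zero, ← map_sub, ← map_sub, residue_eq_zero_iff, ← hmap]
      exact Ideal.mem_map_of_mem _ hc }

section Quot

variable {A B : CompleteLocalAlg 𝔬} {J : Ideal A} (hJ : J ≤ maximalIdeal A.carrier)

/-- The projection of `A` onto the quotient `A ⧸ J`. -/
noncomputable def quotMk : A ⟶ A.quot J hJ := ofAlgHom (Ideal.Quotient.mkₐ 𝔬 J)

theorem quotMk_surjective : Function.Surjective (ringHom (quotMk hJ)) := Ideal.Quotient.mk_surjective

theorem quotMk_eq_zero_iff {a : A} : ringHom (quotMk hJ) a = 0 ↔ a ∈ J :=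
  Ideal.Quotient.eq_zero_iff_mem

/-- The homomorphism on `A ⧸ J` induced by a homomorphism on `A` that vanishes on `J`. -/
noncomputable def quotLift (f : A ⟶ B) (hf : ∀ a ∈ J, ringHom f a = 0) : A.quot J hJ ⟶ B :=
  ofAlgHom (Ideal.Quotient.liftₐ J f.toAlgHom hf)

theorem quotMk_quotLift (f : A ⟶ B) (hf : ∀ a ∈ J, ringHom f a = 0) :
    quotMk hJ ≫ quotLift hJ f hf = f := hom_ext fun _ => rfl

theorem mem_sup_pow_iff {n : ℕ} {a : A} :
    a ∈ J ⊔ maximalIdeal A.carrier ^ n ↔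
      ringHom (quotMk hJ) a ∈ maximalIdeal (A.quot J hJ).carrier ^ n := by
  have hmap : (maximalIdeal A.carrier).map (ringHom (quotMk hJ)) =
      maximalIdeal (A.quot J hJ).carrier :=
    map_maximalIdeal_of_surjective _ (quotMk_surjective hJ)
  rw [← hmap, ← Ideal.map_pow, ← Ideal.mem_comap,
    Ideal.comap_map_of_surjective' _ (quotMk_surjective hJ), sup_comm]
  have h1 : RingHom.ker (ringHom (quotMk hJ)) = J := Ideal.mk_ker
  rw [h1]

end Quot

/-- A theorem of Chevalley: if a family of open ideals is stable under intersection, then it is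
cofinal among the open ideals containing its infimum. -/
theorem exists_mem_le_sInf_sup_pow [Finite (ResidueField 𝔬)] {A : CompleteLocalAlg 𝔬}
    (𝓕 : Set (Ideal A)) (hne : 𝓕.Nonempty) (hinf : ∀ I ∈ 𝓕, ∀ I' ∈ 𝓕, I ⊓ I' ∈ 𝓕)
    (hopen : ∀ I ∈ 𝓕, ∃ n, maximalIdeal A.carrier ^ n ≤ I) (n : ℕ) :
    ∃ I ∈ 𝓕, I ≤ sInf 𝓕 ⊔ maximalIdeal A.carrier ^ n := by
  -- the smallest ideal among the `I ⊔ 𝔪 ^ n`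
  have h1 : ∀ n, ∃ I ∈ 𝓕, ∀ I' ∈ 𝓕, I ≤ I' ⊔ maximalIdeal A.carrier ^ n := by
    intro n
    have hfin : {I : Ideal A | maximalIdeal A.carrier ^ n ≤ I}.Finite := by
      have : Finite (Ideal (A ⧸ maximalIdeal A.carrier ^ n)) :=
        Finite.of_injective _ SetLike.coe_injective
      refine (Set.finite_range (Ideal.comap (Ideal.Quotient.mk (maximalIdeal A.carrier ^ n)))).subset
        fun I hI => ⟨I.map (Ideal.Quotient.mk _), ?_⟩
      rw [Ideal.comap_map_of_surjective' _ Ideal.Quotient.mk_surjective, Ideal.mk_ker]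
      exact sup_eq_left.2 hI
    obtain ⟨_, ⟨⟨I, hI, rfl⟩, hmin⟩⟩ := Set.Finite.exists_minimal
      (s := (fun I => I ⊔ maximalIdeal A.carrier ^ n) '' 𝓕)
      (hfin.subset (by rintro _ ⟨I, -, rfl⟩; exact (le_sup_right : _ ≤ I ⊔ _))) (hne.image _)
    refine ⟨I, hI, fun I' hI' => ?_⟩
    have h2 : I ⊔ maximalIdeal A.carrier ^ n ≤ I ⊓ I' ⊔ maximalIdeal A.carrier ^ n :=
      hmin (Set.mem_image_of_mem _ (hinf I hI I' hI'))
      (sup_le_sup_right inf_le_left (maximalIdeal A.carrier ^ n))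
    exact le_trans le_sup_left (h2.trans (sup_le_sup_right inf_le_right _))
  choose I hI hmin using h1
  refine ⟨I n, hI n, fun x hx => ?_⟩
  have h2 : ∀ j, ∀ y ∈ I j ⊔ maximalIdeal A.carrier ^ j,
      ∃ z ∈ I (j + 1) ⊔ maximalIdeal A.carrier ^ (j + 1), z - y ∈ maximalIdeal A.carrier ^ j := by
    intro j y hy
    have h3 : y ∈ I (j + 1) ⊔ maximalIdeal A.carrier ^ j :=
      sup_le (hmin j _ (hI (j + 1))) le_sup_right hy
    obtain ⟨z, hz, e, he, rfl⟩ := Submodule.mem_sup.1 h3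
    exact ⟨z, Ideal.mem_sup_left hz, by rw [sub_add_cancel_left]; exact neg_mem he⟩
  choose! s hs hs' using h2
  let z : ℕ → A := fun j => Nat.rec x (fun i y => s (n + i) y) j
  have hz : ∀ j, z j ∈ I (n + j) ⊔ maximalIdeal A.carrier ^ (n + j) := by
    intro j
    induction j with
    | zero => exact Ideal.mem_sup_left hx
    | succ j ih => exact hs _ _ ih
  obtain ⟨y, hy⟩ := exists_limit z fun j =>
    Ideal.pow_le_pow_right (Nat.le_add_left j n) (hs' (n + j) _ (hz j))
  have hzx : ∀ j, z j - x ∈ maximalIdeal A.carrier ^ n := by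
    intro j
    induction j with
    | zero => exact (sub_self x).symm ▸ zero_mem _
    | succ j ih =>
      rw [← sub_add_sub_cancel _ (z j)]
      exact add_mem (Ideal.pow_le_pow_right (Nat.le_add_right n j) (hs' (n + j) _ (hz j))) ih
  have hyJ : y ∈ sInf 𝓕 := by
    refine Submodule.mem_sInf.2 fun I' hI' => ?_
    obtain ⟨k, hk⟩ := hopen I' hI'
    have h3 : z k ∈ I' := sup_le ((hmin (n + k) I' hI').trans
      (sup_le le_rfl ((Ideal.pow_le_pow_right (Nat.le_add_left k n)).trans hk)))
      ((Ideal.pow_le_pow_right (Nat.le_add_left k n)).trans hk) (hz k)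
    rw [← sub_add_cancel y (z k)]
    exact add_mem (hk (hy k)) h3
  have h4 : x - y ∈ maximalIdeal A.carrier ^ n := by
    have := neg_mem (add_mem (hy n) (hzx n))
    rwa [sub_add_sub_cancel, neg_sub] at this
  rw [← sub_add_cancel x y]
  exact add_mem (Ideal.mem_sup_right h4) (Ideal.mem_sup_left hyJ)

end CompleteLocalAlg

/-! ### Lifts satisfying a deformation condition -/

section DeformationLifts

open CompleteLocalAlg

variable {𝔬 : Type w} [CommRing 𝔬] [IsLocalRing 𝔬]

namespace CompleteLocalAlg

/-- The reduction map of a quotient of `A`. -/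
noncomputable def quotResidue {A : CompleteLocalAlg 𝔬} (I : Ideal A)
    (hI : I ≤ maximalIdeal A.carrier) : A ⧸ I →ₐ[𝔬] ResidueField 𝔬 :=
  Ideal.Quotient.liftₐ I A.toResidue fun _ ha => toResidue_eq_zero_iff.2 (hI ha)

theorem isNilpotent_of_quotResidue_eq_zero {A : CompleteLocalAlg 𝔬} {I : Ideal A}
    {hI : I ≤ maximalIdeal A.carrier} {n : ℕ} (hn : maximalIdeal A.carrier ^ n ≤ I) (x : A ⧸ I)
    (hx : quotResidue I hI x = 0) : IsNilpotent x := by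
  obtain ⟨a, rfl⟩ := Ideal.Quotient.mk_surjective x
  have ha : A.toResidue a = 0 := hx
  refine ⟨n, ?_⟩
  rw [← map_pow, Ideal.Quotient.eq_zero_iff_mem]
  exact hn (Ideal.pow_mem_pow (toResidue_eq_zero_iff.1 ha) n)

end CompleteLocalAlg

variable {G : Type v} [Group G] {d : ℕ}

/-- A compatible system of representations modulo the powers of the maximal ideal has a limit. -/
theorem exists_rep_of_compatible {A : CompleteLocalAlg 𝔬}
    (ρ : ∀ n : ℕ, G →* Matrix (Fin d) (Fin d) (A ⧸ maximalIdeal A.carrier ^ n))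
    (h : ∀ n, mapRep (Ideal.Quotient.factorPow (maximalIdeal A.carrier) (Nat.le_succ n)) (ρ (n + 1)) =
      ρ n) :
    ∃ r : G →* Matrix (Fin d) (Fin d) A,
      ∀ n, mapRep (Ideal.Quotient.mk (maximalIdeal A.carrier ^ n)) r = ρ n := by
  choose x hx using fun n g i j => Ideal.Quotient.mk_surjective (ρ n g i j)
  have h1 : ∀ n g i j, x (n + 1) g i j - x n g i j ∈ maximalIdeal A.carrier ^ n := by
    intro n g i j
    rw [← Ideal.Quotient.mk_eq_mk_iff_sub_mem, hx]
    have h2 : Ideal.Quotient.factorPow (maximalIdeal A.carrier) (Nat.le_succ n) (ρ (n + 1) g i j) =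
      ρ n g i j := congrFun (congrFun (DFunLike.congr_fun (h n) g) i) j
    rw [← h2, ← hx]
    rfl
  choose y hy using fun g i j => exists_limit (fun n => x n g i j) fun n => h1 n g i j
  have hM : ∀ M N : Matrix (Fin d) (Fin d) A,
      (∀ n, (Ideal.Quotient.mk (maximalIdeal A.carrier ^ n)).mapMatrix M =
        (Ideal.Quotient.mk (maximalIdeal A.carrier ^ n)).mapMatrix N) → M = N := fun M N hMN =>
    Matrix.ext fun i j => sub_eq_zero.1 (eq_zero_of_forall_mem_pow fun n =>
      (Ideal.Quotient.mk_eq_mk_iff_sub_mem _ _).1 (congrFun (congrFun (hMN n) i) j))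
  have hr : ∀ n g, (Ideal.Quotient.mk (maximalIdeal A.carrier ^ n)).mapMatrix (Matrix.of (y g)) =
      ρ n g := fun n g => Matrix.ext fun i j => by
    rw [← hx n g i j]
    exact (Ideal.Quotient.mk_eq_mk_iff_sub_mem _ _).2 (hy g i j n)
  exact ⟨{ toFun := fun g => Matrix.of (y g)
           map_one' := hM _ _ fun n => by rw [hr, map_one, map_one]
           map_mul' := fun g g' => hM _ _ fun n => by rw [map_mul, hr, hr, hr, map_mul] },
    fun n => MonoidHom.ext fun g => hr n g⟩

set_option linter.unusedSectionVars false

variable [TopologicalSpace G] (P : DeformationCondition 𝔬 G d)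

/-- The lifts of `ρbar` to a complete local algebra satisfying the condition `P`. -/
structure DeformationCondition.IsLift (ρbar : G →* Matrix (Fin d) (Fin d) (ResidueField 𝔬))
    (A : CompleteLocalAlg 𝔬) (ρ : G →* Matrix (Fin d) (Fin d) A) : Prop where
  red : mapRep (A.toResidue : A →+* ResidueField 𝔬) ρ = ρbar
  holds : ∀ n : ℕ, P.Holds (mapRep (Ideal.Quotient.mk (maximalIdeal A.carrier ^ n)) ρ)

variable {P} {ρbar : G →* Matrix (Fin d) (Fin d) (ResidueField 𝔬)} [Finite (ResidueField 𝔬)]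
  {A B : CompleteLocalAlg 𝔬}

theorem mapRep_toResidue (f : A ⟶ B) (ρ : G →* Matrix (Fin d) (Fin d) A) :
    mapRep (B.toResidue : B →+* ResidueField 𝔬) (mapRep (ringHom f) ρ) =
      mapRep (A.toResidue : A →+* ResidueField 𝔬) ρ :=
  MonoidHom.ext fun _ => Matrix.ext fun _ _ => toResidue_ringHom f _

/-- The condition for `ρ` modulo an open ideal passes to a quotient of `B`. -/
theorem DeformationCondition.holds_map {ρ : G →* Matrix (Fin d) (Fin d) A} {I : Ideal A} {n : ℕ}
    (hn : maximalIdeal A.carrier ^ n ≤ I) (hρ : P.Holds (mapRep (Ideal.Quotient.mk I) ρ))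
    (f : A ⟶ B) {K : Ideal B} {m : ℕ} (hm : maximalIdeal B.carrier ^ m ≤ K)
    (hf : ∀ a ∈ I, ringHom f a ∈ K) :
    P.Holds (mapRep (Ideal.Quotient.mk K) (mapRep (ringHom f) ρ)) := by
  have := finite_quotient hn
  have := finite_quotient hm
  exact P.map (Ideal.Quotient.liftₐ I ((Ideal.Quotient.mkₐ 𝔬 K).comp f.toAlgHom) fun a ha =>
    Ideal.Quotient.eq_zero_iff_mem.2 (hf a ha)) hρ

theorem DeformationCondition.IsLift.map (f : A ⟶ B) {ρ : G →* Matrix (Fin d) (Fin d) A}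
    (hρ : P.IsLift ρbar A ρ) : P.IsLift ρbar B (mapRep (ringHom f) ρ) where
  red := (mapRep_toResidue f ρ).trans hρ.red
  holds n := P.holds_map le_rfl (hρ.holds n) f le_rfl fun _ ha => ringHom_mem_pow f ha

/-- A lift satisfying the condition is determined by its values at a separating family. -/
theorem DeformationCondition.IsLift.ext {σ : Type t} {γ : σ → G} (hγ : P.Separates γ)
    {ρ ρ' : G →* Matrix (Fin d) (Fin d) A} (hρ : P.IsLift ρbar A ρ) (hρ' : P.IsLift ρbar A ρ')
    (h : ∀ l, ρ (γ l) = ρ' (γ l)) : ρ = ρ' := by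
  refine MonoidHom.ext fun g => Matrix.ext fun i j => sub_eq_zero.1 (eq_zero_of_forall_mem_pow
    fun n => Ideal.pow_le_pow_right (Nat.le_succ n) ?_)
  have h1 : mapRep (Ideal.Quotient.mk (maximalIdeal A.carrier ^ (n + 1))) ρ =
      mapRep (Ideal.Quotient.mk (maximalIdeal A.carrier ^ (n + 1))) ρ' :=
    hγ.rep_ext (π := quotResidue _ (Ideal.pow_le_self n.succ_ne_zero))
      (isNilpotent_of_quotResidue_eq_zero le_rfl) (hρ.holds _) (hρ'.holds _)
      (hρ.red.trans hρ'.red.symm) fun l =>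
        congrArg (Ideal.Quotient.mk (maximalIdeal A.carrier ^ (n + 1))).mapMatrix (h l)
  exact (Ideal.Quotient.mk_eq_mk_iff_sub_mem _ _).1
    (congrFun (congrFun (DFunLike.congr_fun h1 g) i) j)

/-- The locus where a lift of `ρbar` satisfies the condition is represented by a quotient. -/
theorem DeformationCondition.exists_quotient (hbar : P.Holds ρbar)
    (ρ : G →* Matrix (Fin d) (Fin d) A) (hρ : mapRep (A.toResidue : A →+* ResidueField 𝔬) ρ = ρbar) :
    ∃ (A' : CompleteLocalAlg 𝔬) (π : A ⟶ A'), Function.Surjective (ringHom π) ∧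
      ∀ (B : CompleteLocalAlg 𝔬) (f : A ⟶ B),
        P.IsLift ρbar B (mapRep (ringHom f) ρ) ↔ ∃ f' : A' ⟶ B, π ≫ f' = f := by
  let 𝓕 : Set (Ideal A) :=
    {I | (∃ n, maximalIdeal A.carrier ^ n ≤ I) ∧ P.Holds (mapRep (Ideal.Quotient.mk I) ρ)}
  have hm : maximalIdeal A.carrier ∈ 𝓕 := by
    refine ⟨⟨1, (pow_one _).le⟩, P.of_injective (quotResidue _ le_rfl) (quotResidue _ le_rfl)
      (fun x y hxy _ => ?_) (hρ.symm ▸ hbar) (hρ.symm ▸ hbar)⟩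
    obtain ⟨a, rfl⟩ := Ideal.Quotient.mk_surjective x
    obtain ⟨b, rfl⟩ := Ideal.Quotient.mk_surjective y
    rw [Ideal.Quotient.mk_eq_mk_iff_sub_mem, ← toResidue_eq_zero_iff, map_sub, sub_eq_zero]
    exact hxy
  have hinf : ∀ I ∈ 𝓕, ∀ I' ∈ 𝓕, I ⊓ I' ∈ 𝓕 := by
    rintro I ⟨⟨n, hn⟩, hI⟩ I' ⟨⟨n', hn'⟩, hI'⟩
    have := finite_quotient hn
    have := finite_quotient hn'
    refine ⟨⟨n + n', le_inf ((Ideal.pow_le_pow_right (Nat.le_add_right n n')).trans hn)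
      ((Ideal.pow_le_pow_right (Nat.le_add_left n' n)).trans hn')⟩,
      P.of_injective (B := A ⧸ I) (C := A ⧸ I') (Ideal.Quotient.factorₐ 𝔬 inf_le_left)
        (Ideal.Quotient.factorₐ 𝔬 inf_le_right)
        (fun x y hx hy => ?_) hI hI'⟩
    obtain ⟨a, rfl⟩ := Ideal.Quotient.mk_surjective x
    obtain ⟨b, rfl⟩ := Ideal.Quotient.mk_surjective y
    exact (Ideal.Quotient.mk_eq_mk_iff_sub_mem _ _).2
      ⟨(Ideal.Quotient.mk_eq_mk_iff_sub_mem _ _).1 hx,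
        (Ideal.Quotient.mk_eq_mk_iff_sub_mem _ _).1 hy⟩
  have hJ : sInf 𝓕 ≤ maximalIdeal A.carrier := sInf_le hm
  refine ⟨A.quot _ hJ, quotMk hJ, quotMk_surjective hJ, fun B f => ⟨fun hf => ?_, ?_⟩⟩
  · refine ⟨quotLift hJ f fun a ha => eq_zero_of_forall_mem_pow fun n => ?_, quotMk_quotLift hJ _ _⟩
    refine (sInf_le (a := (maximalIdeal B.carrier ^ n).comap (ringHom f)) ⟨⟨n, fun a ha =>
      ringHom_mem_pow f ha⟩, ?_⟩ : sInf 𝓕 ≤ _) ha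
    let e : A ⧸ (maximalIdeal B.carrier ^ n).comap (ringHom f) →ₐ[𝔬]
        B ⧸ maximalIdeal B.carrier ^ n :=
      Ideal.Quotient.liftₐ _ ((Ideal.Quotient.mkₐ 𝔬 (maximalIdeal B.carrier ^ n)).comp f.toAlgHom)
        fun a ha => Ideal.Quotient.eq_zero_iff_mem.2 ha
    refine P.of_injective e e (fun x y hxy _ => ?_) (hf.holds n) (hf.holds n)
    obtain ⟨a, rfl⟩ := Ideal.Quotient.mk_surjective x
    obtain ⟨b, rfl⟩ := Ideal.Quotient.mk_surjective y
    rw [Ideal.Quotient.mk_eq_mk_iff_sub_mem, Ideal.mem_comap, map_sub]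
    exact (Ideal.Quotient.mk_eq_mk_iff_sub_mem _ _).1 hxy
  · rintro ⟨f', rfl⟩
    refine ⟨(mapRep_toResidue _ ρ).trans hρ, fun n => ?_⟩
    obtain ⟨I, ⟨⟨m, hmI⟩, hI⟩, hIJ⟩ := exists_mem_le_sInf_sup_pow 𝓕 ⟨_, hm⟩ hinf (fun I hI => hI.1) n
    exact P.holds_map hmI hI _ le_rfl fun a ha =>
      ringHom_mem_pow f' ((mem_sup_pow_iff hJ).1 (hIJ ha))

end DeformationLifts

/-! ### Power series rings -/

namespace CompleteLocalAlg

variable {𝔬 : Type w} [CommRing 𝔬] [IsLocalRing 𝔬] {σ : Type}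

/-- Coefficients of the powers of the maximal ideal of a power series ring. -/
theorem coeff_mem_of_mem_pow {n : ℕ} {φ : MvPowerSeries σ 𝔬}
    (hφ : φ ∈ maximalIdeal (MvPowerSeries σ 𝔬) ^ n) (e : σ →₀ ℕ) :
    MvPowerSeries.coeff e φ ∈ maximalIdeal 𝔬 ^ (n - e.degree) := by
  classical
  induction n generalizing φ e with
  | zero => simp
  | succ n ih =>
    rw [pow_succ] at hφ
    induction hφ using Submodule.mul_induction_on' with
    | mem_mul_mem x hx y hy =>
      rw [MvPowerSeries.coeff_mul]
      refine sum_mem fun p hp => ?_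
      have hdeg : p.1.degree + p.2.degree = e.degree := by
        rw [← map_add, Finset.HasAntidiagonal.mem_antidiagonal.1 hp]
      have h1 : MvPowerSeries.coeff p.2 y ∈ maximalIdeal 𝔬 ^ (1 - p.2.degree) := by
        rcases Nat.eq_zero_or_pos p.2.degree with h0 | h0
        · rw [h0, Nat.sub_zero, pow_one, (Finsupp.degree_eq_zero_iff p.2).1 h0,
            MvPowerSeries.coeff_zero_eq_constantCoeff_apply, mem_maximalIdeal]
          exact fun h => hy (MvPowerSeries.isUnit_iff_constantCoeff.2 h)
        · rw [Nat.sub_eq_zero_of_le h0, pow_zero, Ideal.one_eq_top]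
          trivial
      have h2 := Ideal.mul_mem_mul (ih hx p.1) h1
      rw [← pow_add] at h2
      exact Ideal.pow_le_pow_right (by omega) h2
    | add x _ y _ hx hy =>
      rw [map_add]
      exact add_mem hx hy

set_option linter.unusedSectionVars false

variable [Finite σ]

theorem coe_mem_pow_of_mem {n : ℕ} {p : MvPolynomial σ 𝔬}
    (hp : p ∈ MvPolynomial.idealOfVars σ 𝔬 ^ n) :
    (p : MvPowerSeries σ 𝔬) ∈ maximalIdeal (MvPowerSeries σ 𝔬) ^ n := by
  have h1 : (MvPolynomial.idealOfVars σ 𝔬).map MvPolynomial.coeToMvPowerSeries.ringHom ≤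
      maximalIdeal (MvPowerSeries σ 𝔬) := by
    rw [MvPolynomial.idealOfVars, Ideal.map_span, Ideal.span_le]
    rintro _ ⟨_, ⟨i, rfl⟩, rfl⟩
    intro h
    have h2 := MvPowerSeries.isUnit_iff_constantCoeff.1 h
    simp at h2
  have h3 := Ideal.mem_map_of_mem MvPolynomial.coeToMvPowerSeries.ringHom hp
  rw [Ideal.map_pow] at h3
  exact Ideal.pow_right_mono h1 n h3

theorem mem_pow_of_truncTotal_eq_zero {n : ℕ} {φ : MvPowerSeries σ 𝔬}
    (hφ : MvPowerSeries.truncTotal n φ = 0) : φ ∈ maximalIdeal (MvPowerSeries σ 𝔬) ^ n := by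
  let e := MvPowerSeries.toAdicCompletionAlgEquiv σ 𝔬
  have h1 : e φ ∈ (MvPolynomial.idealOfVars σ 𝔬 ^ n •
      (⊤ : Submodule (MvPolynomial σ 𝔬)
        (AdicCompletion (MvPolynomial.idealOfVars σ 𝔬) (MvPolynomial σ 𝔬)))) := by
    rw [AdicCompletion.pow_smul_top_eq_ker_eval (MvPolynomial.idealOfVars_fg σ 𝔬), LinearMap.mem_ker]
    change (MvPowerSeries.toAdicCompletion σ 𝔬 φ).val n = 0
    rw [MvPowerSeries.toAdicCompletion_apply_eq_mk_truncTotal, hφ, map_zero]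
  have h2 : ∀ x, x ∈ (MvPolynomial.idealOfVars σ 𝔬 ^ n •
      (⊤ : Submodule (MvPolynomial σ 𝔬)
        (AdicCompletion (MvPolynomial.idealOfVars σ 𝔬) (MvPolynomial σ 𝔬)))) →
      e.symm x ∈ maximalIdeal (MvPowerSeries σ 𝔬) ^ n := by
    intro x hx
    induction hx using Submodule.smul_induction_on' with
    | smul r hr y _ =>
      rw [map_smul, Algebra.smul_def]
      exact Ideal.mul_mem_right _ _ (coe_mem_pow_of_mem hr)
    | add x _ y _ hx hy =>
      rw [map_add]
      exact add_mem hx hy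
  simpa using h2 _ h1

theorem sub_truncTotal_mem_pow (n : ℕ) (φ : MvPowerSeries σ 𝔬) :
    φ - (MvPowerSeries.truncTotal n φ : MvPolynomial σ 𝔬) ∈ maximalIdeal (MvPowerSeries σ 𝔬) ^ n := by
  refine mem_pow_of_truncTotal_eq_zero ?_
  ext e
  rw [MvPowerSeries.coeff_truncTotal_eq_ite, map_sub, MvPolynomial.coeff_coe,
    MvPowerSeries.coeff_truncTotal_eq_ite]
  split_ifs <;> simp

theorem mem_pow_of_forall_coeff_mem {n : ℕ} {φ : MvPowerSeries σ 𝔬}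
    (hφ : ∀ e : σ →₀ ℕ, MvPowerSeries.coeff e φ ∈ maximalIdeal 𝔬 ^ (n - e.degree)) :
    φ ∈ maximalIdeal (MvPowerSeries σ 𝔬) ^ n := by
  rw [← sub_add_cancel φ (MvPowerSeries.truncTotal n φ : MvPolynomial σ 𝔬)]
  refine add_mem (sub_truncTotal_mem_pow n φ) ?_
  have hC : (maximalIdeal 𝔬).map (MvPowerSeries.C (σ := σ) (R := 𝔬)) ≤
      maximalIdeal (MvPowerSeries σ 𝔬) := by
    refine Ideal.map_le_iff_le_comap.2 fun c hc h => hc ?_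
    have h2 := MvPowerSeries.isUnit_iff_constantCoeff.1 h
    rwa [MvPowerSeries.constantCoeff_C] at h2
  rw [MvPolynomial.as_sum (MvPowerSeries.truncTotal n φ)]
  change MvPolynomial.coeToMvPowerSeries.ringHom _ ∈ _
  rw [map_sum]
  refine sum_mem fun e he => ?_
  have hdeg : e.degree < n := by
    by_contra hn
    exact MvPolynomial.mem_support_iff.1 he (MvPowerSeries.coeff_truncTotal_eq_zero _ (not_lt.1 hn))
  have h1 : MvPolynomial.monomial e (MvPolynomial.coeff e (MvPowerSeries.truncTotal n φ)) =
      MvPolynomial.C (MvPowerSeries.coeff e φ) * MvPolynomial.monomial e 1 := by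
    rw [MvPowerSeries.coeff_truncTotal _ hdeg, MvPolynomial.C_mul_monomial, mul_one]
  have h2 : n = (n - e.degree) + e.degree := by omega
  rw [h1, map_mul, h2, pow_add]
  refine Ideal.mul_mem_mul ?_ (coe_mem_pow_of_mem
    ((MvPolynomial.monomial_mem_pow_idealOfVars_iff _ e one_ne_zero).2 le_rfl))
  have h3 := Ideal.mem_map_of_mem (MvPowerSeries.C (σ := σ) (R := 𝔬)) (hφ e)
  rw [Ideal.map_pow] at h3
  have h4 := Ideal.pow_right_mono hC _ h3
  rw [← MvPolynomial.coe_C] at h4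
  exact h4

variable (𝔬 σ) [IsNoetherianRing 𝔬] [IsAdicComplete (maximalIdeal 𝔬) 𝔬]

/-- The power series ring over `𝔬` in finitely many variables. -/
noncomputable def powerSeries : CompleteLocalAlg 𝔬 :=
  have hcomplete : IsAdicComplete (maximalIdeal (MvPowerSeries σ 𝔬)) (MvPowerSeries σ 𝔬) :=
    { prec' := fun f hf => by
        have h1 : ∀ {m n : ℕ}, m ≤ n → f m - f n ∈ maximalIdeal (MvPowerSeries σ 𝔬) ^ m := by
          intro m n hmn
          have := hf hmn
          rwa [SModEq.sub_mem, smul_eq_mul, Ideal.mul_top] at this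
        have h2 : ∀ e : σ →₀ ℕ, ∃ c : 𝔬, ∀ n,
            MvPowerSeries.coeff e (f (n + e.degree)) - c ∈ maximalIdeal 𝔬 ^ n := by
          intro e
          obtain ⟨c, hc⟩ := IsPrecomplete.prec (inferInstance : IsPrecomplete (maximalIdeal 𝔬) 𝔬)
            (f := fun n => MvPowerSeries.coeff e (f (n + e.degree))) (fun {m n} hmn => by
              rw [SModEq.sub_mem, smul_eq_mul, Ideal.mul_top, ← map_sub]
              have h3 := coeff_mem_of_mem_pow (h1 (Nat.add_le_add_right hmn e.degree)) e
              rwa [Nat.add_sub_cancel] at h3)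
          refine ⟨c, fun n => ?_⟩
          have := hc n
          rwa [SModEq.sub_mem, smul_eq_mul, Ideal.mul_top] at this
        choose c hc using h2
        let y : MvPowerSeries σ 𝔬 := c
        have hy : ∀ e, MvPowerSeries.coeff e y = c e := fun _ => rfl
        refine ⟨y, fun n => ?_⟩
        rw [SModEq.sub_mem, smul_eq_mul, Ideal.mul_top]
        refine mem_pow_of_forall_coeff_mem fun e => ?_
        rw [map_sub, hy]
        rcases le_total e.degree n with hn | hn
        · have h3 := hc e (n - e.degree)
          rwa [Nat.sub_add_cancel hn] at h3
        · rw [Nat.sub_eq_zero_of_le hn, pow_zero, Ideal.one_eq_top]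
          trivial }
  have hlocal : IsLocalHom (algebraMap 𝔬 (MvPowerSeries σ 𝔬)) := ⟨fun c hc => by
    have h2 := MvPowerSeries.isUnit_iff_constantCoeff.1 hc
    rwa [MvPowerSeries.algebraMap_apply, Algebra.algebraMap_self, RingHom.id_apply,
      MvPowerSeries.constantCoeff_C] at h2⟩
  { carrier := MvPowerSeries σ 𝔬
    residue_surjective := fun y => by
      obtain ⟨φ, rfl⟩ := IsLocalRing.residue_surjective y
      refine ⟨MvPowerSeries.constantCoeff φ, ?_⟩
      change residue (MvPowerSeries σ 𝔬) (algebraMap 𝔬 _ _) = _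
      rw [← sub_eq_zero, ← map_sub, residue_eq_zero_iff, mem_maximalIdeal]
      intro h
      have h2 := MvPowerSeries.isUnit_iff_constantCoeff.1 h
      rw [map_sub, MvPowerSeries.algebraMap_apply, Algebra.algebraMap_self, RingHom.id_apply,
        MvPowerSeries.constantCoeff_C, sub_self] at h2
      exact not_isUnit_zero h2 }

variable {𝔬 σ}

/-- The variables of the power series ring. -/
noncomputable def powerSeriesX (i : σ) : powerSeries 𝔬 σ := (MvPowerSeries.X i : MvPowerSeries σ 𝔬)

theorem powerSeriesX_mem (i : σ) :
    powerSeriesX i ∈ maximalIdeal (powerSeries 𝔬 σ).carrier := by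
  intro h
  have h2 := MvPowerSeries.isUnit_iff_constantCoeff.1 h
  rw [powerSeriesX, MvPowerSeries.constantCoeff_X] at h2
  exact not_isUnit_zero h2

theorem powerSeries_hom_ext {B : CompleteLocalAlg 𝔬} {f g : powerSeries 𝔬 σ ⟶ B}
    (h : ∀ i, ringHom f (powerSeriesX i) = ringHom g (powerSeriesX i)) : f = g := by
  let F : MvPowerSeries σ 𝔬 →ₐ[𝔬] B := f.toAlgHom
  let F' : MvPowerSeries σ 𝔬 →ₐ[𝔬] B := g.toAlgHom
  have h1 : (F : MvPowerSeries σ 𝔬 →+* B).comp MvPolynomial.coeToMvPowerSeries.ringHom =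
      (F' : MvPowerSeries σ 𝔬 →+* B).comp MvPolynomial.coeToMvPowerSeries.ringHom := by
    refine MvPolynomial.ringHom_ext (fun c => ?_) fun i => ?_
    · change F (MvPolynomial.C c : MvPolynomial σ 𝔬) = F' (MvPolynomial.C c : MvPolynomial σ 𝔬)
      rw [MvPolynomial.coe_C]
      exact (F.commutes c).trans (F'.commutes c).symm
    · change F (MvPolynomial.X i : MvPolynomial σ 𝔬) = F' (MvPolynomial.X i : MvPolynomial σ 𝔬)
      rw [MvPolynomial.coe_X]
      exact h i
  refine hom_ext fun φ => sub_eq_zero.1 (eq_zero_of_forall_mem_pow fun n => ?_)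
  obtain ⟨p, hp⟩ : ∃ p : MvPolynomial σ 𝔬, (show MvPowerSeries σ 𝔬 from φ) - p ∈
    maximalIdeal (MvPowerSeries σ 𝔬) ^ n := ⟨_, sub_truncTotal_mem_pow n φ⟩
  have h4 : F (_ - _) - F' (_ - _) ∈ maximalIdeal B.carrier ^ n :=
    sub_mem (ringHom_mem_pow f hp) (ringHom_mem_pow g hp)
  have h3 : F p = F' p := RingHom.congr_fun h1 p
  rwa [map_sub, map_sub, h3, sub_sub_sub_cancel_right] at h4

/-- Power series can be evaluated at elements of the maximal ideal. -/
theorem exists_powerSeries_hom {B : CompleteLocalAlg 𝔬} (b : σ → B)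
    (hb : ∀ i, b i ∈ maximalIdeal B.carrier) :
    ∃ f : powerSeries 𝔬 σ ⟶ B, ∀ i, ringHom f (powerSeriesX i) = b i := by
  have h1 : ∀ n, ∀ p ∈ MvPolynomial.idealOfVars σ 𝔬 ^ n,
      MvPolynomial.aeval b p ∈ maximalIdeal B.carrier ^ n := by
    intro n p hp
    have h2 : (MvPolynomial.idealOfVars σ 𝔬).map (MvPolynomial.aeval (R := 𝔬) b) ≤
        maximalIdeal B.carrier := by
      rw [MvPolynomial.idealOfVars, Ideal.map_span, Ideal.span_le]
      rintro _ ⟨_, ⟨i, rfl⟩, rfl⟩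
      simpa using hb i
    have h3 := Ideal.mem_map_of_mem (MvPolynomial.aeval (R := 𝔬) b) hp
    rw [Ideal.map_pow] at h3
    exact Ideal.pow_right_mono h2 n h3
  let L : ∀ n, MvPolynomial σ 𝔬 ⧸ MvPolynomial.idealOfVars σ 𝔬 ^ n →ₐ[𝔬]
      B ⧸ maximalIdeal B.carrier ^ n := fun n =>
    Ideal.Quotient.liftₐ (MvPolynomial.idealOfVars σ 𝔬 ^ n)
      ((Ideal.Quotient.mkₐ 𝔬 (maximalIdeal B.carrier ^ n)).comp (MvPolynomial.aeval b))
        fun p hp => Ideal.Quotient.eq_zero_iff_mem.2 (h1 n p hp)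
  let F : ∀ n, MvPowerSeries σ 𝔬 →ₐ[𝔬] B ⧸ maximalIdeal B.carrier ^ n := fun n =>
    (L n).comp ((MvPowerSeries.truncTotalAlgHom σ 𝔬 n).restrictScalars 𝔬)
  have hF : ∀ n φ, F n φ = Ideal.Quotient.mk _ (MvPolynomial.aeval b (MvPowerSeries.truncTotal n φ)) :=
    fun n φ => rfl
  have hcompat : ∀ {m n : ℕ} (hmn : m ≤ n),
      (Ideal.Quotient.factorₐ 𝔬 (Ideal.pow_le_pow_right hmn)).comp (F n) = F m := by
    intro m n hmn
    refine AlgHom.ext fun φ => ?_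
    rw [AlgHom.comp_apply, hF, hF]
    refine (Ideal.Quotient.mk_eq_mk_iff_sub_mem _ _).2 ?_
    rw [← map_sub]
    exact h1 m _ (MvPowerSeries.truncTotal_sub_truncTotal_mem_pow_idealOfVars hmn le_rfl φ)
  let f : MvPowerSeries σ 𝔬 →ₐ[𝔬] B :=
    IsAdicComplete.liftAlgHom (maximalIdeal B.carrier) F hcompat
  refine ⟨ofAlgHom (A := powerSeries 𝔬 σ) f, fun i => sub_eq_zero.1
    (eq_zero_of_forall_mem_pow fun n => ?_)⟩
  rw [← Ideal.Quotient.mk_eq_mk_iff_sub_mem]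
  have h2 : Ideal.Quotient.mk (maximalIdeal B.carrier ^ n) (f (MvPowerSeries.X i)) =
    F n (MvPowerSeries.X i) := 
    IsAdicComplete.mk_liftAlgHom (maximalIdeal B.carrier) F hcompat n _
  refine h2.trans ?_
  have h3 : MvPowerSeries.truncTotalAlgHom σ 𝔬 n (MvPowerSeries.X i) =
      Ideal.Quotient.mk _ (MvPolynomial.X i) := by
    rw [← MvPolynomial.coe_X]
    exact AlgHom.commutes (MvPowerSeries.truncTotalAlgHom σ 𝔬 n) (MvPolynomial.X i)
  change L n (MvPowerSeries.truncTotalAlgHom σ 𝔬 n (MvPowerSeries.X i)) = _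
  rw [h3]
  change Ideal.Quotient.mk _ (MvPolynomial.aeval b (MvPolynomial.X i)) = _
  rw [MvPolynomial.aeval_X]

end CompleteLocalAlg

/-! ### The universal framed lift -/

open CompleteLocalAlg

section Universal

set_option linter.unusedSectionVars false

variable {𝔬 : Type w} [CommRing 𝔬] [IsLocalRing 𝔬] {G : Type v} [Group G] [TopologicalSpace G]
  {d : ℕ} {P : DeformationCondition 𝔬 G d} {ρbar : G →* Matrix (Fin d) (Fin d) (ResidueField 𝔬)}
  [Finite (ResidueField 𝔬)] {σ : Type t} {γ : σ → G} {Λ : CompleteLocalAlg 𝔬}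
  {c : σ → Matrix (Fin d) (Fin d) Λ}

/-- The open ideals `I` of `Λ` for which `ρbar` has a lift over `Λ ⧸ I` satisfying the condition `P`
whose values at the group elements `γ l` are the images of the given matrices `c l`. -/
def DeformationCondition.liftIdeals (P : DeformationCondition 𝔬 G d)
    (ρbar : G →* Matrix (Fin d) (Fin d) (ResidueField 𝔬)) (γ : σ → G)
    (c : σ → Matrix (Fin d) (Fin d) Λ) : Set (Ideal Λ) :=
  {I | ∃ hI : I ≤ maximalIdeal Λ.carrier, (∃ n, maximalIdeal Λ.carrier ^ n ≤ I) ∧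
    ∃ r : G →* Matrix (Fin d) (Fin d) (Λ ⧸ I), P.Holds r ∧
      mapRep (quotResidue I hI : Λ ⧸ I →+* ResidueField 𝔬) r = ρbar ∧
      ∀ l i j, r (γ l) i j = Ideal.Quotient.mk I (c l i j)}

/-- A lift over `E` whose entries at the family `γ` come from `Λ` descends to the image of `Λ` in
`E`. -/
theorem DeformationCondition.Separates.ker_mem_liftIdeals (hγ : P.Separates γ) {E : Type w}
    [CommRing E] [Algebra 𝔬 E] [Finite E] (f : Λ →ₐ[𝔬] E) {π : E →ₐ[𝔬] ResidueField 𝔬}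
    (hπ : ∀ x, π x = 0 → IsNilpotent x) {r : G →* Matrix (Fin d) (Fin d) E} (hr : P.Holds r)
    (hred : mapRep (π : E →+* ResidueField 𝔬) r = ρbar)
    (h : ∀ l i j, r (γ l) i j = f (c l i j)) : RingHom.ker f ∈ P.liftIdeals ρbar γ c := by
  have hπf : ∀ a, π (f a) = Λ.toResidue a := fun a =>
    AlgHom.congr_fun (algHom_eq_toResidue (π.comp f)) a
  have hI : RingHom.ker f ≤ maximalIdeal Λ.carrier := fun a ha => by
    rw [← toResidue_eq_zero_iff, ← hπf, (RingHom.mem_ker).1 ha, map_zero]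
  refine ⟨hI, ?_, ?_⟩
  · obtain ⟨n, hn⟩ : IsNilpotent (RingHom.ker π) :=
      (Ideal.FG.isNilpotent_iff_le_nilradical (IsNoetherian.noetherian _)).2 fun x hx => hπ x hx
    have h1 : (maximalIdeal Λ.carrier).map f ≤ RingHom.ker π := Ideal.map_le_iff_le_comap.2
      fun a ha => by
        rw [Ideal.mem_comap, RingHom.mem_ker, hπf]
        exact toResidue_eq_zero_iff.2 ha
    refine ⟨n, fun a ha => ?_⟩
    have h2 := Ideal.pow_right_mono h1 n (Ideal.map_pow f _ n ▸ Ideal.mem_map_of_mem f ha)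
    rw [hn] at h2
    exact h2
  · obtain ⟨r', hr', he⟩ := hγ.exists_rep_quotient_ker hπ f hr fun l i j => ⟨_, (h l i j).symm⟩
    refine ⟨r', hr', MonoidHom.ext fun g => Matrix.ext fun i j => ?_, fun l i j => ?_⟩
    · rw [← hred]
      change quotResidue _ hI (r' g i j) = π (r g i j)
      rw [← he]
      obtain ⟨a, ha⟩ := Ideal.Quotient.mk_surjective (r' g i j)
      rw [← ha]
      exact (hπf a).symm
    · refine Ideal.kerLiftAlg_injective f ?_
      rw [he, h]
      rfl

/-- The lifts over `Λ ⧸ I` and `Λ ⧸ I'` together give one over the fibre product over the residue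
field, which contains `Λ ⧸ (I ⊓ I')`. -/
theorem DeformationCondition.Separates.inf_mem_liftIdeals (hγ : P.Separates γ) {I I' : Ideal Λ}
    (h : I ∈ P.liftIdeals ρbar γ c) (h' : I' ∈ P.liftIdeals ρbar γ c) :
    I ⊓ I' ∈ P.liftIdeals ρbar γ c := by
  obtain ⟨hI, ⟨n, hn⟩, r, hr, hred, hrc⟩ := h
  obtain ⟨hI', ⟨n', hn'⟩, r', hr', hred', hrc'⟩ := h'
  have := finite_quotient hn
  have := finite_quotient hn'
  obtain ⟨s, hs, hsr⟩ := P.exists_rep_equalizer hr hr' (hred.trans hred'.symm)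
  let E := AlgHom.equalizer ((quotResidue I hI).comp (AlgHom.fst 𝔬 (Λ ⧸ I) (Λ ⧸ I')))
    ((quotResidue I' hI').comp (AlgHom.snd 𝔬 (Λ ⧸ I) (Λ ⧸ I')))
  let f : Λ →ₐ[𝔬] E := AlgHom.codRestrict
    ((Ideal.Quotient.mkₐ 𝔬 I).prod (Ideal.Quotient.mkₐ 𝔬 I')) E fun a => rfl
  have hker : RingHom.ker f = I ⊓ I' := by
    ext a
    rw [RingHom.mem_ker, Submodule.mem_inf, ← Ideal.Quotient.eq_zero_iff_mem,
      ← Ideal.Quotient.eq_zero_iff_mem]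
    exact ⟨fun h => ⟨congrArg (fun x : E => x.1.1) h, congrArg (fun x : E => x.1.2) h⟩,
      fun h => Subtype.ext (Prod.ext h.1 h.2)⟩
  rw [← hker]
  refine hγ.ker_mem_liftIdeals f
    (π := ((quotResidue I hI).comp (AlgHom.fst 𝔬 (Λ ⧸ I) (Λ ⧸ I'))).comp E.val)
    (fun x hx => isNilpotent_of_mem_equalizer (isNilpotent_of_quotResidue_eq_zero hn)
      (isNilpotent_of_quotResidue_eq_zero hn') x hx) hs ?_ fun l i j => Subtype.ext ?_
  · rw [← hred]
    refine MonoidHom.ext fun g => Matrix.ext fun i j => ?_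
    change quotResidue I hI (s g i j).1.1 = quotResidue I hI (r g i j)
    rw [hsr]
  · rw [hsr, hrc, hrc']
    rfl

/-- The lifts over the quotients of `Λ` by two of these ideals are compatible. -/
theorem DeformationCondition.Separates.mapRep_eq (hγ : P.Separates γ) {I I' : Ideal Λ} (hII : I ≤ I')
    {n : ℕ} (hn : maximalIdeal Λ.carrier ^ n ≤ I) (hI : I' ≤ maximalIdeal Λ.carrier)
    {r : G →* Matrix (Fin d) (Fin d) (Λ ⧸ I)} {r' : G →* Matrix (Fin d) (Fin d) (Λ ⧸ I')}
    (hr : P.Holds r) (hr' : P.Holds r')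
    (hred : mapRep (quotResidue I (hII.trans hI) : Λ ⧸ I →+* ResidueField 𝔬) r = ρbar)
    (hred' : mapRep (quotResidue I' hI : Λ ⧸ I' →+* ResidueField 𝔬) r' = ρbar)
    (h : ∀ l i j, Ideal.Quotient.factor hII (r (γ l) i j) = r' (γ l) i j) :
    mapRep (Ideal.Quotient.factor hII) r = r' := by
  have := finite_quotient hn
  have := finite_quotient (hn.trans hII)
  have h1 : P.Holds (mapRep (Ideal.Quotient.factor hII) r) :=
    P.map (Ideal.Quotient.factorₐ 𝔬 hII) hr
  refine hγ.rep_ext (isNilpotent_of_quotResidue_eq_zero (hI := hI) (hn.trans hII)) h1 hr' ?_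
    fun l => Matrix.ext fun i j => h l i j
  rw [hred', ← hred]
  refine MonoidHom.ext fun g => Matrix.ext fun i j => ?_
  change quotResidue _ hI (Ideal.Quotient.factor hII (r g i j)) = quotResidue _ (hII.trans hI) (r g i j)
  obtain ⟨a, ha⟩ := Ideal.Quotient.mk_surjective (r g i j)
  rw [← ha]
  rfl

/-- If `Λ` with the matrices `c l` is universal for families of lifts of the matrices
`ρbar (γ l)`, then a quotient of it carries the universal lift of `ρbar`. -/
theorem DeformationCondition.Separates.exists_universal_of (hγ : P.Separates γ)
    (hbar : P.Holds ρbar) (hc : ∀ l i j, Λ.toResidue (c l i j) = ρbar (γ l) i j)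
    (hhom : ∀ (B : CompleteLocalAlg 𝔬) (b : σ → Matrix (Fin d) (Fin d) B),
      (∀ l i j, B.toResidue (b l i j) = ρbar (γ l) i j) →
        ∃ f : Λ ⟶ B, ∀ l i j, ringHom f (c l i j) = b l i j)
    (hext : ∀ (B : CompleteLocalAlg 𝔬) (f f' : Λ ⟶ B),
      (∀ l i j, ringHom f (c l i j) = ringHom f' (c l i j)) → f = f') :
    ∃ (R : CompleteLocalAlg 𝔬) (ρ : G →* Matrix (Fin d) (Fin d) R), P.IsLift ρbar R ρ ∧
      ∀ (B : CompleteLocalAlg 𝔬) (ρ' : G →* Matrix (Fin d) (Fin d) B), P.IsLift ρbar B ρ' →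
        ∃! f : R ⟶ B, mapRep (ringHom f) ρ = ρ' := by
  have hm : RingHom.ker Λ.toResidue ∈ P.liftIdeals ρbar γ c :=
    hγ.ker_mem_liftIdeals Λ.toResidue (π := AlgHom.id 𝔬 (ResidueField 𝔬))
      (fun x hx => ⟨1, by rw [pow_one]; exact hx⟩) hbar rfl fun l i j => (hc l i j).symm
  have hJ : sInf (P.liftIdeals ρbar γ c) ≤ maximalIdeal Λ.carrier := (sInf_le hm).trans hm.1
  let R := Λ.quot _ hJ
  let q : Λ ⟶ R := quotMk hJ
  -- the lifts modulo the powers of the maximal ideal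
  have h1 : ∀ n, ∃ r : G →* Matrix (Fin d) (Fin d) (R ⧸ maximalIdeal R.carrier ^ n), P.Holds r ∧
      (∀ hn : maximalIdeal R.carrier ^ n ≤ maximalIdeal R.carrier,
        mapRep (quotResidue _ hn : R ⧸ maximalIdeal R.carrier ^ n →+* ResidueField 𝔬) r = ρbar) ∧
      ∀ l i j, r (γ l) i j = Ideal.Quotient.mk _ (ringHom q (c l i j)) := by
    intro n
    obtain ⟨I, ⟨hI, ⟨m, hmI⟩, r, hr, hred, hrc⟩, hIJ⟩ := exists_mem_le_sInf_sup_pow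
      (P.liftIdeals ρbar γ c) ⟨_, hm⟩ (fun _ h _ h' => hγ.inf_mem_liftIdeals h h')
      (fun _ h => h.2.1) n
    have := finite_quotient hmI
    let e : Λ ⧸ I →ₐ[𝔬] R ⧸ maximalIdeal R.carrier ^ n := Ideal.Quotient.liftₐ I
      ((Ideal.Quotient.mkₐ 𝔬 (maximalIdeal R.carrier ^ n)).comp q.toAlgHom)
      fun a ha => Ideal.Quotient.eq_zero_iff_mem.2 ((mem_sup_pow_iff hJ).1 (hIJ ha))
    refine ⟨mapRep (e : Λ ⧸ I →+* R ⧸ maximalIdeal R.carrier ^ n) r, P.map e hr, fun hn => ?_,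
      fun l i j => ?_⟩
    · rw [← hred]
      refine MonoidHom.ext fun g => Matrix.ext fun i j => ?_
      change quotResidue _ hn (e (r g i j)) = quotResidue I hI (r g i j)
      obtain ⟨a, ha⟩ := Ideal.Quotient.mk_surjective (r g i j)
      rw [← ha]
      exact toResidue_ringHom q a
    · change e (r (γ l) i j) = _
      rw [hrc]
      rfl
  choose r hr hred hrc using h1
  obtain ⟨ρ, hρ⟩ := exists_rep_of_compatible r fun n => by
    rcases n with _ | n
    · have : Subsingleton (R ⧸ maximalIdeal R.carrier ^ 0) :=
        Ideal.Quotient.subsingleton_iff.2 (by rw [pow_zero, Ideal.one_eq_top])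
      exact MonoidHom.ext fun g => Matrix.ext fun i j => Subsingleton.elim _ _
    · have hn : maximalIdeal R.carrier ^ (n + 1) ≤ maximalIdeal R.carrier :=
        Ideal.pow_le_self n.succ_ne_zero
      have hn' : maximalIdeal R.carrier ^ (n + 1 + 1) ≤ maximalIdeal R.carrier :=
        Ideal.pow_le_self (n + 1).succ_ne_zero
      refine hγ.mapRep_eq (I := maximalIdeal R.carrier ^ (n + 1 + 1))
        (I' := maximalIdeal R.carrier ^ (n + 1)) (Ideal.pow_le_pow_right (Nat.le_succ (n + 1)))
        le_rfl hn (hr _) (hr _) (hred _ hn') (hred _ hn) fun l i j => ?_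
      rw [hrc, hrc]
      rfl
  have hn : maximalIdeal R.carrier ^ 1 ≤ maximalIdeal R.carrier := (pow_one _).le
  have hlift : P.IsLift ρbar R ρ := by
    refine ⟨?_, fun n => (hρ n).symm ▸ hr n⟩
    rw [← hred 1 hn, ← hρ 1]
    rfl
  have hval : ∀ l i j, ρ (γ l) i j = ringHom q (c l i j) := fun l i j =>
    sub_eq_zero.1 (eq_zero_of_forall_mem_pow fun n => by
      rw [← Ideal.Quotient.mk_eq_mk_iff_sub_mem]
      have h2 := congrFun (congrFun (DFunLike.congr_fun (hρ n) (γ l)) i) j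
      exact h2.trans (hrc n l i j))
  refine ⟨R, ρ, hlift, fun B ρ' hρ' => ?_⟩
  have hred' : ∀ g i j, B.toResidue (ρ' g i j) = ρbar g i j := fun g i j =>
    congrFun (congrFun (DFunLike.congr_fun hρ'.red g) i) j
  obtain ⟨f, hf⟩ := hhom B (fun l => ρ' (γ l)) fun l i j => hred' _ i j
  have hfJ : ∀ a ∈ sInf (P.liftIdeals ρbar γ c), ringHom f a = 0 := fun a ha =>
    eq_zero_of_forall_mem_pow fun n => Ideal.pow_le_pow_right (Nat.le_succ n) (by
      have h2 := hγ.ker_mem_liftIdeals (c := c)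
        ((Ideal.Quotient.mkₐ 𝔬 (maximalIdeal B.carrier ^ (n + 1))).comp f.toAlgHom)
        (π := quotResidue _ (Ideal.pow_le_self n.succ_ne_zero))
        (isNilpotent_of_quotResidue_eq_zero le_rfl) (hρ'.holds (n + 1)) hρ'.red
        fun l i j => congrArg (Ideal.Quotient.mk _) (hf l i j).symm
      exact Ideal.Quotient.eq_zero_iff_mem.1 (sInf_le h2 ha))
  have hqf : ∀ a, ringHom (quotLift hJ f hfJ) (ringHom q a) = ringHom f a := fun a => rfl
  refine ⟨quotLift hJ f hfJ, ?_, fun f' hf' => ?_⟩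
  · refine (hlift.map _).ext hγ hρ' fun l => Matrix.ext fun i j => ?_
    rw [mapRep_apply, hval, hqf, hf]
  · have h2 : q ≫ f' = f := hext B _ _ fun l i j => by
      rw [hf, ← hf', mapRep_apply, hval]
      rfl
    refine hom_ext fun a => ?_
    obtain ⟨a, rfl⟩ := quotMk_surjective hJ a
    rw [hqf, ← h2]
    rfl

/-- The universal lift of `ρbar` satisfying the condition `P`. -/
theorem DeformationCondition.exists_universal [IsNoetherianRing 𝔬]
    [IsAdicComplete (maximalIdeal 𝔬) 𝔬] (hbar : P.Holds ρbar) :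
    ∃ (R : CompleteLocalAlg 𝔬) (ρ : G →* Matrix (Fin d) (Fin d) R), P.IsLift ρbar R ρ ∧
      ∀ (B : CompleteLocalAlg 𝔬) (ρ' : G →* Matrix (Fin d) (Fin d) B), P.IsLift ρbar B ρ' →
        ∃! f : R ⟶ B, mapRep (ringHom f) ρ = ρ' := by
  obtain ⟨s, γ, hγ⟩ := P.exists_separates
  choose c hc using fun l i j => IsLocalRing.residue_surjective (ρbar (γ l) i j)
  have hres : ∀ (B : CompleteLocalAlg 𝔬) l i j,
      B.toResidue (algebraMap 𝔬 B (c l i j)) = ρbar (γ l) i j := fun B l i j =>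
    (B.toResidue.commutes _).trans (hc l i j)
  let Λ := powerSeries 𝔬 (Fin s × Fin d × Fin d)
  refine hγ.exists_universal_of (Λ := Λ)
    (c := fun l => Matrix.of fun i j => algebraMap 𝔬 Λ (c l i j) + powerSeriesX (l, i, j)) hbar
    (fun l i j => ?_) (fun B b hb => ?_) fun B f f' h => powerSeries_hom_ext fun x => ?_
  · rw [Matrix.of_apply, map_add, hres, toResidue_eq_zero_iff.2 (powerSeriesX_mem _), add_zero]
  · obtain ⟨f, hf⟩ := exists_powerSeries_hom (B := B)
      (fun x : Fin s × Fin d × Fin d => b x.1 x.2.1 x.2.2 - algebraMap 𝔬 B (c x.1 x.2.1 x.2.2))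
      fun x => by
        rw [← toResidue_eq_zero_iff, map_sub, hb, hres, sub_self]
    refine ⟨f, fun l i j => ?_⟩
    rw [Matrix.of_apply, map_add, ringHom_algebraMap, hf, add_sub_cancel]
  · have h1 := h x.1 x.2.1 x.2.2
    rw [Matrix.of_apply, map_add, map_add, ringHom_algebraMap, ringHom_algebraMap] at h1
    exact add_left_cancel h1

end Universal

/-! ### Slices for the conjugation action -/

section MatrixEntries

variable {d : ℕ} {A : Type w} [CommRing A]

theorem mul_apply_mem_mul {I I' : Ideal A} {M N : Matrix (Fin d) (Fin d) A}
    (hM : ∀ a b, M a b ∈ I) (hN : ∀ a b, N a b ∈ I') (a b : Fin d) : (M * N) a b ∈ I * I' := by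
  rw [Matrix.mul_apply]
  exact sum_mem fun i _ => Ideal.mul_mem_mul (hM a i) (hN i b)

theorem mul_apply_mem_left {I : Ideal A} {M : Matrix (Fin d) (Fin d) A} (hM : ∀ a b, M a b ∈ I)
    (N : Matrix (Fin d) (Fin d) A) (a b : Fin d) : (M * N) a b ∈ I := by
  rw [Matrix.mul_apply]
  exact sum_mem fun i _ => Ideal.mul_mem_right _ _ (hM a i)

theorem mul_apply_mem_right {I : Ideal A} (M : Matrix (Fin d) (Fin d) A)
    {N : Matrix (Fin d) (Fin d) A} (hN : ∀ a b, N a b ∈ I) (a b : Fin d) : (M * N) a b ∈ I := by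
  rw [Matrix.mul_apply]
  exact sum_mem fun i _ => Ideal.mul_mem_left _ _ (hN i b)

/-- The linear form `Z ↦ (Z M - M Z) a b` on matrices. -/
def commEntry (M : Matrix (Fin d) (Fin d) A) (a b : Fin d) : Matrix (Fin d) (Fin d) A →ₗ[A] A where
  toFun Z := (Z * M - M * Z) a b
  map_add' Z Z' := by simp only [add_mul, mul_add, Matrix.sub_apply, Matrix.add_apply]; ring
  map_smul' c Z := by
    simp only [Matrix.smul_mul, Matrix.mul_smul, Matrix.sub_apply, Matrix.smul_apply, smul_eq_mul,
      RingHom.id_apply]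
    ring

theorem commEntry_apply (M : Matrix (Fin d) (Fin d) A) (a b : Fin d) (Z : Matrix (Fin d) (Fin d) A) :
    commEntry M a b Z = (Z * M - M * Z) a b := rfl

theorem map_commEntry {B : Type t} [CommRing B] (f : A →+* B) (M : Matrix (Fin d) (Fin d) A)
    (a b : Fin d) (Z : Matrix (Fin d) (Fin d) A) :
    f (commEntry M a b Z) = commEntry (f.mapMatrix M) a b (f.mapMatrix Z) := by
  rw [commEntry_apply, commEntry_apply, ← map_mul, ← map_mul, ← map_sub]
  rfl

/-- A linear form on matrices with values in `J` maps matrices with entries in `I` to `I * J`. -/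
theorem linearForm_mem_mul {I J : Ideal A} (f : Matrix (Fin d) (Fin d) A →ₗ[A] A)
    (hf : ∀ Z, f Z ∈ J) {Z : Matrix (Fin d) (Fin d) A} (hZ : ∀ a b, Z a b ∈ I) : f Z ∈ I * J := by
  rw [Matrix.matrix_eq_sum_single Z, map_sum]
  refine sum_mem fun a _ => ?_
  rw [map_sum]
  refine sum_mem fun b _ => ?_
  have h1 : Matrix.single a b (Z a b) = Z a b • Matrix.single a b (1 : A) := by
    rw [Matrix.smul_single, smul_eq_mul, mul_one]
  rw [h1, map_smul, smul_eq_mul]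
  exact Ideal.mul_mem_mul (hZ a b) (hf _)

/-- The conjugate of a representation. -/
def conjRep {G : Type v} [Group G] (U : (Matrix (Fin d) (Fin d) A)ˣ)
    (ρ : G →* Matrix (Fin d) (Fin d) A) : G →* Matrix (Fin d) (Fin d) A where
  toFun g := U * ρ g * (U⁻¹ : (Matrix (Fin d) (Fin d) A)ˣ)
  map_one' := by rw [map_one, mul_one, Units.mul_inv]
  map_mul' g g' := by
    rw [map_mul, Matrix.mul_assoc, Matrix.mul_assoc, Matrix.mul_assoc, Matrix.mul_assoc,
      Matrix.mul_assoc, Units.inv_mul_cancel_left]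

variable {G : Type v} [Group G]

theorem conjRep_apply (U : (Matrix (Fin d) (Fin d) A)ˣ) (ρ : G →* Matrix (Fin d) (Fin d) A) (g : G) :
    conjRep U ρ g = U * ρ g * (U⁻¹ : (Matrix (Fin d) (Fin d) A)ˣ) := rfl

theorem conjRep_mul_unit (U : (Matrix (Fin d) (Fin d) A)ˣ) (ρ : G →* Matrix (Fin d) (Fin d) A)
    (g : G) : conjRep U ρ g * U = U * ρ g := Units.inv_mul_cancel_right _ _

theorem conjRep_mul (U U' : (Matrix (Fin d) (Fin d) A)ˣ) (ρ : G →* Matrix (Fin d) (Fin d) A) :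
    conjRep (U * U') ρ = conjRep U (conjRep U' ρ) := MonoidHom.ext fun g => by
  simp only [conjRep_apply, mul_inv_rev, Units.val_mul, Matrix.mul_assoc]

theorem conjRep_one (ρ : G →* Matrix (Fin d) (Fin d) A) : conjRep 1 ρ = ρ :=
  MonoidHom.ext fun g => by simp [conjRep_apply]

theorem mapRep_conjRep {B : Type t} [CommRing B] (f : A →+* B) (U : (Matrix (Fin d) (Fin d) A)ˣ)
    (ρ : G →* Matrix (Fin d) (Fin d) A) :
    mapRep f (conjRep U ρ) = conjRep (Units.map (f.mapMatrix : _ →+* _).toMonoidHom U) (mapRep f ρ) :=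
  MonoidHom.ext fun g => by
    change f.mapMatrix ((U : Matrix (Fin d) (Fin d) A) * ρ g *
      ((U⁻¹ : (Matrix (Fin d) (Fin d) A)ˣ) : Matrix (Fin d) (Fin d) A)) = _
    rw [map_mul, map_mul]
    rfl

end MatrixEntries

section SliceForConjugation

variable {𝔬 : Type w} [CommRing 𝔬] [IsLocalRing 𝔬] {G : Type v} [Group G] {d : ℕ}

theorem mapMatrix_toResidue_eq_one_iff {A : CompleteLocalAlg 𝔬} {M : Matrix (Fin d) (Fin d) A} :
    (A.toResidue : A →+* ResidueField 𝔬).mapMatrix M = 1 ↔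
      ∀ a b, (M - 1) a b ∈ maximalIdeal A.carrier := by
  rw [← sub_eq_zero, ← map_one (A.toResidue : A →+* ResidueField 𝔬).mapMatrix, ← map_sub]
  constructor
  · intro h a b
    rw [← toResidue_eq_zero_iff]
    exact congrFun (congrFun h a) b
  · intro h
    ext a b
    exact toResidue_eq_zero_iff.2 (h a b)

theorem isUnit_of_sub_one_mem {A : CompleteLocalAlg 𝔬} {M : Matrix (Fin d) (Fin d) A}
    (h : ∀ a b, (M - 1) a b ∈ maximalIdeal A.carrier) : IsUnit M := by
  rw [Matrix.isUnit_iff_isUnit_det]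
  by_contra hdet
  have h1 : A.toResidue M.det = 0 := toResidue_eq_zero_iff.2 hdet
  have h2 := RingHom.map_det (A.toResidue : A →+* ResidueField 𝔬) M
  rw [mapMatrix_toResidue_eq_one_iff.2 h, Matrix.det_one] at h2
  exact one_ne_zero (h2.symm.trans h1)

theorem toResidue_commEntry {A : CompleteLocalAlg 𝔬} {ρ : G →* Matrix (Fin d) (Fin d) A}
    {ρbar : G →* Matrix (Fin d) (Fin d) (ResidueField 𝔬)}
    (hρ : mapRep (A.toResidue : A →+* ResidueField 𝔬) ρ = ρbar) (g : G) (a b : Fin d)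
    (Z : Matrix (Fin d) (Fin d) A) :
    A.toResidue (commEntry (ρ g) a b Z) =
      commEntry (ρbar g) a b ((A.toResidue : A →+* ResidueField 𝔬).mapMatrix Z) := by
  subst hρ
  exact map_commEntry (A.toResidue : A →+* ResidueField 𝔬) _ _ _ _

/-- A slice of the conjugation action at `ρbar`: finitely many matrix coefficients of representations
whose differentials along the orbit of `ρbar` are linearly independent (as witnessed by the matrices
`dual l`) and determine the tangent vector to the orbit, with lifts `value l` of their values at
`ρbar`. -/
structure Slice (ρbar : G →* Matrix (Fin d) (Fin d) (ResidueField 𝔬)) where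
  size : ℕ
  elt : Fin size → G
  row : Fin size → Fin d
  col : Fin size → Fin d
  dual : Fin size → Matrix (Fin d) (Fin d) (ResidueField 𝔬)
  value : Fin size → 𝔬
  commEntry_dual : ∀ l m, commEntry (ρbar (elt l)) (row l) (col l) (dual m) = if l = m then 1 else 0
  comm_of_commEntry_eq_zero : ∀ Z : Matrix (Fin d) (Fin d) (ResidueField 𝔬),
    (∀ l, commEntry (ρbar (elt l)) (row l) (col l) Z = 0) → ∀ g, Z * ρbar g = ρbar g * Z
  residue_value : ∀ l, residue 𝔬 (value l) = ρbar (elt l) (row l) (col l)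

/-- The differentials of the matrix coefficients along the orbit span a subspace of the dual space
of all matrices; the coefficients whose differentials form a basis of it give a slice. -/
theorem exists_slice (ρbar : G →* Matrix (Fin d) (Fin d) (ResidueField 𝔬)) :
    Nonempty (Slice ρbar) := by
  classical
  let F := ResidueField 𝔬
  let V := Matrix (Fin d) (Fin d) F
  let β : G × Fin d × Fin d → Module.Dual F V := fun x => commEntry (ρbar x.1) x.2.1 x.2.2
  obtain ⟨s, hs, hspan, hli⟩ := exists_linearIndependent F (Set.range β)
  have hfin : Finite s := hli.finite
  have hli' : LinearIndepOn F id s := hli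
  let b := Module.Basis.extend hli'
  have hbs : ∀ x : s, b ⟨x.1, hli'.subset_extend _ x.2⟩ = x.1 := fun x =>
    Module.Basis.extend_apply_self _ _
  let e := (Finite.equivFin s).symm
  choose x hx using fun l => hs (e l).2
  choose c hc using fun l => IsLocalRing.residue_surjective (ρbar (x l).1 (x l).2.1 (x l).2.2)
  let S : s → V := fun y => (Module.evalEquiv F V).symm (b.coord ⟨y.1, hli'.subset_extend _ y.2⟩)
  have hS : ∀ (f : Module.Dual F V) (y : s), f (S y) = b.coord ⟨y.1, hli'.subset_extend _ y.2⟩ f :=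
    fun f y => Module.apply_evalEquiv_symm_apply _ _ _ _
  refine ⟨⟨Nat.card s, fun l => (x l).1, fun l => (x l).2.1, fun l => (x l).2.2, fun l => S (e l), c,
    fun l m => ?_, fun Z hZ g => ?_, hc⟩⟩
  · change β (x l) (S (e m)) = _
    rw [hS, hx, ← hbs (e l), Module.Basis.coord_apply, Module.Basis.repr_self, Finsupp.single_apply]
    simp only [Subtype.mk.injEq, ← Subtype.ext_iff, e.injective.eq_iff]
  · have h1 : Submodule.span F (Set.range β) ≤ LinearMap.ker (Module.Dual.eval F V Z) := by
      rw [← hspan, Submodule.span_le]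
      intro f hf
      have h2 := hZ (Finite.equivFin s ⟨f, hf⟩)
      change β (x _) Z = 0 at h2
      rw [hx] at h2
      have h3 : (e (Finite.equivFin s ⟨f, hf⟩)).1 = f := by rw [Equiv.symm_apply_apply]
      rwa [h3] at h2
    ext i j
    have h2 := h1 (Submodule.subset_span ⟨(g, i, j), rfl⟩)
    exact sub_eq_zero.1 h2

namespace Slice

variable {ρbar : G →* Matrix (Fin d) (Fin d) (ResidueField 𝔬)} (S : Slice ρbar)

/-- The deviation of a representation from the slice. -/
def err {A : CompleteLocalAlg 𝔬} (ρ : G →* Matrix (Fin d) (Fin d) A) (l : Fin S.size) : A :=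
  ρ (S.elt l) (S.row l) (S.col l) - algebraMap 𝔬 A (S.value l)

/-- A linear form on matrices that vanishes on the infinitesimal stabilizer of `ρbar` is a linear
combination of the differentials of the coordinates of the slice. -/
theorem apply_eq_sum (f : Matrix (Fin d) (Fin d) (ResidueField 𝔬) →ₗ[ResidueField 𝔬] ResidueField 𝔬)
    (hf : ∀ Z, (∀ g, Z * ρbar g = ρbar g * Z) → f Z = 0)
    (Z : Matrix (Fin d) (Fin d) (ResidueField 𝔬)) :
    f Z = ∑ l, f (S.dual l) * commEntry (ρbar (S.elt l)) (S.row l) (S.col l) Z := by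
  have h1 := hf (Z - ∑ l, commEntry (ρbar (S.elt l)) (S.row l) (S.col l) Z • S.dual l)
    (S.comm_of_commEntry_eq_zero _ fun m => by
      rw [map_sub, map_sum, sub_eq_zero, Finset.sum_eq_single m]
      · rw [map_smul, S.commEntry_dual, if_pos rfl, smul_eq_mul, mul_one]
      · intro l _ hl
        rw [map_smul, S.commEntry_dual, if_neg hl.symm, smul_zero]
      · exact fun h => absurd (Finset.mem_univ _) h)
  rw [map_sub, map_sum, sub_eq_zero] at h1
  rw [h1]
  exact Finset.sum_congr rfl fun l _ => by rw [map_smul, smul_eq_mul, mul_comm]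

variable {A : CompleteLocalAlg 𝔬} {ρ ρ' : G →* Matrix (Fin d) (Fin d) A}

/-- Transversality of the slice to the orbits: if the commutators of `ρ` with an infinitesimal matrix
`Z` are tangent to the slice, then they vanish to higher order, and so do all linear forms on `Z` that
vanish on the infinitesimal stabilizer of `ρbar`. -/
theorem linearForm_mem (hρ : mapRep (A.toResidue : A →+* ResidueField 𝔬) ρ = ρbar)
    {I : Ideal A} {Z : Matrix (Fin d) (Fin d) A} (hZ : ∀ a b, Z a b ∈ I)
    (hl : ∀ l, commEntry (ρ (S.elt l)) (S.row l) (S.col l) Z ∈ I * maximalIdeal A.carrier)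
    (f : Matrix (Fin d) (Fin d) A →ₗ[A] A)
    (fbar : Matrix (Fin d) (Fin d) (ResidueField 𝔬) →ₗ[ResidueField 𝔬] ResidueField 𝔬)
    (hf : ∀ Z, A.toResidue (f Z) = fbar ((A.toResidue : A →+* ResidueField 𝔬).mapMatrix Z))
    (hfbar : ∀ Z, (∀ g, Z * ρbar g = ρbar g * Z) → fbar Z = 0) :
    f Z ∈ I * maximalIdeal A.carrier := by
  choose c hc using fun l => IsLocalRing.residue_surjective (fbar (S.dual l))
  let f' : Matrix (Fin d) (Fin d) A →ₗ[A] A :=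
    f - ∑ l, algebraMap 𝔬 A (c l) • commEntry (ρ (S.elt l)) (S.row l) (S.col l)
  have hf'Z : ∀ Z, f' Z = f Z -
      ∑ l, algebraMap 𝔬 A (c l) * commEntry (ρ (S.elt l)) (S.row l) (S.col l) Z := fun Z => by
    simp only [f', LinearMap.sub_apply, LinearMap.sum_apply, LinearMap.smul_apply, smul_eq_mul]
  have h1 : f' Z ∈ I * maximalIdeal A.carrier := by
    refine linearForm_mem_mul f' (fun Z => ?_) hZ
    rw [← toResidue_eq_zero_iff, hf'Z, map_sub, hf, S.apply_eq_sum fbar hfbar, map_sum, sub_eq_zero]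
    refine Finset.sum_congr rfl fun l _ => ?_
    rw [map_mul, AlgHom.commutes, ← hc, toResidue_commEntry hρ]
    rfl
  rw [← sub_add_cancel (f Z) (∑ l, algebraMap 𝔬 A (c l) *
    commEntry (ρ (S.elt l)) (S.row l) (S.col l) Z), ← hf'Z]
  exact add_mem h1 (sum_mem fun l _ => Ideal.mul_mem_left _ _ (hl l))

/-- One step of the approximation of the point of the slice in an orbit. -/
theorem exists_conj_err_mem_mul (hρ : mapRep (A.toResidue : A →+* ResidueField 𝔬) ρ = ρbar)
    {I : Ideal A} (hI : I ≤ maximalIdeal A.carrier) (h : ∀ l, S.err ρ l ∈ I) :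
    ∃ U : (Matrix (Fin d) (Fin d) A)ˣ, (∀ a b, ((U : Matrix (Fin d) (Fin d) A) - 1) a b ∈ I) ∧
      ∀ l, S.err (conjRep U ρ) l ∈ I * maximalIdeal A.carrier := by
  choose s hs using fun l a b => IsLocalRing.residue_surjective (S.dual l a b)
  let T : Fin S.size → Matrix (Fin d) (Fin d) A := fun l => Matrix.of fun a b => algebraMap 𝔬 A (s l a b)
  have hT : ∀ l, (A.toResidue : A →+* ResidueField 𝔬).mapMatrix (T l) = S.dual l := fun l =>
    Matrix.ext fun a b => (A.toResidue.commutes _).trans (hs l a b)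
  let Y := ∑ l, S.err ρ l • T l
  have hY : ∀ a b, Y a b ∈ I := fun a b => by
    have h1 : Y a b = ∑ l, (S.err ρ l • T l) a b := Matrix.sum_apply a b _ _
    rw [h1]
    exact sum_mem fun l _ => Ideal.mul_mem_right _ _ (h l)
  have hYl : ∀ l, commEntry (ρ (S.elt l)) (S.row l) (S.col l) Y - S.err ρ l ∈
      I * maximalIdeal A.carrier := by
    intro l
    have h1 : ∑ m, S.err ρ m * (if l = m then 1 else 0) = S.err ρ l := by simp
    have h2 : commEntry (ρ (S.elt l)) (S.row l) (S.col l) Y =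
        ∑ m, S.err ρ m * commEntry (ρ (S.elt l)) (S.row l) (S.col l) (T m) := by
      rw [map_sum]
      exact Finset.sum_congr rfl fun m _ => by rw [map_smul, smul_eq_mul]
    rw [h2, ← h1, ← Finset.sum_sub_distrib]
    refine sum_mem fun m _ => ?_
    rw [← mul_sub]
    refine Ideal.mul_mem_mul (h m) ?_
    rw [← toResidue_eq_zero_iff, map_sub]
    rw [toResidue_commEntry hρ, hT, S.commEntry_dual]
    split_ifs <;> simp
  obtain ⟨U, hU⟩ : IsUnit (1 - Y) := isUnit_of_sub_one_mem fun a b => by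
    rw [sub_sub_cancel_left]
    exact neg_mem (hI (hY a b))
  refine ⟨U, fun a b => ?_, fun l => ?_⟩
  · rw [hU, sub_sub_cancel_left]
    exact neg_mem (hY a b)
  · have h1 : conjRep U ρ (S.elt l) * (1 - Y) = (1 - Y) * ρ (S.elt l) := by
      rw [← hU]
      exact conjRep_mul_unit U ρ _
    set M := ρ (S.elt l)
    set N := conjRep U ρ (S.elt l)
    -- `N = M - [Y, M] + (N - M) Y` and `N - M = N Y - Y M` has entries in `I`
    have h2 : N - M = N * Y - Y * M := by
      rw [mul_sub, sub_mul, mul_one, one_mul] at h1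
      have : N - M - (N * Y - Y * M) = (N - N * Y) - (M - Y * M) := by abel
      rw [← sub_eq_zero, this, h1, sub_self]
    have h3 : ∀ a b, (N - M) a b ∈ I := fun a b => by
      rw [h2, Matrix.sub_apply]
      exact sub_mem (mul_apply_mem_right _ hY a b) (mul_apply_mem_left hY _ a b)
    have h4 : N = M - (Y * M - M * Y) + (N - M) * Y := by
      rw [sub_mul, ← sub_eq_zero]
      have : N - (M - (Y * M - M * Y) + (N * Y - M * Y)) = (N - M) - (N * Y - Y * M) := by abel
      rw [this, h2, sub_self]
    have h5 : S.err (conjRep U ρ) l = ((N - M) * Y) (S.row l) (S.col l) -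
        (commEntry M (S.row l) (S.col l) Y - S.err ρ l) := by
      change N (S.row l) (S.col l) - _ = _ - (_ - (M (S.row l) (S.col l) - _))
      rw [commEntry_apply]
      have := congrFun (congrFun h4 (S.row l)) (S.col l)
      rw [this, Matrix.add_apply, Matrix.sub_apply]
      ring
    rw [h5]
    exact sub_mem (Ideal.mul_mono_right hI (mul_apply_mem_mul h3 hY _ _)) (hYl l)

theorem red_conjRep (hρ : mapRep (A.toResidue : A →+* ResidueField 𝔬) ρ = ρbar)
    {U : (Matrix (Fin d) (Fin d) A)ˣ}
    (hU : ∀ a b, ((U : Matrix (Fin d) (Fin d) A) - 1) a b ∈ maximalIdeal A.carrier) :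
    mapRep (A.toResidue : A →+* ResidueField 𝔬) (conjRep U ρ) = ρbar := by
  rw [mapRep_conjRep, hρ]
  have h1 : Units.map ((A.toResidue : A →+* ResidueField 𝔬).mapMatrix :
      Matrix (Fin d) (Fin d) A →+* _).toMonoidHom U = 1 :=
    Units.ext (mapMatrix_toResidue_eq_one_iff.2 hU)
  rw [h1, conjRep_one]

/-- Every representation is conjugate to one on the slice, by a matrix as close to the identity as the
representation is to the slice. -/
theorem exists_conj_err_eq_zero (hρ : mapRep (A.toResidue : A →+* ResidueField 𝔬) ρ = ρbar)
    {K : Ideal A} (hK : K ≤ maximalIdeal A.carrier) (h : ∀ l, S.err ρ l ∈ K) :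
    ∃ U : (Matrix (Fin d) (Fin d) A)ˣ, (∀ a b, ((U : Matrix (Fin d) (Fin d) A) - 1) a b ∈ K) ∧
      ∀ l, S.err (conjRep U ρ) l = 0 := by
  let Inv : ℕ → (Matrix (Fin d) (Fin d) A)ˣ → Prop := fun n U =>
    (∀ a b, ((U : Matrix (Fin d) (Fin d) A) - 1) a b ∈ K) ∧
      ∀ l, S.err (conjRep U ρ) l ∈ K * maximalIdeal A.carrier ^ n
  have h1 : ∀ n U, Inv n U → ∃ U', Inv (n + 1) U' ∧
      ∀ a b, ((U' : Matrix (Fin d) (Fin d) A) - U) a b ∈ maximalIdeal A.carrier ^ n := by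
    rintro n U ⟨hU, hUe⟩
    have hU' : ∀ a b, ((U : Matrix (Fin d) (Fin d) A) - 1) a b ∈ maximalIdeal A.carrier :=
      fun a b => hK (hU a b)
    have hI : K * maximalIdeal A.carrier ^ n ≤ maximalIdeal A.carrier := Ideal.mul_le_left.trans hK
    obtain ⟨X, hX, hXe⟩ := S.exists_conj_err_mem_mul (red_conjRep hρ hU') hI hUe
    have h2 : ((X * U : (Matrix (Fin d) (Fin d) A)ˣ) : Matrix (Fin d) (Fin d) A) - U =
        (X - 1) * U := by rw [sub_mul, one_mul, Units.val_mul]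
    have h3 : ∀ a b, (((X * U : (Matrix (Fin d) (Fin d) A)ˣ) : Matrix (Fin d) (Fin d) A) - U) a b ∈
        K * maximalIdeal A.carrier ^ n := fun a b => by
      rw [h2]
      exact mul_apply_mem_left hX _ a b
    refine ⟨X * U, ⟨fun a b => ?_, fun l => ?_⟩, fun a b => Ideal.mul_le_right (h3 a b)⟩
    · rw [← sub_add_sub_cancel _ (U : Matrix (Fin d) (Fin d) A), Matrix.add_apply]
      exact add_mem (Ideal.mul_le_left (h3 a b)) (hU a b)
    · rw [conjRep_mul, pow_succ, ← mul_assoc]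
      exact hXe l
  choose! s hs hs' using h1
  have h0 : Inv 0 1 := by
    refine ⟨fun a b => ?_, fun l => ?_⟩
    · rw [Units.val_one, sub_self]
      exact zero_mem K
    · rw [conjRep_one, pow_zero, mul_one]
      exact h l
  obtain ⟨X, hX, hX'⟩ : ∃ X : ℕ → (Matrix (Fin d) (Fin d) A)ˣ, (∀ n, Inv n (X n)) ∧
      ∀ n, X (n + 1) = s n (X n) := by
    refine ⟨fun n => Nat.rec 1 (fun i U => s i U) n, fun n => ?_, fun n => rfl⟩
    induction n with
    | zero => exact h0
    | succ n ih => exact hs n _ ih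
  obtain ⟨y, hy⟩ : ∃ y : Matrix (Fin d) (Fin d) A, ∀ a b n,
      y a b - (X n : Matrix (Fin d) (Fin d) A) a b ∈ maximalIdeal A.carrier ^ n := by
    choose y hy using fun a b => exists_limit (fun n => (X n : Matrix (Fin d) (Fin d) A) a b)
      fun n => by
        rw [hX']
        exact hs' n _ (hX n) a b
    exact ⟨y, hy⟩
  have hyK : ∀ a b, (y - 1) a b ∈ K := by
    intro a b
    refine mem_of_forall_mem_sup_pow fun n => ?_
    rw [← sub_add_sub_cancel y (X n : Matrix (Fin d) (Fin d) A) 1]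
    exact add_mem (Ideal.mem_sup_right (hy a b n)) (Ideal.mem_sup_left ((hX n).1 a b))
  obtain ⟨U, hU⟩ := isUnit_of_sub_one_mem fun a b => hK (hyK a b)
  refine ⟨U, fun a b => hU ▸ hyK a b, fun l => eq_zero_of_forall_mem_pow fun n => ?_⟩
  have h2 : Units.map ((Ideal.Quotient.mk (maximalIdeal A.carrier ^ n)).mapMatrix :
      Matrix (Fin d) (Fin d) A →+* _).toMonoidHom U =
      Units.map ((Ideal.Quotient.mk (maximalIdeal A.carrier ^ n)).mapMatrix :
        Matrix (Fin d) (Fin d) A →+* _).toMonoidHom (X n) := Units.ext (Matrix.ext fun a b => by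
    change Ideal.Quotient.mk _ ((U : Matrix (Fin d) (Fin d) A) a b) =
      Ideal.Quotient.mk _ ((X n : Matrix (Fin d) (Fin d) A) a b)
    rw [hU]
    exact (Ideal.Quotient.mk_eq_mk_iff_sub_mem _ _).2 (hy a b n))
  have h3 : mapRep (Ideal.Quotient.mk (maximalIdeal A.carrier ^ n)) (conjRep U ρ) =
      mapRep (Ideal.Quotient.mk (maximalIdeal A.carrier ^ n)) (conjRep (X n) ρ) := by
    rw [mapRep_conjRep, mapRep_conjRep, h2]
  have h4 : conjRep U ρ (S.elt l) (S.row l) (S.col l) - conjRep (X n) ρ (S.elt l) (S.row l) (S.col l) ∈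
      maximalIdeal A.carrier ^ n := (Ideal.Quotient.mk_eq_mk_iff_sub_mem _ _).1
    (congrFun (congrFun (DFunLike.congr_fun h3 (S.elt l)) (S.row l)) (S.col l))
  have h5 := add_mem h4 (Ideal.mul_le_right ((hX n).2 l))
  rwa [err, sub_add_sub_cancel] at h5

end Slice

end SliceForConjugation

/-! ### Lifts on a slice -/

section SliceLifts

set_option linter.unusedSectionVars false

variable {𝔬 : Type w} [CommRing 𝔬] [IsLocalRing 𝔬] {G : Type v} [Group G] {d : ℕ}
  {ρbar : G →* Matrix (Fin d) (Fin d) (ResidueField 𝔬)} (S : Slice ρbar) {A B : CompleteLocalAlg 𝔬}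

namespace Slice

theorem err_mapRep (f : A ⟶ B) (ρ : G →* Matrix (Fin d) (Fin d) A) (l : Fin S.size) :
    S.err (mapRep (ringHom f) ρ) l = ringHom f (S.err ρ l) := by
  rw [err, err, map_sub, ringHom_algebraMap]
  rfl

theorem err_mem {ρ : G →* Matrix (Fin d) (Fin d) A}
    (hρ : mapRep (A.toResidue : A →+* ResidueField 𝔬) ρ = ρbar) (l : Fin S.size) :
    S.err ρ l ∈ maximalIdeal A.carrier := by
  rw [← toResidue_eq_zero_iff, err, map_sub, AlgHom.commutes, sub_eq_zero]
  have h1 : A.toResidue (ρ (S.elt l) (S.row l) (S.col l)) = ρbar (S.elt l) (S.row l) (S.col l) :=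
    congrFun (congrFun (DFunLike.congr_fun hρ _) _) _
  exact h1.trans (S.residue_value l).symm

variable {ρ ρ' : G →* Matrix (Fin d) (Fin d) A}

/-- Two representations on the slice intertwined by `M` are closer to each other, and `M` is closer to
commuting with them, than `M` is to the identity. -/
theorem mem_mul_of_intertwining (hρ : mapRep (A.toResidue : A →+* ResidueField 𝔬) ρ = ρbar)
    (he : ∀ l, S.err ρ l = 0) (he' : ∀ l, S.err ρ' l = 0) {I : Ideal A}
    (hI : I ≤ maximalIdeal A.carrier) {M : Matrix (Fin d) (Fin d) A}
    (hM : ∀ g, ρ' g * M = M * ρ g) (hMI : ∀ a b, (M - 1) a b ∈ I) :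
    (∀ g a b, commEntry (ρ g) a b (M - 1) ∈ I * maximalIdeal A.carrier) ∧
      ∀ g a b, (ρ' g - ρ g) a b ∈ I * maximalIdeal A.carrier := by
  set Z := M - 1 with hZ
  have h1 : ∀ g, ρ' g - ρ g = Z * ρ g - ρ' g * Z := fun g => by
    rw [hZ, sub_mul, mul_sub, hM, one_mul, mul_one]
    abel
  have h2 : ∀ g, ρ' g - ρ g = (Z * ρ g - ρ g * Z) - (ρ' g - ρ g) * Z := fun g => by
    conv_lhs => rw [h1]
    rw [sub_mul (ρ' g) (ρ g) Z]
    abel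
  have h3 : ∀ g a b, (ρ' g - ρ g) a b ∈ I := fun g a b => by
    rw [h1, Matrix.sub_apply]
    exact sub_mem (mul_apply_mem_left hMI _ a b) (mul_apply_mem_right _ hMI a b)
  have h4 : ∀ g a b, ((ρ' g - ρ g) * Z) a b ∈ I * maximalIdeal A.carrier := fun g a b =>
    Ideal.mul_mono_right hI (mul_apply_mem_mul (h3 g) hMI a b)
  have h5 : ∀ g a b, (ρ' g - ρ g) a b + ((ρ' g - ρ g) * Z) a b = commEntry (ρ g) a b Z :=
    fun g a b => by
      have := congrFun (congrFun (h2 g) a) b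
      rw [this, Matrix.sub_apply, sub_add_cancel]
      rfl
  have h6 : ∀ g a b, commEntry (ρ g) a b Z ∈ I * maximalIdeal A.carrier := by
    intro g a b
    refine S.linearForm_mem hρ hMI (fun l => ?_) _ (commEntry (ρbar g) a b)
      (toResidue_commEntry hρ g a b) fun Z hZ => ?_
    · rw [← h5]
      have h7 : (ρ' (S.elt l) - ρ (S.elt l)) (S.row l) (S.col l) = S.err ρ' l - S.err ρ l :=
        (sub_sub_sub_cancel_right _ _ _).symm
      rw [h7, he, he', sub_zero, zero_add]
      exact h4 _ _ _
    · rw [commEntry_apply, hZ, sub_self]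
      rfl
  refine ⟨h6, fun g a b => ?_⟩
  have h7 := sub_mem (h6 g a b) (h4 g a b)
  rwa [← h5, add_sub_cancel_right] at h7

/-- If `ρbar` has only scalar endomorphisms, then the slice meets each orbit only once: an
intertwining matrix can be brought closer and closer to the identity by scalars. -/
theorem eq_of_intertwining (hend : ∀ Z : Matrix (Fin d) (Fin d) (ResidueField 𝔬),
      (∀ g, Z * ρbar g = ρbar g * Z) → ∃ c : ResidueField 𝔬, Z = c • 1)
    (hρ : mapRep (A.toResidue : A →+* ResidueField 𝔬) ρ = ρbar)
    (he : ∀ l, S.err ρ l = 0) (he' : ∀ l, S.err ρ' l = 0) {M : Matrix (Fin d) (Fin d) A}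
    (hM : ∀ g, ρ' g * M = M * ρ g) (hM1 : ∀ a b, (M - 1) a b ∈ maximalIdeal A.carrier) : ρ = ρ' := by
  have hpow : ∀ n, maximalIdeal A.carrier ^ (n + 1) ≤ maximalIdeal A.carrier := fun n =>
    Ideal.pow_le_self n.succ_ne_zero
  have h1 : ∀ n, ∃ M : Matrix (Fin d) (Fin d) A, (∀ g, ρ' g * M = M * ρ g) ∧
      ∀ a b, (M - 1) a b ∈ maximalIdeal A.carrier ^ (n + 1) := by
    intro n
    induction n with
    | zero => exact ⟨M, hM, fun a b => by rw [zero_add, pow_one]; exact hM1 a b⟩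
    | succ n ih =>
      obtain ⟨M, hM, hMn⟩ := ih
      have h2 := (S.mem_mul_of_intertwining hρ he he' (hpow n) hM hMn).1
      obtain ⟨z, hz, hzM⟩ : ∃ z ∈ maximalIdeal A.carrier ^ (n + 1), ∀ a b,
          (M - (1 + z) • (1 : Matrix (Fin d) (Fin d) A)) a b ∈
            maximalIdeal A.carrier ^ (n + 1 + 1) := by
        rcases d with _ | d
        · exact ⟨0, zero_mem _, fun a => a.elim0⟩
        · refine ⟨(M - 1) 0 0, hMn 0 0, fun a b => ?_⟩
          rw [pow_succ _ (n + 1)]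
          have h3 : M - (1 + (M - 1) 0 0) • (1 : Matrix (Fin (d + 1)) (Fin (d + 1)) A) =
              (M - 1) - (M - 1) 0 0 • 1 := by rw [add_smul, one_smul, sub_sub]
          -- the linear form `Z ↦ (Z - Z 0 0 • 1) a b` vanishes on scalars
          let f : Matrix (Fin (d + 1)) (Fin (d + 1)) A →ₗ[A] A :=
            { toFun := fun Z => (Z - Z 0 0 • 1) a b
              map_add' := fun Z Z' => by
                simp only [Matrix.sub_apply, Matrix.add_apply, Matrix.smul_apply, smul_eq_mul]; ring
              map_smul' := fun c Z => by
                simp only [Matrix.sub_apply, Matrix.smul_apply, smul_eq_mul, RingHom.id_apply]; ring }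
          let fbar : Matrix (Fin (d + 1)) (Fin (d + 1)) (ResidueField 𝔬) →ₗ[ResidueField 𝔬]
              ResidueField 𝔬 :=
            { toFun := fun Z => (Z - Z 0 0 • 1) a b
              map_add' := fun Z Z' => by
                simp only [Matrix.sub_apply, Matrix.add_apply, Matrix.smul_apply, smul_eq_mul]; ring
              map_smul' := fun c Z => by
                simp only [Matrix.sub_apply, Matrix.smul_apply, smul_eq_mul, RingHom.id_apply]; ring }
          have h4 : f (M - 1) ∈ maximalIdeal A.carrier ^ (n + 1) * maximalIdeal A.carrier := by
            refine S.linearForm_mem hρ hMn (fun l => h2 _ _ _) f fbar (fun Z => ?_) fun Z hZ => ?_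
            · change A.toResidue ((Z - Z 0 0 • 1) a b) = A.toResidue (Z a b) -
                A.toResidue (Z 0 0) • (1 : Matrix (Fin (d + 1)) (Fin (d + 1)) (ResidueField 𝔬)) a b
              rw [Matrix.sub_apply, Matrix.smul_apply, map_sub, smul_eq_mul, map_mul, smul_eq_mul]
              congr 2
              rw [Matrix.one_apply, Matrix.one_apply]
              split_ifs <;> simp
            · obtain ⟨c, rfl⟩ := hend Z hZ
              change (c • (1 : Matrix (Fin (d + 1)) (Fin (d + 1)) (ResidueField 𝔬)) -
                (c • (1 : Matrix (Fin (d + 1)) (Fin (d + 1)) (ResidueField 𝔬))) 0 0 • 1) a b = 0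
              rw [Matrix.smul_apply, Matrix.one_apply_eq, smul_eq_mul, mul_one, sub_self]
              rfl
          rw [h3]
          exact h4
      obtain ⟨v, hv⟩ : ∃ v, v * (1 + z) = 1 := by
        have h5 : IsUnit (1 - -z) := isUnit_one_sub_self_of_mem_nonunits _
          (neg_mem (hpow n hz) : -z ∈ maximalIdeal A.carrier)
        rw [sub_neg_eq_add] at h5
        exact h5.exists_left_inv
      refine ⟨v • M, fun g => by rw [Matrix.mul_smul, hM, Matrix.smul_mul], fun a b => ?_⟩
      have h5 : v • M - 1 = v • (M - (1 + z) • (1 : Matrix (Fin d) (Fin d) A)) := by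
        rw [smul_sub, smul_smul, hv, one_smul]
      rw [h5, Matrix.smul_apply, smul_eq_mul]
      exact Ideal.mul_mem_left _ _ (hzM a b)
  refine MonoidHom.ext fun g => Matrix.ext fun a b => (sub_eq_zero.1 (eq_zero_of_forall_mem_pow
    fun n => ?_)).symm
  obtain ⟨M, hM, hMn⟩ := h1 n
  have h2 := (S.mem_mul_of_intertwining hρ he he' (hpow n) hM hMn).2 g a b
  rw [← pow_succ] at h2
  exact Ideal.pow_le_pow_right (by omega) h2

end Slice

variable [TopologicalSpace G] {P : DeformationCondition 𝔬 G d} [Finite (ResidueField 𝔬)]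

theorem DeformationCondition.IsLift.conj {ρ : G →* Matrix (Fin d) (Fin d) A}
    (hρ : P.IsLift ρbar A ρ) {U : (Matrix (Fin d) (Fin d) A)ˣ}
    (hU : ∀ a b, ((U : Matrix (Fin d) (Fin d) A) - 1) a b ∈ maximalIdeal A.carrier) :
    P.IsLift ρbar A (conjRep U ρ) where
  red := Slice.red_conjRep hρ.red hU
  holds n := by
    rw [mapRep_conjRep]
    exact P.conj _ (fun g => (conjRep_mul_unit _ _ g).symm) (hρ.holds n)

/-- The universal lift of `ρbar` on the slice. -/
theorem Slice.exists_universal [IsNoetherianRing 𝔬] [IsAdicComplete (maximalIdeal 𝔬) 𝔬]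
    (hbar : P.Holds ρbar) :
    ∃ (R : CompleteLocalAlg 𝔬) (ρ : G →* Matrix (Fin d) (Fin d) R), P.IsLift ρbar R ρ ∧
      (∀ l, S.err ρ l = 0) ∧
      ∀ (B : CompleteLocalAlg 𝔬) (ρ' : G →* Matrix (Fin d) (Fin d) B), P.IsLift ρbar B ρ' →
        (∀ l, S.err ρ' l = 0) → ∃! f : R ⟶ B, mapRep (ringHom f) ρ = ρ' := by
  obtain ⟨R, ρ, hρ, huniv⟩ := DeformationCondition.exists_universal hbar
  have hJ : Ideal.span (Set.range (S.err ρ)) ≤ maximalIdeal R.carrier := by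
    rw [Ideal.span_le]
    rintro _ ⟨l, rfl⟩
    exact S.err_mem hρ.red l
  refine ⟨R.quot _ hJ, mapRep (ringHom (quotMk hJ)) ρ, hρ.map _, fun l => ?_, fun B ρ' hρ' he => ?_⟩
  · rw [S.err_mapRep, quotMk_eq_zero_iff]
    exact Ideal.subset_span ⟨l, rfl⟩
  · obtain ⟨f, hf, hfu⟩ := huniv B ρ' hρ'
    have hf0 : ∀ a ∈ Ideal.span (Set.range (S.err ρ)), ringHom f a = 0 := by
      intro a ha
      refine (Ideal.span_le.2 ?_ : Ideal.span (Set.range (S.err ρ)) ≤ RingHom.ker (ringHom f)) ha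
      rintro _ ⟨l, rfl⟩
      rw [SetLike.mem_coe, RingHom.mem_ker, ← S.err_mapRep, hf, he]
    refine ⟨quotLift hJ f hf0, hf, fun f' hf' => ?_⟩
    have h1 : quotMk hJ ≫ f' = f := hfu _ hf'
    refine hom_ext fun a => ?_
    obtain ⟨a, rfl⟩ := quotMk_surjective hJ a
    subst h1
    rfl

end SliceLifts

/-! ### Deformation functors with conditions -/

section Functors

set_option linter.unusedSectionVars false

variable {𝔬 : Type w} [CommRing 𝔬] [IsLocalRing 𝔬] {G : Type v} [Group G] {d : ℕ}

/-- A representation with values in `GL_d`, as a matrix representation. -/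
def matRep {A : Type w} [CommRing A] (ρ : G →* GL (Fin d) A) : G →* Matrix (Fin d) (Fin d) A :=
  (Units.coeHom _).comp ρ

theorem matRep_injective {A : Type w} [CommRing A] :
    Function.Injective (matRep : (G →* GL (Fin d) A) → G →* Matrix (Fin d) (Fin d) A) := fun _ _ h =>
  MonoidHom.ext fun g => Units.ext (DFunLike.congr_fun h g)

variable [TopologicalSpace G] {P : DeformationCondition 𝔬 G d}
  {ρbar : G →* GL (Fin d) (ResidueField 𝔬)} [Finite (ResidueField 𝔬)] {A B : CompleteLocalAlg 𝔬}

theorem matRep_map (f : A ⟶ B) (ρ : FramedDeformation ρbar A) :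
    matRep (FramedDeformation.map f ρ).1 = mapRep (ringHom f) (matRep ρ.1) := rfl

theorem FramedDeformation.red (ρ : FramedDeformation ρbar A) :
    mapRep (A.toResidue : A →+* ResidueField 𝔬) (matRep ρ.1) = matRep ρbar :=
  MonoidHom.ext fun g => Matrix.ext fun i j => A.residueMap_bijective.1 (by
    have h1 := congrArg (fun M : GL (Fin d) (ResidueField A.carrier) =>
      (M : Matrix (Fin d) (Fin d) (ResidueField A.carrier)) i j) (DFunLike.congr_fun ρ.2.2 g)
    exact (A.residueMap_toResidue _).trans h1)

/-- A lift satisfying a deformation condition is continuous. -/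
theorem DeformationCondition.IsLift.adicContinuous [IsTopologicalGroup G]
    {ρ : G →* Matrix (Fin d) (Fin d) A} {ρbar : G →* Matrix (Fin d) (Fin d) (ResidueField 𝔬)}
    (hρ : P.IsLift ρbar A ρ) : AdicContinuous (A := A) ρ.toHomUnits := by
  let : TopologicalSpace A := (maximalIdeal A.carrier).adicTopology
  have h1 : Continuous fun g => ρ g := by
    refine continuous_matrix fun i j => continuous_iff_continuousAt.2 fun g₀ => ?_
    rw [ContinuousAt, ((maximalIdeal A.carrier).hasBasis_nhds_adic (ρ g₀ i j)).tendsto_right_iff]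
    intro n _
    have h2 := (P.isOpen (hρ.holds n)).preimage (continuous_const_mul g₀⁻¹)
    refine Filter.mem_of_superset (h2.mem_nhds (x := g₀) ?_) fun g hg => ?_
    · rw [Set.mem_preimage, Set.mem_ofPred_eq, inv_mul_cancel, map_one]
    · rw [Set.mem_preimage, Set.mem_ofPred_eq] at hg
      refine ⟨ρ g i j - ρ g₀ i j, ?_, add_sub_cancel _ _⟩
      refine (Ideal.Quotient.mk_eq_mk_iff_sub_mem _ _).1 ?_
      have h3 : mapRep (Ideal.Quotient.mk (maximalIdeal A.carrier ^ n)) ρ g =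
          mapRep (Ideal.Quotient.mk (maximalIdeal A.carrier ^ n)) ρ g₀ := by
        conv_lhs => rw [← mul_inv_cancel_left g₀ g, map_mul, hg, mul_one]
      exact congrFun (congrFun h3 i) j
  exact Units.continuous_iff.2 ⟨h1, h1.comp continuous_inv⟩

/-- The framed deformation given by a lift satisfying a deformation condition. -/
def DeformationCondition.IsLift.toFramed [IsTopologicalGroup G]
    {ρ : G →* Matrix (Fin d) (Fin d) A} (hρ : P.IsLift (matRep ρbar) A ρ) :
    FramedDeformation ρbar A :=
  ⟨ρ.toHomUnits, hρ.adicContinuous, MonoidHom.ext fun g => Units.ext (Matrix.ext fun i j => by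
    have h1 : A.toResidue (ρ g i j) = (ρbar g : Matrix (Fin d) (Fin d) (ResidueField 𝔬)) i j :=
      congrFun (congrFun (DFunLike.congr_fun hρ.red g) i) j
    exact (A.residueMap_toResidue _).symm.trans (congrArg A.residueMap h1))⟩

theorem DeformationCondition.IsLift.matRep_toFramed [IsTopologicalGroup G]
    {ρ : G →* Matrix (Fin d) (Fin d) A} (hρ : P.IsLift (matRep ρbar) A ρ) :
    matRep hρ.toFramed.1 = ρ := rfl

theorem mk_eq_mk_iff {ρ ρ' : FramedDeformation ρbar A} :
    (Quotient.mk (deformationSetoid ρbar A) ρ = Quotient.mk _ ρ') ↔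
      ∃ U : (Matrix (Fin d) (Fin d) A)ˣ,
        (∀ a b, ((U : Matrix (Fin d) (Fin d) A) - 1) a b ∈ maximalIdeal A.carrier) ∧
        matRep ρ'.1 = conjRep U (matRep ρ.1) := by
  rw [Quotient.eq]
  refine exists_congr fun U => and_congr ?_ ?_
  · rw [← mapMatrix_toResidue_eq_one_iff]
    have h1 : ∀ a b, A.residueMap ((A.toResidue : A →+* ResidueField 𝔬).mapMatrix
        (U : Matrix (Fin d) (Fin d) A) a b) =
        (Matrix.GeneralLinearGroup.map (residue A.carrier) U : Matrix (Fin d) (Fin d) _) a b :=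
      fun a b => A.residueMap_toResidue _
    constructor
    · intro h
      ext a b
      refine A.residueMap_bijective.1 ((h1 a b).trans ?_)
      rw [h]
      by_cases hab : a = b <;> simp [Matrix.one_apply, hab]
    · intro h
      refine Units.ext (Matrix.ext fun a b => (h1 a b).symm.trans ?_)
      rw [h]
      by_cases hab : a = b <;> simp [Matrix.one_apply, hab]
  · exact ⟨fun h => MonoidHom.ext fun g => congrArg Units.val (h g),
      fun h g => Units.ext (DFunLike.congr_fun h g)⟩

variable (P ρbar)

/-- The subfunctor of framed deformations satisfying the condition `P`. -/
def DeformationCondition.framedSubfunctor : Subfunctor (framedFunctor ρbar) where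
  obj A := {ρ : FramedDeformation ρbar A | P.IsLift (matRep ρbar) A (matRep ρ.1)}
  map f _ hρ := DeformationCondition.IsLift.map f hρ

/-- The subfunctor of deformations satisfying the condition `P`. -/
def DeformationCondition.subfunctor : Subfunctor (deformationFunctor ρbar) where
  obj A := Quotient.mk (deformationSetoid ρbar A) ''
    {ρ : FramedDeformation ρbar A | P.IsLift (matRep ρbar) A (matRep ρ.1)}
  map := by
    rintro A B f _ ⟨ρ, hρ, rfl⟩
    exact ⟨FramedDeformation.map f ρ, DeformationCondition.IsLift.map f hρ, rfl⟩

variable {P ρbar}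

theorem mk_mem_subfunctor_iff {ρ : FramedDeformation ρbar A} :
    (Quotient.mk (deformationSetoid ρbar A) ρ ∈ (P.subfunctor ρbar).obj A) ↔
      P.IsLift (matRep ρbar) A (matRep ρ.1) := by
  constructor
  · rintro ⟨ρ', hρ', h⟩
    obtain ⟨U, hU, he⟩ := mk_eq_mk_iff.1 h
    rw [he]
    exact DeformationCondition.IsLift.conj hρ' hU
  · exact fun h => ⟨ρ, h, rfl⟩

theorem relRepresentable_framedSubfunctor (hbar : P.Holds (matRep ρbar)) :
    RelRepresentableBySurjections (P.framedSubfunctor ρbar) := fun _ (ρ : FramedDeformation ρbar _) =>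
  P.exists_quotient hbar (matRep ρ.1) ρ.red

theorem relRepresentable_subfunctor (hbar : P.Holds (matRep ρbar)) :
    RelRepresentableBySurjections (P.subfunctor ρbar) := fun A x => by
  obtain ⟨ρ, rfl⟩ := Quotient.exists_rep x
  obtain ⟨A', π, hπ, h⟩ := P.exists_quotient hbar (matRep ρ.1) ρ.red
  exact ⟨A', π, hπ, fun B f => (mk_mem_subfunctor_iff (ρ := FramedDeformation.map f ρ)).trans (h B f)⟩

theorem isCorepresentable_of_bijective {D : CompleteLocalAlg 𝔬 ⥤ Type t} {R : CompleteLocalAlg 𝔬}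
    (ξ : D.obj R) (h : ∀ B, Function.Bijective fun f : R ⟶ B => D.map f ξ) : D.IsCorepresentable :=
  Functor.CorepresentableBy.isCorepresentable (X := R)
    { homEquiv := fun {B} => Equiv.ofBijective _ (h B)
      homEquiv_comp := fun g f => by
        change D.map (f ≫ g) ξ = D.map g (D.map f ξ)
        rw [D.map_comp]
        rfl }

variable [IsTopologicalGroup G] [IsNoetherianRing 𝔬] [IsAdicComplete (maximalIdeal 𝔬) 𝔬]

theorem isCorepresentable_framedSubfunctor (hbar : P.Holds (matRep ρbar)) :
    (P.framedSubfunctor ρbar).toFunctor.IsCorepresentable := by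
  obtain ⟨R, ρ, hρ, h⟩ := DeformationCondition.exists_universal hbar
  refine isCorepresentable_of_bijective (R := R)
    (⟨hρ.toFramed, hρ⟩ : (P.framedSubfunctor ρbar).toFunctor.obj R) fun B => ⟨fun f f' hff => ?_, ?_⟩
  · have h1 : mapRep (ringHom f) ρ = mapRep (ringHom f') ρ :=
      congrArg (fun x : (P.framedSubfunctor ρbar).toFunctor.obj B =>
        matRep (show FramedDeformation ρbar B from x.1).1) hff
    exact (h B _ (hρ.map f)).unique rfl h1.symm
  · rintro ⟨ρ', hρ'⟩
    obtain ⟨f, hf, -⟩ := h B _ hρ'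
    exact ⟨f, Subtype.ext (Subtype.ext (matRep_injective hf))⟩

theorem mul_maximalIdeal_dualNumbers :
    maximalIdeal (dualNumbers 𝔬).carrier * maximalIdeal (dualNumbers 𝔬).carrier = ⊥ := by
  change maximalIdeal (DualNumber (ResidueField 𝔬)) * maximalIdeal (DualNumber (ResidueField 𝔬)) = ⊥
  rw [← pow_two, DualNumber.maximalIdeal_eq_span_singleton_eps, Ideal.span_singleton_pow, pow_two,
    DualNumber.eps_mul_eps, Ideal.span_singleton_zero]

section SliceFunctor

variable (S : Slice (matRep ρbar)) {R : CompleteLocalAlg 𝔬} {ρ : FramedDeformation ρbar R}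

/-- Every deformation is represented by a lift on the slice. -/
theorem exists_map_mk_eq
    (huniv : ∀ (B : CompleteLocalAlg 𝔬) (ρ' : G →* Matrix (Fin d) (Fin d) B),
      P.IsLift (matRep ρbar) B ρ' → (∀ l, S.err ρ' l = 0) →
        ∃! f : R ⟶ B, mapRep (ringHom f) (matRep ρ.1) = ρ')
    {ρ' : FramedDeformation ρbar B} (hρ' : P.IsLift (matRep ρbar) B (matRep ρ'.1))
    {K : Ideal B} (hK : K ≤ maximalIdeal B.carrier) (h : ∀ l, S.err (matRep ρ'.1) l ∈ K) :
    ∃ (f : R ⟶ B) (U : (Matrix (Fin d) (Fin d) B)ˣ),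
      (∀ a b, ((U : Matrix (Fin d) (Fin d) B) - 1) a b ∈ K) ∧
      mapRep (ringHom f) (matRep ρ.1) = conjRep U (matRep ρ'.1) ∧
      (Quotient.mk (deformationSetoid ρbar B) (FramedDeformation.map f ρ) = Quotient.mk _ ρ') := by
  obtain ⟨U, hU, he⟩ := S.exists_conj_err_eq_zero hρ'.red hK h
  have hU' : ∀ a b, ((U : Matrix (Fin d) (Fin d) B) - 1) a b ∈ maximalIdeal B.carrier :=
    fun a b => hK (hU a b)
  obtain ⟨f, hf, -⟩ := huniv B _ (hρ'.conj hU') he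
  exact ⟨f, U, hU, hf,
    ((mk_eq_mk_iff (ρ := ρ') (ρ' := FramedDeformation.map f ρ)).2 ⟨U, hU', hf⟩).symm⟩

/-- The universal lift on a slice is a hull of the functor of deformations. -/
theorem hasHull_subfunctor (hbar : P.Holds (matRep ρbar)) :
    HasHull (P.subfunctor ρbar).toFunctor := by
  obtain ⟨S⟩ := exists_slice (matRep ρbar)
  obtain ⟨R, ρ, hρ, he, huniv⟩ := S.exists_universal hbar
  have heq : ∀ {B : CompleteLocalAlg 𝔬} {f f' : R ⟶ B},
      mapRep (ringHom f) ρ = mapRep (ringHom f') ρ → f = f' := fun {B f f'} h =>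
    (huniv B _ (hρ.map f) fun l => by rw [S.err_mapRep, he, map_zero]).unique rfl h.symm
  refine ⟨R, ⟨Quotient.mk _ hρ.toFramed, mk_mem_subfunctor_iff.2 hρ⟩, ⟨?_, ?_, ?_⟩⟩
  · rintro B A _ _ p hp f ⟨_, ρ', hρ', rfl⟩ hy
    replace hρ' : P.IsLift (matRep ρbar) B (matRep ρ'.1) := hρ'
    have hy' : Quotient.mk (deformationSetoid ρbar A) (FramedDeformation.map p ρ') =
      Quotient.mk _ (FramedDeformation.map f hρ.toFramed) := congrArg Subtype.val hy
    obtain ⟨U, hU, hUe⟩ := mk_eq_mk_iff.1 hy'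
    rw [matRep_map, matRep_map, hρ.matRep_toFramed] at hUe
    -- conjugate so that `ρ'` maps to the specialization of the universal lift
    choose V hV using fun a b => hp ((U : Matrix (Fin d) (Fin d) A) a b)
    have hV1 : ∀ a b, (Matrix.of V - 1 : Matrix (Fin d) (Fin d) B) a b ∈ maximalIdeal B.carrier := by
      intro a b
      rw [← toResidue_eq_zero_iff, ← toResidue_ringHom p, toResidue_eq_zero_iff]
      have h1 : ringHom p ((Matrix.of V - 1 : Matrix (Fin d) (Fin d) B) a b) =
          ((U : Matrix (Fin d) (Fin d) A) - 1) a b := by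
        rw [Matrix.sub_apply, Matrix.sub_apply, map_sub, Matrix.of_apply, hV, Matrix.one_apply,
          Matrix.one_apply]
        split_ifs <;> simp
      rw [h1]
      exact hU a b
    obtain ⟨W, hW⟩ := isUnit_of_sub_one_mem hV1
    rw [← hW] at hV1
    have hWU : Units.map ((ringHom p).mapMatrix : Matrix (Fin d) (Fin d) B →+* _).toMonoidHom W = U :=
      Units.ext (Matrix.ext fun a b => by
        change ringHom p ((W : Matrix (Fin d) (Fin d) B) a b) = _
        rw [hW]
        exact hV a b)
    have hρ₁ := hρ'.conj hV1
    have h1 : mapRep (ringHom p) (conjRep W (matRep ρ'.1)) = mapRep (ringHom f) ρ := by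
      rw [mapRep_conjRep, hWU, hUe]
    obtain ⟨f', X, hX, hf', hmk⟩ := exists_map_mk_eq (P := P) (ρ := hρ.toFramed) S huniv
      (ρ' := hρ₁.toFramed) hρ₁ (K := RingHom.ker (ringHom p)) (le_maximalIdeal (RingHom.ker_ne_top _))
      fun l => by
        rw [RingHom.mem_ker, ← S.err_mapRep, hρ₁.matRep_toFramed, h1, S.err_mapRep, he, map_zero]
    refine ⟨f', heq ?_, Subtype.ext (hmk.trans (mk_eq_mk_iff.2 ⟨W, hV1, rfl⟩).symm)⟩
    have hXp : Units.map ((ringHom p).mapMatrix : Matrix (Fin d) (Fin d) B →+* _).toMonoidHom X = 1 :=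
      Units.ext (Matrix.ext fun a b => by
        have h2 := (RingHom.mem_ker).1 (hX a b)
        rw [Matrix.sub_apply, map_sub, sub_eq_zero] at h2
        refine h2.trans ?_
        rw [Units.val_one, Matrix.one_apply, Matrix.one_apply]
        split_ifs <;> simp)
    have h2 : mapRep (ringHom (f' ≫ p)) ρ = mapRep (ringHom p) (mapRep (ringHom f') ρ) := rfl
    have h3 : mapRep (ringHom f') ρ = conjRep X (conjRep W (matRep ρ'.1)) := hf'
    rw [h2, h3, mapRep_conjRep, hXp, conjRep_one, h1]
  · intro f f' hff
    have h1 : Quotient.mk (deformationSetoid ρbar (dualNumbers 𝔬))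
        (FramedDeformation.map f hρ.toFramed) =
      Quotient.mk _ (FramedDeformation.map f' hρ.toFramed) := congrArg Subtype.val hff
    obtain ⟨U, hU, hUe⟩ := mk_eq_mk_iff.1 h1
    rw [matRep_map, matRep_map, hρ.matRep_toFramed] at hUe
    have h2 := (S.mem_mul_of_intertwining (hρ.map f).red
      (fun l => by rw [S.err_mapRep, he, map_zero]) (ρ' := mapRep (ringHom f') ρ)
      (fun l => by rw [S.err_mapRep, he, map_zero]) le_rfl (fun g => by
        rw [hUe]; exact conjRep_mul_unit U _ g) hU).2
    rw [mul_maximalIdeal_dualNumbers] at h2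
    exact heq (MonoidHom.ext fun g => Matrix.ext fun a b => (sub_eq_zero.1 (h2 g a b)).symm)
  · rintro ⟨_, ρ', hρ', rfl⟩
    replace hρ' : P.IsLift (matRep ρbar) _ (matRep ρ'.1) := hρ'
    obtain ⟨f, -, -, -, hmk⟩ := exists_map_mk_eq (P := P) (ρ := hρ.toFramed) S huniv hρ' le_rfl
      (S.err_mem hρ'.red)
    exact ⟨f, Subtype.ext hmk⟩

/-- If only scalars commute with `ρbar`, then conjugate lifts on a slice are equal, and the
universal lift on the slice represents the functor of deformations. -/
theorem isCorepresentable_subfunctor (hbar : P.Holds (matRep ρbar))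
    (hend : ∀ Z : Matrix (Fin d) (Fin d) (ResidueField 𝔬),
      (∀ g, Z * matRep ρbar g = matRep ρbar g * Z) → ∃ c : ResidueField 𝔬, Z = c • 1) :
    (P.subfunctor ρbar).toFunctor.IsCorepresentable := by
  obtain ⟨S⟩ := exists_slice (matRep ρbar)
  obtain ⟨R, ρ, hρ, he, huniv⟩ := S.exists_universal hbar
  refine isCorepresentable_of_bijective (R := R)
    (⟨Quotient.mk _ hρ.toFramed, mk_mem_subfunctor_iff.2 hρ⟩ : (P.subfunctor ρbar).toFunctor.obj R)
    fun B => ⟨fun f f' hff => ?_, ?_⟩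
  · have h1 : Quotient.mk (deformationSetoid ρbar B) (FramedDeformation.map f hρ.toFramed) =
      Quotient.mk _ (FramedDeformation.map f' hρ.toFramed) := congrArg Subtype.val hff
    obtain ⟨U, hU, hUe⟩ := mk_eq_mk_iff.1 h1
    rw [matRep_map, matRep_map, hρ.matRep_toFramed] at hUe
    have he' : ∀ (f : R ⟶ B) l, S.err (mapRep (ringHom f) ρ) l = 0 := fun f l => by
      rw [S.err_mapRep, he, map_zero]
    have h2 := S.eq_of_intertwining hend (hρ.map f).red (he' f) (ρ' := mapRep (ringHom f') ρ) (he' f')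
      (fun g => by rw [hUe]; exact conjRep_mul_unit U _ g) hU
    exact (huniv B _ (hρ.map f) (he' f)).unique rfl h2.symm
  · rintro ⟨_, ρ', hρ', rfl⟩
    replace hρ' : P.IsLift (matRep ρbar) _ (matRep ρ'.1) := hρ'
    obtain ⟨f, -, -, -, hmk⟩ := exists_map_mk_eq (P := P) (ρ := hρ.toFramed) S huniv hρ' le_rfl
      (S.err_mem hρ'.red)
    exact ⟨f, Subtype.ext hmk⟩

end SliceFunctor

end Functors

end EqCharDeformation

/-! ### Deformations of height `≤ h` -/

namespace EqCharDeformation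

section HeightDeformations

variable {Fq : Type u} [Field Fq] [Fintype Fq] {k : Type v} [Field k] [Algebra Fq k]
  {ι : PowerSeries Fq →ₐ[Fq] PowerSeries k} {h : ℕ} {𝔬 : Type w} [CommRing 𝔬]
  [Algebra (PowerSeries Fq) 𝔬] {d : ℕ}

theorem matRepHeightLE_matRep_iff {B : Type w} [CommRing B] [Algebra 𝔬 B]
    (ρ : GK k →* GL (Fin d) B) : MatRepHeightLE ι h 𝔬 (matRep ρ) ↔ RepHeightLE ι h 𝔬 ρ := by
  have h1 : (matRep ρ).toHomUnits = ρ := MonoidHom.ext fun g => Units.ext rfl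
  rw [MatRepHeightLE, h1]

variable [Finite k] [IsLocalRing 𝔬] [Finite (ResidueField 𝔬)]
  [IsLocalHom (algebraMap (PowerSeries Fq) 𝔬)]

theorem isLift_heightCondition_iff (hu : ι PowerSeries.X ≠ 0)
    {ρbar : GK k →* GL (Fin d) (ResidueField 𝔬)} {A : CompleteLocalAlg 𝔬}
    (ρ : FramedDeformation ρbar A) :
    (heightCondition (𝔬 := 𝔬) hu h d).IsLift (matRep ρbar) A (matRep ρ.1) ↔ ρ.HeightLE ι h :=
  ⟨fun hρ n => (matRepHeightLE_matRep_iff ((Matrix.GeneralLinearGroup.map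
      (Ideal.Quotient.mk (maximalIdeal A.carrier ^ n))).comp ρ.1)).1 (hρ.holds n),
    fun hρ => ⟨ρ.red, fun n => (matRepHeightLE_matRep_iff ((Matrix.GeneralLinearGroup.map
      (Ideal.Quotient.mk (maximalIdeal A.carrier ^ n))).comp ρ.1)).2 (hρ n)⟩⟩

end HeightDeformations

end EqCharDeformation

theorem theorem6
    -- the finite fields `𝔽_q ⊆ k`, and the finite map `ι : 𝔽_q[[π₀]] → k[[u]]`
    {Fq : Type u} [Field Fq] [Fintype Fq] {k : Type v} [Field k] [Finite k] [Algebra Fq k]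
    (ι : PowerSeries Fq →ₐ[Fq] PowerSeries k) (hι : (ι : PowerSeries Fq →+* PowerSeries k).Finite)
    (h : ℕ)
    -- the coefficient ring `𝔬`, with finite residue field
    {𝔬 : Type w} [CommRing 𝔬] [IsDomain 𝔬] [IsDiscreteValuationRing 𝔬]
    [IsAdicComplete (maximalIdeal 𝔬) 𝔬] [Finite (ResidueField 𝔬)]
    [Algebra (PowerSeries Fq) 𝔬] [IsLocalHom (algebraMap (PowerSeries Fq) 𝔬)]
    -- the residual representation
    {d : ℕ} (ρbar : GK k →* GL (Fin d) (ResidueField 𝔬)) (hcont : AdicContinuous ρbar)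
    (hheight : RepHeightLE ι h 𝔬 ρbar) :
    -- deformations and framed deformations of height `≤ h` form subfunctors
    ∃ (D : Subfunctor (deformationFunctor ρbar)) (Dbox : Subfunctor (framedFunctor ρbar)),
      D.obj = deformationHeightLE ι h ρbar ∧ Dbox.obj = framedHeightLE ι h ρbar ∧
      HasHull D.toFunctor ∧
      (Nonempty (endAlgebra ρbar ≃ₐ[ResidueField 𝔬] ResidueField 𝔬) →
        D.toFunctor.IsCorepresentable) ∧
      Dbox.toFunctor.IsCorepresentable ∧
      RelRepresentableBySurjections D ∧ RelRepresentableBySurjections Dbox := by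
  let P := heightCondition (𝔬 := 𝔬) (map_X_ne_zero ι hι) h d
  have hbar : P.Holds (matRep ρbar) := (matRepHeightLE_matRep_iff ρbar).2 hheight
  refine ⟨P.subfunctor ρbar, P.framedSubfunctor ρbar, ?_, ?_, hasHull_subfunctor hbar, fun ⟨e⟩ => ?_,
    isCorepresentable_framedSubfunctor hbar, relRepresentable_subfunctor hbar,
    relRepresentable_framedSubfunctor hbar⟩
  · exact funext fun A => congrArg (Quotient.mk (deformationSetoid ρbar A) '' ·)
      (Set.ext fun ρ => isLift_heightCondition_iff (map_X_ne_zero ι hι) ρ)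
  · exact funext fun A => Set.ext fun ρ => isLift_heightCondition_iff (map_X_ne_zero ι hι) ρ
  · refine isCorepresentable_subfunctor hbar fun Z hZ => ?_
    have hmem : Z ∈ endAlgebra ρbar := (Subalgebra.mem_centralizer_iff _).2 (by
      rintro _ ⟨g, rfl⟩
      exact (hZ g).symm)
    refine ⟨e ⟨Z, hmem⟩, ?_⟩
    have h1 : (⟨Z, hmem⟩ : endAlgebra ρbar) = algebraMap _ _ (e ⟨Z, hmem⟩) :=
      e.injective (by rw [AlgEquiv.commutes]; rfl)
    refine (congrArg Subtype.val h1).trans ?_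
    exact Algebra.algebraMap_eq_smul_one _
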